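/- Let $K$ be a field. A Lie superalgebra over $K$ is a $\mathbb Z_2$-graded vector space $L=L_0\oplus L_1$ with a bilinear bracket such that $[L_\alpha,L_\beta]\subseteq L_{\alpha+\beta}$, $[a,b]=-(-1)^{\alpha\beta}[b,a]$ and $[a,[b,c]]=[[a,b],c]+(-1)^{\alpha\beta}[b,[a,c]]$ for $a\in L_\alpha$, $b\in L_\beta$, $c\in L$. A LieSupAct triple $(\mathfrak g,\mathfrak h,\rho)$ consists of Lie superalgebras $(\mathfrak g,\pi)$, $(\mathfrak h,\mu)$ and a morphism of Lie superalgebras $\rho:\mathfrak g\to\mathrm{Der}(\mathfrak h)$ of degree $0$, where $\mathrm{Der}(\mathfrak h)$ is the Lie superalgebra of superderivations of $\mathfrak h$ with the supercommutator bracket. For a $\mathbb Z_2$-graded vector space $V$, let $\mathrm{Hom}(\wedge^nV,V)$ be the space of $n$-linear maps $F:V^n\to V$ with $\sigma.F=F$ for all $\sigma\in S_n$. Here, for homogeneous $X_1,\dots,X_n$, $$(\sigma.F)(X_1,\dots,X_n)=\mathrm{sgn}(\sigma)(-1)^{k}F(X_{\sigma(1)},\dots,X_{\sigma(n)}),$$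 where $k$ is the number of pairs $i<j$ with $\sigma(j)<\sigma(i)$ and $X_{\sigma(i)},X_{\sigma(j)}$ both odd. An element of $\mathrm{Hom}(\wedge^{n+1}V,V)$ that is homogeneous of parity $f$ has degree $(n,f)\in\mathbb Z\times\mathbb Z_2$. For $F$ of degree $(n,f)$ and $F'$ of degree $(n',f')$ put $$(F*F')(X_1,\dots,X_{n+n'+1})=(-1)^{f'(|X_1|+\cdots+|X_n|)}F(X_1,\dots,X_n,F'(X_{n+1},\dots,X_{n+n'+1})),$$ $$F\circ F'=\sum_{\sigma}\sigma.(F*F'),\qquad [F,F']=F\circ F'-(-1)^{nn'+ff'}F'\circ F,$$ where $\sigma$ runs over the $\sigma\in S_{n+n'+1}$ with $\sigma(1)<\cdots<\sigma(n)$ and $\sigma(n+1)<\cdots<\sigma(n+n'+1)$. The bracket is extended bilinearly to $\bigoplus_{s\ge0}\mathrm{Hom}(\wedge^{s+1}V,V)$. Let $V=\mathfrak g\oplus\mathfrak h$. For $i+j=n$ and $W\in\{\mathfrak g,\mathfrak h\}$, regard $\mathrm{Hom}(\wedge^i\mathfrak g\otimes\wedge^j\mathfrak h,W)$ as the subspace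 of $\mathrm{Hom}(\wedge^{n}V,V)$ of the maps with values in $W$ that vanish on every $n$-tuple of elements of $\mathfrak g\cup\mathfrak h$ in which the number of entries taken from $\mathfrak h$ is not $j$. Set $$C^n(\mathfrak g,\mathfrak h,\rho)=\mathrm{Hom}(\wedge^n\mathfrak g,\mathfrak g)\oplus\bigoplus_{i=0}^{n-1}\mathrm{Hom}(\wedge^i\mathfrak g\otimes\wedge^{n-i}\mathfrak h,\mathfrak h)\quad(n\ge1),\qquad C^0=0,\qquad \mathfrak F=\bigoplus_{n\ge1}C^n(\mathfrak g,\mathfrak h,\rho),$$ so that $C^{s+1}$ has first degree $s$ in $\mathfrak F$. Let $\Pi=\pi+\rho+\mu$, that is, for homogeneous $x+y,\ x'+y'\in\mathfrak g\oplus\mathfrak h$ of parities $\alpha,\beta$, $$\Pi(x+y,x'+y')=\pi(x,x')+\rho(x)y'-(-1)^{\alpha\beta}\rho(x')y+\mu(y,y').$$ **Theorem.** Let $(\mathfrak g,\mathfrak h,\rho)$ be a LieSupAct triple. Then $\mathfrak F$ is closed under $[\cdot,\cdot]$; $\Pi$ is a Maurer–Cartan element of $\mathfrak F$, i.e. $\Pi\in\mathfrak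 F$ has degree $(1,0)$ and $[\Pi,\Pi]=0$; and $(\mathfrak F,[\cdot,\cdot],\partial_\Pi)$ with $\partial_\Pi=[\Pi,\cdot]$ is a differential $\mathbb Z\times\mathbb Z_2$-graded Lie algebra. Explicitly, $\mathfrak F$ is the direct sum of its components of degrees $p\in\mathbb Z\times\mathbb Z_2$, and for $x$ of degree $p=(p_1,p_2)$, $y$ of degree $q=(q_1,q_2)$ and $z\in\mathfrak F$, with $\langle p,q\rangle=p_1q_1+p_2q_2$: - $[x,y]$ has degree $p+q$ and $[x,y]=-(-1)^{\langle p,q\rangle}[y,x]$; - $[x,[y,z]]=[[x,y],z]+(-1)^{\langle p,q\rangle}[y,[x,z]]$; - $\partial_\Pi x$ has degree $p+(1,0)$ and $\partial_\Pi[x,z]=[\partial_\Pi x,z]+(-1)^{p_1}[x,\partial_\Pi z]$; - $\partial_\Pi^2=0$. Consequently $\partial_\Pi$ maps $C^n(\mathfrak g,\mathfrak h,\rho)$ to $C^{n+1}(\mathfrak g,\mathfrak h,\rho)$ and makes $C^*(\mathfrak g,\mathfrak h,\rho)$ a cochain complex, whose $n$-th cohomology is $$H^n(\mathfrak g,\mathfrak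 h,\rho)=\{a\in C^n:[\Pi,a]=0\}\,/\,[\Pi,C^{n-1}]$$ (with $C^{-1}=0$). -/

import Mathlib

namespace LieSup

section General

/-- The sign `(-1)^α` for `α ∈ ℤ/2`. -/
def sgn (K : Type*) [Field K] (α : ZMod 2) : K := (-1) ^ α.val

variable {K : Type*} [Field K] {V : Type*} [AddCommGroup V] [Module K V]

/-- The projection of a `ℤ/2`-graded vector space onto its component of degree `α`. -/
noncomputable def proj (𝒱 : ZMod 2 → Submodule K V) [DirectSum.Decomposition 𝒱] (α : ZMod 2) :
    V →ₗ[K] V :=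
  (𝒱 α).subtype ∘ₗ DirectSum.component K (ZMod 2) (fun i => 𝒱 i) α ∘ₗ
    (DirectSum.decomposeLinearEquiv 𝒱).toLinearMap

/-- Lie superalgebra structure, given by the bracket `m`, on a `ℤ/2`-graded vector space. -/
structure IsLieSuperalgebra (𝒱 : ZMod 2 → Submodule K V) (m : V →ₗ[K] V →ₗ[K] V) : Prop where
  degree : ∀ (α β : ZMod 2) (a b : V), a ∈ 𝒱 α → b ∈ 𝒱 β → m a b ∈ 𝒱 (α + β)
  skew : ∀ (α β : ZMod 2) (a b : V), a ∈ 𝒱 α → b ∈ 𝒱 β → m a b = -(sgn K (α * β) • m b a)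
  jacobi : ∀ (α β : ZMod 2) (a b c : V), a ∈ 𝒱 α → b ∈ 𝒱 β →
    m a (m b c) = m (m a b) c + sgn K (α * β) • m b (m a c)

/-- `D` is a derivation of degree `s` of the superalgebra `(V, m)`, i.e. `D ∈ Der_s(V)`. -/
structure IsSuperDerivation (𝒱 : ZMod 2 → Submodule K V) (m : V →ₗ[K] V →ₗ[K] V)
    (s : ZMod 2) (D : Module.End K V) : Prop where
  degree : ∀ (α : ZMod 2) (a : V), a ∈ 𝒱 α → D a ∈ 𝒱 (s + α)
  leibniz : ∀ (α : ZMod 2) (a b : V), a ∈ 𝒱 α →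
    D (m a b) = m (D a) b + sgn K (s * α) • m a (D b)

/-- The triple `(g, h, ρ)`: Lie superalgebras `(g, π)`, `(h, μ)` and a morphism of Lie
superalgebras `ρ : g → Der(h)` of degree `0`. -/
structure IsLieSupAct {g h : Type*} [AddCommGroup g] [Module K g] [AddCommGroup h] [Module K h]
    (𝒢 : ZMod 2 → Submodule K g) (ℋ : ZMod 2 → Submodule K h)
    (π : g →ₗ[K] g →ₗ[K] g) (μ : h →ₗ[K] h →ₗ[K] h) (ρ : g →ₗ[K] Module.End K h) : Prop where
  left : IsLieSuperalgebra 𝒢 π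
  right : IsLieSuperalgebra ℋ μ
  der : ∀ (α : ZMod 2) (x : g), x ∈ 𝒢 α → IsSuperDerivation ℋ μ α (ρ x)
  map_bracket : ∀ (α β : ZMod 2) (x y : g), x ∈ 𝒢 α → y ∈ 𝒢 β →
    ρ (π x y) = ρ x * ρ y - sgn K (α * β) • (ρ y * ρ x)

/-! ### Multilinear maps on a `ℤ/2`-graded vector space -/

/-- For homogeneous arguments of degrees `d`, the sign
`ε(σ) (-1)^#{(i,j) | i < j, d (σ i) = d (σ j) = 1, σ j < σ i}`. -/
def eps (K : Type*) [Field K] {n : ℕ} (σ : Equiv.Perm (Fin n)) (d : Fin n → ZMod 2) : K :=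
  ((Equiv.Perm.sign σ : ℤ) : K) *
    (-1) ^ (Finset.univ.filter fun p : Fin n × Fin n =>
      p.1 < p.2 ∧ d (σ p.1) = 1 ∧ d (σ p.2) = 1 ∧ σ p.2 < σ p.1).card

/-- The action of a permutation on `n`-linear maps. On homogeneous arguments
`(σ.F)(X₁, …, Xₙ) = ε(σ, X) F(X_{σ 1}, …, X_{σ n})`; the sum over all degree vectors `d` extends
this multilinearly to all arguments. -/
noncomputable def permAct (𝒱 : ZMod 2 → Submodule K V) [DirectSum.Decomposition 𝒱] {n : ℕ}
    (σ : Equiv.Perm (Fin n)) :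
    MultilinearMap K (fun _ : Fin n => V) V →ₗ[K] MultilinearMap K (fun _ : Fin n => V) V where
  toFun F := ∑ d : Fin n → ZMod 2,
    eps K σ d • (F.compLinearMap fun i => proj 𝒱 (d (σ i))).domDomCongr σ
  map_add' F G := by
    rw [← Finset.sum_add_distrib]
    refine Finset.sum_congr rfl fun d _ => ?_
    ext v
    simp
  map_smul' c F := by
    rw [RingHom.id_apply, Finset.smul_sum]
    refine Finset.sum_congr rfl fun d _ => ?_
    ext v
    simp [smul_smul, mul_comm]

/-- `Hom(⋀ⁿ V, V)`: the `n`-linear maps with `σ.F = F` for all `σ`. -/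
noncomputable def superAlt (𝒱 : ZMod 2 → Submodule K V) [DirectSum.Decomposition 𝒱] (n : ℕ) :
    Submodule K (MultilinearMap K (fun _ : Fin n => V) V) :=
  ⨅ σ : Equiv.Perm (Fin n), LinearMap.ker (permAct 𝒱 σ - LinearMap.id)

/-- The `n`-linear maps that are homogeneous of degree `β ∈ ℤ/2`. -/
def homogeneous (𝒱 : ZMod 2 → Submodule K V) (n : ℕ) (β : ZMod 2) :
    Submodule K (MultilinearMap K (fun _ : Fin n => V) V) where
  carrier := {F | ∀ (d : Fin n → ZMod 2) (v : Fin n → V), (∀ i, v i ∈ 𝒱 (d i)) →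
    F v ∈ 𝒱 ((∑ i, d i) + β)}
  add_mem' hF hG d v hv := Submodule.add_mem _ (hF d v hv) (hG d v hv)
  zero_mem' _ _ _ := Submodule.zero_mem _
  smul_mem' c _ hF d v hv := Submodule.smul_mem _ c (hF d v hv)

/-- The component of degree `β ∈ ℤ/2` of an `n`-linear map. -/
noncomputable def homPart (𝒱 : ZMod 2 → Submodule K V) [DirectSum.Decomposition 𝒱] {n : ℕ}
    (β : ZMod 2) :
    MultilinearMap K (fun _ : Fin n => V) V →ₗ[K] MultilinearMap K (fun _ : Fin n => V) V where
  toFun F := ∑ d : Fin n → ZMod 2,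
    (proj 𝒱 ((∑ i, d i) + β)).compMultilinearMap (F.compLinearMap fun i => proj 𝒱 (d i))
  map_add' F G := by
    rw [← Finset.sum_add_distrib]
    refine Finset.sum_congr rfl fun d _ => ?_
    ext v
    simp
  map_smul' c F := by
    rw [RingHom.id_apply, Finset.smul_sum]
    refine Finset.sum_congr rfl fun d _ => ?_
    ext v
    simp

/-- The insertion `(X₁, …, X_{n+m}) ↦ F(X₁, …, Xₙ, G(X_{n+1}, …, X_{n+m}))`, without signs. -/
def insertLast {n m : ℕ} (F : MultilinearMap K (fun _ : Fin (n + 1) => V) V)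
    (G : MultilinearMap K (fun _ : Fin m => V) V) :
    MultilinearMap K (fun _ : Fin (n + m) => V) V :=
  have left : ∀ (v : Fin (n + m) → V) (i : Fin n) (x : V),
      (fun k => Function.update v (Fin.castAdd m i) x (Fin.castAdd m k)) =
        Function.update (fun k => v (Fin.castAdd m k)) i x := fun v i x =>
    Function.update_comp_eq_of_injective v (Fin.castAdd_injective n m) i x
  have left' : ∀ (v : Fin (n + m) → V) (i : Fin n) (x : V),
      (fun k => Function.update v (Fin.castAdd m i) x (Fin.natAdd n k)) =
        fun k => v (Fin.natAdd n k) := fun v i x => by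
    funext k
    exact Function.update_of_ne (by simp [Fin.ext_iff]; omega) _ _
  have right : ∀ (v : Fin (n + m) → V) (j : Fin m) (x : V),
      (fun k => Function.update v (Fin.natAdd n j) x (Fin.natAdd n k)) =
        Function.update (fun k => v (Fin.natAdd n k)) j x := fun v j x =>
    Function.update_comp_eq_of_injective v (Fin.natAdd_injective m n) j x
  have right' : ∀ (v : Fin (n + m) → V) (j : Fin m) (x : V),
      (fun k => Function.update v (Fin.natAdd n j) x (Fin.castAdd m k)) =
        fun k => v (Fin.castAdd m k) := fun v j x => by
    funext k
    exact Function.update_of_ne (by simp [Fin.ext_iff]; omega) _ _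
  MultilinearMap.mk'
    (fun v => F (Fin.snoc (α := fun _ => V) (fun i => v (Fin.castAdd m i))
      (G fun j => v (Fin.natAdd n j))))
    (fun v i x y => by
      induction i using Fin.addCases with
      | left i => simp only [left, left', Fin.snoc_update, MultilinearMap.map_update_add]
      | right j => simp only [right, right', MultilinearMap.map_update_add, MultilinearMap.snoc_add])
    (fun v i c x => by
      induction i using Fin.addCases with
      | left i => simp only [left, left', Fin.snoc_update, MultilinearMap.map_update_smul]
      | right j =>
        simp only [right, right', MultilinearMap.map_update_smul, MultilinearMap.snoc_smul])

theorem insertLast_apply {n m : ℕ} (F : MultilinearMap K (fun _ : Fin (n + 1) => V) V)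
    (G : MultilinearMap K (fun _ : Fin m => V) V) (v : Fin (n + m) → V) :
    insertLast F G v = F (Fin.snoc (α := fun _ => V) (fun i => v (Fin.castAdd m i))
      (G fun j => v (Fin.natAdd n j))) := rfl

/-- `F * G`, given on homogeneous `G` of degree `β` and homogeneous `X₁, …, X_{n+m}` by
`(-1)^(β (|X₁| + ⋯ + |Xₙ|)) F(X₁, …, Xₙ, G(X_{n+1}, …, X_{n+m}))`; the sum over `β` and over the
degrees `d` of `X₁, …, Xₙ` extends this bilinearly in `F`, `G` and multilinearly in the `X`. -/
noncomputable def starMul (𝒱 : ZMod 2 → Submodule K V) [DirectSum.Decomposition 𝒱] {n m : ℕ}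
    (F : MultilinearMap K (fun _ : Fin (n + 1) => V) V)
    (G : MultilinearMap K (fun _ : Fin m => V) V) :
    MultilinearMap K (fun _ : Fin (n + m) => V) V :=
  ∑ β : ZMod 2, ∑ d : Fin n → ZMod 2, sgn K (β * ∑ i, d i) •
    insertLast (F.compLinearMap (Fin.snoc (α := fun _ => V →ₗ[K] V)
      (fun i => proj 𝒱 (d i)) LinearMap.id)) (homPart 𝒱 β G)

/-- The `(n, m)`-shuffles: `σ 1 < ⋯ < σ n` and `σ (n+1) < ⋯ < σ (n+m)`. -/
def shuffles (n m : ℕ) : Finset (Equiv.Perm (Fin (n + m))) :=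
  Finset.univ.filter fun σ =>
    (∀ i j : Fin n, i < j → σ (Fin.castAdd m i) < σ (Fin.castAdd m j)) ∧
    (∀ i j : Fin m, i < j → σ (Fin.natAdd n i) < σ (Fin.natAdd n j))

/-- `F ∘ G = ∑_{σ ∈ S_(n, m+1)} σ.(F * G)` for `F` with `n + 1` and `G` with `m + 1` arguments. -/
noncomputable def circ (𝒱 : ZMod 2 → Submodule K V) [DirectSum.Decomposition 𝒱] (n m : ℕ) :
    MultilinearMap K (fun _ : Fin (n + 1) => V) V →ₗ[K]
      MultilinearMap K (fun _ : Fin (m + 1) => V) V →ₗ[K]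
        MultilinearMap K (fun _ : Fin (n + m + 1) => V) V :=
  LinearMap.mk₂ K (fun F G => ∑ σ ∈ shuffles n (m + 1), permAct 𝒱 σ (starMul 𝒱 F G))
    (fun F F' G => by
      rw [← Finset.sum_add_distrib]
      refine Finset.sum_congr rfl fun σ _ => ?_
      rw [← map_add]
      congr 1
      simp only [starMul, ← Finset.sum_add_distrib, ← smul_add]
      rfl)
    (fun c F G => by
      rw [Finset.smul_sum]
      refine Finset.sum_congr rfl fun σ _ => ?_
      rw [← map_smul]
      congr 1
      simp only [starMul, Finset.smul_sum, smul_comm c]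
      rfl)
    (fun F G G' => by
      rw [← Finset.sum_add_distrib]
      refine Finset.sum_congr rfl fun σ _ => ?_
      rw [← map_add]
      congr 1
      simp only [starMul, ← Finset.sum_add_distrib, ← smul_add]
      refine Finset.sum_congr rfl fun β _ => Finset.sum_congr rfl fun d _ => ?_
      congr 1
      ext v
      simp only [add_apply, insertLast_apply, map_add, MultilinearMap.snoc_add])
    (fun c F G => by
      rw [Finset.smul_sum]
      refine Finset.sum_congr rfl fun σ _ => ?_
      rw [← map_smul]
      congr 1
      simp only [starMul, Finset.smul_sum, smul_comm c]
      refine Finset.sum_congr rfl fun β _ => Finset.sum_congr rfl fun d _ => ?_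
      congr 1
      ext v
      simp only [smul_apply, insertLast_apply, map_smul,
        MultilinearMap.snoc_smul])

/-- `⨁_{s ≥ 0}` of the spaces of `(s+1)`-linear maps on `V`; the summand `s` has degree `s`. -/
def Multi (K V : Type*) [Field K] [AddCommGroup V] [Module K V] : Type _ :=
  DirectSum ℕ fun s => MultilinearMap K (fun _ : Fin (s + 1) => V) V

noncomputable instance : AddCommGroup (Multi K V) :=
  inferInstanceAs (AddCommGroup (DirectSum ℕ fun s =>
    MultilinearMap K (fun _ : Fin (s + 1) => V) V))

noncomputable instance : Module K (Multi K V) :=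
  inferInstanceAs (Module K (DirectSum ℕ fun s => MultilinearMap K (fun _ : Fin (s + 1) => V) V))

/-- The inclusion of the summand `s`. -/
noncomputable def incl (s : ℕ) :
    MultilinearMap K (fun _ : Fin (s + 1) => V) V →ₗ[K] Multi K V :=
  DirectSum.lof K ℕ (fun s => MultilinearMap K (fun _ : Fin (s + 1) => V) V) s

/-- The component in the summand `s`. -/
noncomputable def component (s : ℕ) :
    Multi K V →ₗ[K] MultilinearMap K (fun _ : Fin (s + 1) => V) V :=
  DirectSum.component K ℕ (fun s => MultilinearMap K (fun _ : Fin (s + 1) => V) V) s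

/-- The linear map on the direct sum with given restrictions to the summands. -/
noncomputable def lift {N : Type*} [AddCommGroup N] [Module K N]
    (f : ∀ s, MultilinearMap K (fun _ : Fin (s + 1) => V) V →ₗ[K] N) : Multi K V →ₗ[K] N :=
  DirectSum.toModule K ℕ N f

theorem lift_incl {N : Type*} [AddCommGroup N] [Module K N]
    (f : ∀ s, MultilinearMap K (fun _ : Fin (s + 1) => V) V →ₗ[K] N) (s : ℕ)
    (F : MultilinearMap K (fun _ : Fin (s + 1) => V) V) : lift f (incl s F) = f s F :=
  DirectSum.toModule_lof (M := fun s => MultilinearMap K (fun _ : Fin (s + 1) => V) V) (φ := f) K s F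

/-- `[F, G] = F ∘ G - (-1)^(nm + αβ) G ∘ F` for `F` of degree `(n, α)`, `G` of degree `(m, β)`;
the sum over `α`, `β` extends this to `F`, `G` that are not homogeneous over `ℤ/2`. -/
noncomputable def bracketAux (𝒱 : ZMod 2 → Submodule K V) [DirectSum.Decomposition 𝒱] (n m : ℕ) :
    MultilinearMap K (fun _ : Fin (n + 1) => V) V →ₗ[K]
      MultilinearMap K (fun _ : Fin (m + 1) => V) V →ₗ[K] Multi K V :=
  (circ 𝒱 n m).compr₂ (incl (n + m)) -
    ∑ α : ZMod 2, ∑ β : ZMod 2, sgn K ((n : ZMod 2) * m + α * β) •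
      ((circ 𝒱 m n).flip.compl₁₂ (homPart 𝒱 α) (homPart 𝒱 β)).compr₂
        (incl (m + n))

/-- The bracket `[F, G]`, extended bilinearly to the direct sum over all numbers of arguments. -/
noncomputable def bracket (𝒱 : ZMod 2 → Submodule K V) [DirectSum.Decomposition 𝒱] :
    Multi K V →ₗ[K] Multi K V →ₗ[K] Multi K V :=
  lift fun n => (lift fun m => (bracketAux 𝒱 n m).flip).flip

theorem bracket_incl (𝒱 : ZMod 2 → Submodule K V) [DirectSum.Decomposition 𝒱] (n m : ℕ)
    (F : MultilinearMap K (fun _ : Fin (n + 1) => V) V)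
    (G : MultilinearMap K (fun _ : Fin (m + 1) => V) V) :
    bracket 𝒱 (incl n F) (incl m G) = bracketAux 𝒱 n m F G := by
  rw [bracket, lift_incl, LinearMap.flip_apply, lift_incl, LinearMap.flip_apply]

/-- The quotient `Z / (B ∩ Z)` of subspaces of `M`. -/
def Subquotient {M : Type*} [AddCommGroup M] [Module K M] (Z B : Submodule K M) : Type _ :=
  Z ⧸ B.submoduleOf Z

instance {M : Type*} [AddCommGroup M] [Module K M] (Z B : Submodule K M) :
    AddCommGroup (Subquotient Z B) :=
  inferInstanceAs (AddCommGroup (Z ⧸ B.submoduleOf Z))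

instance {M : Type*} [AddCommGroup M] [Module K M] (Z B : Submodule K M) :
    Module K (Subquotient Z B) :=
  inferInstanceAs (Module K (Z ⧸ B.submoduleOf Z))

end General

/-! ### Differential graded Lie algebras -/

section DGLie

variable {K : Type*} [Field K] {L : Type*} [AddCommGroup L] [Module K L]

/-- The sign `(-1)^(p₁q₁ + p₂q₂)` for degrees `p, q ∈ ℤ × ℤ/2`. -/
def degSgn (K : Type*) [Field K] (p q : ℤ × ZMod 2) : K :=
  sgn K (((p.1 * q.1 : ℤ) : ZMod 2) + p.2 * q.2)

/-- `(L, br)` is a `ℤ × ℤ/2`-graded Lie algebra. -/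
structure IsGradedLieAlgebra (ℒ : ℤ × ZMod 2 → Submodule K L) (br : L →ₗ[K] L →ₗ[K] L) :
    Prop where
  internal : DirectSum.IsInternal ℒ
  degree : ∀ (p q : ℤ × ZMod 2) (x y : L), x ∈ ℒ p → y ∈ ℒ q → br x y ∈ ℒ (p + q)
  skew : ∀ (p q : ℤ × ZMod 2) (x y : L), x ∈ ℒ p → y ∈ ℒ q →
    br x y = -(degSgn K p q • br y x)
  jacobi : ∀ (p q : ℤ × ZMod 2) (x y z : L), x ∈ ℒ p → y ∈ ℒ q →
    br x (br y z) = br (br x y) z + degSgn K p q • br y (br x z)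

/-- `∂` is a graded derivation of degree `p`. -/
structure IsGradedDerivation (ℒ : ℤ × ZMod 2 → Submodule K L) (br : L →ₗ[K] L →ₗ[K] L)
    (p : ℤ × ZMod 2) (D : L →ₗ[K] L) : Prop where
  degree : ∀ (q : ℤ × ZMod 2) (x : L), x ∈ ℒ q → D x ∈ ℒ (p + q)
  leibniz : ∀ (q : ℤ × ZMod 2) (x y : L), x ∈ ℒ q →
    D (br x y) = br (D x) y + degSgn K p q • br x (D y)

/-- `(L, br, D)` is a differential `ℤ × ℤ/2`-graded Lie algebra. -/
structure IsDGLieAlgebra (ℒ : ℤ × ZMod 2 → Submodule K L) (br : L →ₗ[K] L →ₗ[K] L)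
    (D : L →ₗ[K] L) : Prop where
  graded : IsGradedLieAlgebra ℒ br
  derivation : IsGradedDerivation ℒ br (1, 0) D
  sq_zero : ∀ x : L, D (D x) = 0

/-- Maurer-Cartan elements of a graded Lie algebra (with zero differential). -/
structure IsMaurerCartan (ℒ : ℤ × ZMod 2 → Submodule K L) (br : L →ₗ[K] L →ₗ[K] L) (ω : L) :
    Prop where
  degree : ω ∈ ℒ (1, 0)
  bracket_self : br ω ω = 0

end DGLie

/-! ### The graded Lie algebra and the cochain complex of `(g, h, ρ)` -/

section Triple

variable {K : Type*} [Field K] {g h : Type*} [AddCommGroup g] [Module K g] [AddCommGroup h]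
  [Module K h]

/-- The grading `(g ⊕ h)_α = g_α ⊕ h_α`. -/
def prodGrading (𝒢 : ZMod 2 → Submodule K g) (ℋ : ZMod 2 → Submodule K h) :
    ZMod 2 → Submodule K (g × h) :=
  fun α => (𝒢 α).prod (ℋ α)

theorem proj_mem (𝒢 : ZMod 2 → Submodule K g) [DirectSum.Decomposition 𝒢] (α : ZMod 2) (x : g) :
    proj 𝒢 α x ∈ 𝒢 α := (DirectSum.decompose 𝒢 x α).2

theorem sum_proj (𝒢 : ZMod 2 → Submodule K g) [DirectSum.Decomposition 𝒢] (x : g) :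
    ∑ α, proj 𝒢 α x = x := by
  classical
  conv_rhs => rw [← DirectSum.sum_support_decompose 𝒢 x]
  refine (Finset.sum_subset (Finset.subset_univ _) fun α _ hα => ?_).symm
  change ((DirectSum.decompose 𝒢 x α : 𝒢 α) : g) = 0
  simpa using hα

theorem proj_of_mem (𝒢 : ZMod 2 → Submodule K g) [DirectSum.Decomposition 𝒢] (α β : ZMod 2)
    (x : g) (hx : x ∈ 𝒢 β) : proj 𝒢 α x = if α = β then x else 0 := by
  change (DirectSum.decompose 𝒢 x α : g) = _
  split_ifs with h
  · subst h
    exact DirectSum.decompose_of_mem_same 𝒢 hx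
  · exact DirectSum.decompose_of_mem_ne 𝒢 hx (Ne.symm h)

noncomputable instance (𝒢 : ZMod 2 → Submodule K g) (ℋ : ZMod 2 → Submodule K h)
    [DirectSum.Decomposition 𝒢] [DirectSum.Decomposition ℋ] :
    DirectSum.Decomposition (prodGrading 𝒢 ℋ) :=
  DirectSum.Decomposition.ofLinearMap (prodGrading 𝒢 ℋ)
    (∑ α : ZMod 2, DirectSum.lof K (ZMod 2) (fun α => prodGrading 𝒢 ℋ α) α ∘ₗ
      ((proj 𝒢 α).prodMap (proj ℋ α)).codRestrict (prodGrading 𝒢 ℋ α)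
        (fun x => ⟨proj_mem 𝒢 α x.1, proj_mem ℋ α x.2⟩))
    (by
      refine LinearMap.ext fun x => ?_
      simp only [LinearMap.comp_apply, LinearMap.sum_apply, map_sum, DirectSum.coeLinearMap_lof,
        LinearMap.id_apply]
      refine Prod.ext ?_ ?_
      · rw [Prod.fst_sum]
        exact sum_proj 𝒢 x.1
      · rw [Prod.snd_sum]
        exact sum_proj ℋ x.2)
    (by
      refine DirectSum.linearMap_ext K fun β => LinearMap.ext fun x => ?_
      simp only [LinearMap.comp_apply, LinearMap.sum_apply, DirectSum.coeLinearMap_lof,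
        LinearMap.id_apply]
      rw [Finset.sum_eq_single β]
      · congr 1
        refine Subtype.ext (Prod.ext ?_ ?_)
        · exact (proj_of_mem 𝒢 β β _ x.2.1).trans (if_pos rfl)
        · exact (proj_of_mem ℋ β β _ x.2.2).trans (if_pos rfl)
      · intro α _ hα
        refine (congrArg _ ?_).trans (LinearMap.map_zero _)
        refine Subtype.ext (Prod.ext ?_ ?_)
        · exact (proj_of_mem 𝒢 α β _ x.2.1).trans (if_neg hα)
        · exact (proj_of_mem ℋ α β _ x.2.2).trans (if_neg hα)
      · simp)

/-- `Hom(⋀ⁱ g ⊗ ⋀ʲ h, W)` with `i + j = s + 1` and `W ⊆ g ⊕ h`, as a subspace of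
`Hom(⋀^{s+1} (g ⊕ h), g ⊕ h) = ⨁_{i+j=s+1} Hom(⋀ⁱ g ⊗ ⋀ʲ h, g ⊕ h)`: the maps with values in `W`
that vanish on all tuples of elements of `g ∪ h` in which the number of entries from `h` is
not `j`. Here `S` is the set of positions of the entries from `h`. -/
def biHom (𝒢 : ZMod 2 → Submodule K g) (ℋ : ZMod 2 → Submodule K h)
    [DirectSum.Decomposition 𝒢] [DirectSum.Decomposition ℋ] (s j : ℕ)
    (W : Submodule K (g × h)) :
    Submodule K (MultilinearMap K (fun _ : Fin (s + 1) => g × h) (g × h)) where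
  carrier := {F | F ∈ superAlt (prodGrading 𝒢 ℋ) (s + 1) ∧ (∀ v, F v ∈ W) ∧
    ∀ (v : Fin (s + 1) → g × h) (S : Finset (Fin (s + 1))),
      (∀ i ∈ S, (v i).1 = 0) → (∀ i ∉ S, (v i).2 = 0) → S.card ≠ j → F v = 0}
  add_mem' {F G} hF hG := ⟨Submodule.add_mem _ hF.1 hG.1,
    fun v => Submodule.add_mem _ (hF.2.1 v) (hG.2.1 v), fun v S h1 h2 h3 => by
      rw [add_apply, hF.2.2 v S h1 h2 h3, hG.2.2 v S h1 h2 h3, add_zero]⟩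
  zero_mem' := ⟨Submodule.zero_mem _, fun _ => Submodule.zero_mem _, fun _ _ _ _ _ => rfl⟩
  smul_mem' c F hF := ⟨Submodule.smul_mem _ c hF.1, fun v => Submodule.smul_mem _ c (hF.2.1 v),
    fun v S h1 h2 h3 => by
      rw [smul_apply, hF.2.2 v S h1 h2 h3, smul_zero]⟩

/-- `Hom(⋀^{s+1} g, g) ⊕ ⨁_{i+j=s+1, j≥1} Hom(⋀ⁱ g ⊗ ⋀ʲ h, h)`. -/
def actComponent (𝒢 : ZMod 2 → Submodule K g) (ℋ : ZMod 2 → Submodule K h)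
    [DirectSum.Decomposition 𝒢] [DirectSum.Decomposition ℋ] (s : ℕ) :
    Submodule K (MultilinearMap K (fun _ : Fin (s + 1) => g × h) (g × h)) :=
  biHom 𝒢 ℋ s 0 (Submodule.prod ⊤ ⊥) ⊔
    ⨆ j ∈ Finset.Icc 1 (s + 1), biHom 𝒢 ℋ s j (Submodule.prod ⊥ ⊤)

/-- `𝔉 = ⨁_{s≥0} (Hom(⋀^{s+1} g, g) ⊕ ⨁_{i+j=s+1, j≥1} Hom(⋀ⁱ g ⊗ ⋀ʲ h, h))`. -/
def actAlgebra (𝒢 : ZMod 2 → Submodule K g) (ℋ : ZMod 2 → Submodule K h)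
    [DirectSum.Decomposition 𝒢] [DirectSum.Decomposition ℋ] : Submodule K (Multi K (g × h)) where
  carrier := {a | ∀ s, component s a ∈ actComponent 𝒢 ℋ s}
  add_mem' ha hb s := by
    rw [map_add]
    exact Submodule.add_mem _ (ha s) (hb s)
  zero_mem' s := by
    rw [map_zero]
    exact Submodule.zero_mem _
  smul_mem' c _ ha s := by
    rw [map_smul]
    exact Submodule.smul_mem _ c (ha s)

/-- The component of `𝔉` of degree `p = (s, β) ∈ ℤ × ℤ/2`: maps with `s + 1` arguments, homogeneous
of degree `β`; it is zero for `s < 0`. -/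
def actGrading (𝒢 : ZMod 2 → Submodule K g) (ℋ : ZMod 2 → Submodule K h)
    [DirectSum.Decomposition 𝒢] [DirectSum.Decomposition ℋ] (p : ℤ × ZMod 2) :
    Submodule K (actAlgebra 𝒢 ℋ) where
  carrier := {a | (∀ s : ℕ, (s : ℤ) ≠ p.1 → component s (a : Multi K (g × h)) = 0) ∧
    ∀ s : ℕ, component s (a : Multi K (g × h)) ∈ homogeneous (prodGrading 𝒢 ℋ) (s + 1) p.2}
  add_mem' {a b} ha hb := by
    refine ⟨fun s hs => ?_, fun s => ?_⟩
    · rw [Submodule.coe_add, map_add, ha.1 s hs, hb.1 s hs, add_zero]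
    · rw [Submodule.coe_add, map_add]
      exact Submodule.add_mem _ (ha.2 s) (hb.2 s)
  zero_mem' := by
    refine ⟨fun s _ => ?_, fun s => ?_⟩
    · rw [Submodule.coe_zero, map_zero]
    · rw [Submodule.coe_zero, map_zero]
      exact Submodule.zero_mem _
  smul_mem' c a ha := by
    refine ⟨fun s hs => ?_, fun s => ?_⟩
    · rw [Submodule.coe_smul, map_smul, ha.1 s hs, smul_zero]
    · rw [Submodule.coe_smul, map_smul]
      exact Submodule.smul_mem _ c (ha.2 s)

/-- A bilinear map on `V` as a multilinear map with two arguments. -/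
def ofBilin {V : Type*} [AddCommGroup V] [Module K V] (B : V →ₗ[K] V →ₗ[K] V) :
    MultilinearMap K (fun _ : Fin 2 => V) V :=
  MultilinearMap.mk' (fun v => B (v 0) (v 1))
    (fun v i x y => by fin_cases i <;> simp)
    (fun v i c x => by fin_cases i <;> simp)

/-- `((x, y), (x', y')) ↦ (π(x, x'), 0)`. -/
def liftLeft (π : g →ₗ[K] g →ₗ[K] g) : MultilinearMap K (fun _ : Fin 2 => g × h) (g × h) :=
  ofBilin ((π.compl₁₂ (LinearMap.fst K g h) (LinearMap.fst K g h)).compr₂ (LinearMap.inl K g h))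

/-- `((x, y), (x', y')) ↦ (0, μ(y, y'))`. -/
def liftRight (μ : h →ₗ[K] h →ₗ[K] h) : MultilinearMap K (fun _ : Fin 2 => g × h) (g × h) :=
  ofBilin ((μ.compl₁₂ (LinearMap.snd K g h) (LinearMap.snd K g h)).compr₂ (LinearMap.inr K g h))

/-- The element of `Hom(g ⊗ h, h) ⊆ Hom(⋀² (g ⊕ h), g ⊕ h)` given by `ρ`: the sum of `σ.ρ₀` over the
`(1,1)`-shuffles `σ`, where `ρ₀((x, y), (x', y')) = (0, ρ(x) y')`. On homogeneous arguments this is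
`((x, y), (x', y')) ↦ (0, ρ(x) y' - (-1)^(|y| |x'|) ρ(x') y)`. -/
noncomputable def liftAct (𝒢 : ZMod 2 → Submodule K g) (ℋ : ZMod 2 → Submodule K h)
    [DirectSum.Decomposition 𝒢] [DirectSum.Decomposition ℋ] (ρ : g →ₗ[K] Module.End K h) :
    MultilinearMap K (fun _ : Fin 2 => g × h) (g × h) :=
  ∑ σ ∈ shuffles 1 1, permAct (prodGrading 𝒢 ℋ) σ
    (ofBilin ((LinearMap.compl₁₂ ρ (LinearMap.fst K g h) (LinearMap.snd K g h)).compr₂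
      (LinearMap.inr K g h)))

/-- `Π = π + ρ + μ`, placed in degree `1`. -/
noncomputable def mcElement (𝒢 : ZMod 2 → Submodule K g) (ℋ : ZMod 2 → Submodule K h)
    [DirectSum.Decomposition 𝒢] [DirectSum.Decomposition ℋ]
    (π : g →ₗ[K] g →ₗ[K] g) (μ : h →ₗ[K] h →ₗ[K] h) (ρ : g →ₗ[K] Module.End K h) :
    Multi K (g × h) :=
  incl 1 (liftLeft π + liftAct 𝒢 ℋ ρ + liftRight μ)

/-- `Cⁿ(g, h, ρ)`: the elements of `𝔉` with exactly `n` arguments; `C⁰ = 0`. -/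
def cochains (𝒢 : ZMod 2 → Submodule K g) (ℋ : ZMod 2 → Submodule K h)
    [DirectSum.Decomposition 𝒢] [DirectSum.Decomposition ℋ] (n : ℕ) :
    Submodule K (Multi K (g × h)) where
  carrier := {a | a ∈ actAlgebra 𝒢 ℋ ∧ ∀ s, s + 1 ≠ n → component s a = 0}
  add_mem' ha hb := ⟨Submodule.add_mem _ ha.1 hb.1, fun s hs => by
    rw [map_add, ha.2 s hs, hb.2 s hs, add_zero]⟩
  zero_mem' := ⟨Submodule.zero_mem _, fun _ _ => map_zero _⟩
  smul_mem' c _ ha := ⟨Submodule.smul_mem _ c ha.1, fun s hs => by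
    rw [map_smul, ha.2 s hs, smul_zero]⟩

/-- The cocycles in `Cⁿ(g, h, ρ)`: those `a` with `[Π, a] = 0`. -/
noncomputable def cocycles (𝒢 : ZMod 2 → Submodule K g) (ℋ : ZMod 2 → Submodule K h)
    [DirectSum.Decomposition 𝒢] [DirectSum.Decomposition ℋ]
    (π : g →ₗ[K] g →ₗ[K] g) (μ : h →ₗ[K] h →ₗ[K] h) (ρ : g →ₗ[K] Module.End K h) (n : ℕ) :
    Submodule K (Multi K (g × h)) :=
  cochains 𝒢 ℋ n ⊓ LinearMap.ker (bracket (prodGrading 𝒢 ℋ) (mcElement 𝒢 ℋ π μ ρ))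

/-- The coboundaries `[Π, a]`, `a ∈ C^{n-1}(g, h, ρ)`. -/
noncomputable def coboundaries (𝒢 : ZMod 2 → Submodule K g) (ℋ : ZMod 2 → Submodule K h)
    [DirectSum.Decomposition 𝒢] [DirectSum.Decomposition ℋ]
    (π : g →ₗ[K] g →ₗ[K] g) (μ : h →ₗ[K] h →ₗ[K] h) (ρ : g →ₗ[K] Module.End K h) :
    ℕ → Submodule K (Multi K (g × h))
  | 0 => ⊥
  | n + 1 => (cochains 𝒢 ℋ n).map (bracket (prodGrading 𝒢 ℋ) (mcElement 𝒢 ℋ π μ ρ))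

/-- `Hⁿ(g, h, ρ)`: cocycles in degree `n` modulo coboundaries. -/
abbrev cohomology (𝒢 : ZMod 2 → Submodule K g) (ℋ : ZMod 2 → Submodule K h)
    [DirectSum.Decomposition 𝒢] [DirectSum.Decomposition ℋ]
    (π : g →ₗ[K] g →ₗ[K] g) (μ : h →ₗ[K] h →ₗ[K] h) (ρ : g →ₗ[K] Module.End K h) (n : ℕ) :
    Type _ :=
  Subquotient (cocycles 𝒢 ℋ π μ ρ n) (coboundaries 𝒢 ℋ π μ ρ n)

end Triple

end LieSup

/-! The composition `F ∘ G` is a graded right pre-Lie product: the associator (F ∘ G) ∘ H − F ∘ (G ∘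
H) is graded symmetric in G and H. The commutator of such a product satisfies the graded Jacobi
identity.

Symmetry of the associator is obtained without handling double shuffles. A shuffle takes its least
value at the start of one of its two blocks, so fixing the first argument X of F ∘ G gives (ι_X F) ∘
G plus F ∘ (ι_X G), up to sign: contraction is a signed derivation of the composition. Hence the
contraction of an associator is a sum of three associators, each with one contracted entry, and the
symmetry follows by induction on the number of arguments. With no arguments left the associator is
F(H, G) up to sign, and its symmetry is that of F. A similar induction shows that F ∘ G is again
signed symmetric. The induction takes place on maps of lists of labelled vectors (`listMul`,
`contract_listAssoc`, `listAssoc_symm`, `listBracket_jacobi`); `compSum_eq_listMul` and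
`toListMap_circ` identify the recursion with the sum over shuffles, and `toListMap_injective`
carries identities back.

The space 𝔉 consists of the signed symmetric maps for which g is a subalgebra and h an ideal
(`mem_actComponent_iff`). Inserting one such map into another gives a map of the same kind, so 𝔉 is
closed under the bracket.

The element Π is the bracket of the semidirect product of g and h, and Π ∘ Π = 0 is its Jacobi
identity (`mcBracket_jacobi`, `listMul_mcMap_self`). The field may have characteristic 2, where [Π,
Π] = 2 Π ∘ Π carries no information and the Jacobi identity yields only 2[Π, [Π, a]] = 0. The square
of the differential is therefore computed from Π ∘ Π = 0 together with (a ∘ Π) ∘ Π = a ∘ (Π ∘ Π),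
which is `listAssoc_self`. -/

namespace LieSup

/-! ### Signs with exponents in ℤ/2. -/

section Sign

variable (K : Type*) [Field K]

@[simp] theorem sgn_zero : sgn K 0 = 1 := by simp [sgn]

@[simp] theorem sgn_one : sgn K 1 = -1 := by simp [sgn, ZMod.val_one]

theorem sgn_add (a b : ZMod 2) : sgn K (a + b) = sgn K a * sgn K b := by
  rw [sgn, ZMod.val_add, ← neg_one_pow_eq_pow_mod_two, pow_add, sgn, sgn]

theorem sgn_mul_self (a : ZMod 2) : sgn K a * sgn K a = 1 := by
  rw [← sgn_add, CharTwo.add_self_eq_zero, sgn_zero]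

theorem sgn_eq_one_or (a : ZMod 2) : sgn K a = 1 ∨ sgn K a = -1 := by
  fin_cases a <;> simp [sgn, ZMod.val]

theorem sgn_add_one (a : ZMod 2) : sgn K (a + 1) = -sgn K a := by
  rw [sgn_add, sgn_one, mul_neg_one]

theorem sgn_natCast (n : ℕ) : sgn K (n : ZMod 2) = (-1) ^ n := by
  rw [sgn, ZMod.val_natCast, ← neg_one_pow_eq_pow_mod_two]

theorem sgn_sum {ι : Type*} (s : Finset ι) (f : ι → ZMod 2) :
    sgn K (∑ i ∈ s, f i) = ∏ i ∈ s, sgn K (f i) := by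
  classical
  induction s using Finset.induction_on with
  | empty => simp
  | insert a s ha ih => rw [Finset.sum_insert ha, Finset.prod_insert ha, sgn_add, ih]

end Sign

/-! ### Maps on lists of labelled vectors -/

section ListMap

/-- Maps on lists of vectors labelled by degrees. -/
abbrev ListMap (V : Type*) := List (ZMod 2 × V) → V

/-- Insertion of `x` as the first argument. -/
def contract {V : Type*} (x : ZMod 2 × V) (φ : ListMap V) : ListMap V := fun l => φ (x :: l)

theorem contract_apply {V : Type*} (x : ZMod 2 × V) (φ : ListMap V) (l : List (ZMod 2 × V)) :
    contract x φ l = φ (x :: l) := rfl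

variable {K : Type*} [Field K] {V : Type*} [AddCommGroup V] [Module K V]

/-- The recursive form of the composition `φ ∘ ψ`, where `n` is the parity of the number of
arguments of `φ` minus one, and `β` is the degree of `ψ`. -/
def listMulAux (K : Type*) [Field K] {V : Type*} [AddCommGroup V] [Module K V] :
    List (ZMod 2 × V) → ZMod 2 → ZMod 2 → ListMap V → ListMap V → V
  | [], _, β, φ, ψ => φ [(β, ψ [])]
  | x :: l, n, β, φ, ψ => sgn K (β * x.1) • listMulAux K l (n + 1) β (contract x φ) ψ +
      sgn K n • listMulAux K l n (β + x.1) φ (contract x ψ)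

/-- The composition `φ ∘ ψ`, where `n` is the parity of the number of arguments of `φ` minus one,
and `β` is the degree of `ψ`. -/
def listMul (K : Type*) [Field K] {V : Type*} [AddCommGroup V] [Module K V] (n β : ZMod 2)
    (φ ψ : ListMap V) : ListMap V := fun l => listMulAux K l n β φ ψ

theorem listMul_nil (n β : ZMod 2) (φ ψ : ListMap V) :
    listMul K n β φ ψ [] = φ [(β, ψ [])] := rfl

/-- Contraction is a signed derivation of the composition. To enter `φ`, the vector `x` passes `ψ`,
of degree `β`; to enter `ψ`, it passes the `n` arguments of `φ` in front of `ψ`. Its parity signs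
against arguments that enter `φ` later are stored in the new degree `β + x.1`. Modulo two, `n + 1`
records that `φ` has lost an argument. -/
theorem contract_listMul (x : ZMod 2 × V) (n β : ZMod 2) (φ ψ : ListMap V) :
    contract x (listMul K n β φ ψ) = sgn K (β * x.1) • listMul K (n + 1) β (contract x φ) ψ +
      sgn K n • listMul K n (β + x.1) φ (contract x ψ) := rfl

theorem listMul_cons (x : ZMod 2 × V) (l : List (ZMod 2 × V)) (n β : ZMod 2) (φ ψ : ListMap V) :
    listMul K n β φ ψ (x :: l) = sgn K (β * x.1) • listMul K (n + 1) β (contract x φ) ψ l +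
      sgn K n • listMul K n (β + x.1) φ (contract x ψ) l := rfl

theorem contract_add (x : ZMod 2 × V) (φ ψ : ListMap V) :
    contract x (φ + ψ) = contract x φ + contract x ψ := rfl

theorem contract_smul (x : ZMod 2 × V) (c : K) (φ : ListMap V) :
    contract x (c • φ) = c • contract x φ := rfl

theorem listMul_add_left (n β : ZMod 2) (φ φ' ψ : ListMap V) :
    listMul K n β (φ + φ') ψ = listMul K n β φ ψ + listMul K n β φ' ψ := by
  funext l
  induction l generalizing n β φ φ' ψ with
  | nil => rfl
  | cons x l ih =>
    simp only [Pi.add_apply] at ih ⊢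
    simp only [listMul_cons, contract_add, ih, smul_add]
    abel

theorem listMul_smul_left (n β : ZMod 2) (c : K) (φ ψ : ListMap V) :
    listMul K n β (c • φ) ψ = c • listMul K n β φ ψ := by
  funext l
  induction l generalizing n β φ ψ with
  | nil => rfl
  | cons x l ih =>
    simp only [Pi.smul_apply] at ih ⊢
    simp only [listMul_cons, contract_smul, ih, smul_add, smul_comm c]

theorem listMul_zero_left (n β : ZMod 2) (ψ : ListMap V) : listMul K n β 0 ψ = 0 := by
  simpa using listMul_smul_left n β (0 : K) (0 : ListMap V) ψ

/-- Multilinearity. -/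
structure IsLinearListMap (K : Type*) [Field K] {V : Type*} [AddCommGroup V] [Module K V]
    (φ : ListMap V) : Prop where
  add : ∀ (l₁ : List (ZMod 2 × V)) (α : ZMod 2) (x y : V) (l₂ : List (ZMod 2 × V)),
    φ (l₁ ++ (α, x + y) :: l₂) = φ (l₁ ++ (α, x) :: l₂) + φ (l₁ ++ (α, y) :: l₂)
  smul : ∀ (l₁ : List (ZMod 2 × V)) (α : ZMod 2) (c : K) (x : V) (l₂ : List (ZMod 2 × V)),
    φ (l₁ ++ (α, c • x) :: l₂) = c • φ (l₁ ++ (α, x) :: l₂)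

namespace IsLinearListMap

variable {φ ψ : ListMap V}

theorem contract (hφ : IsLinearListMap K φ) (x : ZMod 2 × V) :
    IsLinearListMap K (contract x φ) :=
  ⟨fun l₁ => hφ.add (x :: l₁), fun l₁ => hφ.smul (x :: l₁)⟩

theorem listMul_add_right (hφ : IsLinearListMap K φ) (n β : ZMod 2) (ψ ψ' : ListMap V) :
    listMul K n β φ (ψ + ψ') = listMul K n β φ ψ + listMul K n β φ ψ' := by
  funext l
  induction l generalizing n β φ ψ ψ' with
  | nil => exact hφ.add [] β _ _ []
  | cons x l ih =>
    simp only [Pi.add_apply] at ih ⊢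
    simp only [listMul_cons, LieSup.contract_add, ih hφ, ih (hφ.contract x), smul_add]
    abel

theorem listMul_smul_right (hφ : IsLinearListMap K φ) (n β : ZMod 2) (c : K) (ψ : ListMap V) :
    listMul K n β φ (c • ψ) = c • listMul K n β φ ψ := by
  funext l
  induction l generalizing n β φ ψ with
  | nil => exact hφ.smul [] β c _ []
  | cons x l ih =>
    simp only [Pi.smul_apply] at ih ⊢
    simp only [listMul_cons, LieSup.contract_smul, ih hφ, ih (hφ.contract x), smul_add,
      smul_comm c]

theorem listMul_zero_right (hφ : IsLinearListMap K φ) (n β : ZMod 2) :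
    listMul K n β φ 0 = 0 := by
  simpa using hφ.listMul_smul_right n β (0 : K) 0

end IsLinearListMap

/-- Invariance under the signed exchange of neighbouring arguments. -/
def IsAltListMap (K : Type*) [Field K] {V : Type*} [AddCommGroup V] [Module K V]
    (φ : ListMap V) : Prop :=
  ∀ (l₁ : List (ZMod 2 × V)) (x y : ZMod 2 × V) (l₂ : List (ZMod 2 × V)),
    φ (l₁ ++ x :: y :: l₂) = -(sgn K (x.1 * y.1) • φ (l₁ ++ y :: x :: l₂))

/-- `φ` vanishes on lists whose length does not have the parity of `n + 1`. -/
def HasLengthParity (n : ZMod 2) {V : Type*} [Zero V] (φ : ListMap V) : Prop :=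
  ∀ l : List (ZMod 2 × V), (l.length : ZMod 2) ≠ n + 1 → φ l = 0

theorem HasLengthParity.apply_nil {m : ZMod 2} {ψ : ListMap V} (hψ : HasLengthParity m ψ)
    (hm : m ≠ 1) : ψ [] = 0 := hψ [] fun h => hm <| by
  rw [List.length_nil, Nat.cast_zero] at h
  clear * - h
  revert m
  decide

theorem HasLengthParity.contract {n : ZMod 2} {φ : ListMap V} (hφ : HasLengthParity n φ)
    (x : ZMod 2 × V) : HasLengthParity (n + 1) (contract x φ) := fun l hl =>
  hφ (x :: l) fun h => hl <| by
    rw [List.length_cons, Nat.cast_succ] at h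
    rw [add_right_cancel h, add_assoc, CharTwo.add_self_eq_zero, add_zero]

theorem IsAltListMap.contract {φ : ListMap V} (hφ : IsAltListMap K φ) (x : ZMod 2 × V) :
    IsAltListMap K (contract x φ) := fun l₁ => hφ (x :: l₁)

theorem IsAltListMap.contract_contract {φ : ListMap V} (hφ : IsAltListMap K φ)
    (x y : ZMod 2 × V) :
    LieSup.contract y (LieSup.contract x φ) =
      -(sgn K (x.1 * y.1) • LieSup.contract x (LieSup.contract y φ)) :=
  funext fun l => hφ [] x y l

/-- Contracting with the arguments in front of the exchanged pair reduces to a pair at the head of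
the list. -/
theorem IsAltListMap.listMul {φ ψ : ListMap V} (hφ : IsAltListMap K φ) (hψ : IsAltListMap K ψ)
    (hφ' : IsLinearListMap K φ) (n β : ZMod 2) : IsAltListMap K (listMul K n β φ ψ) := by
  intro l₁ x y l₂
  induction l₁ generalizing n β φ ψ with
  | nil =>
    obtain ⟨a, u⟩ := x
    obtain ⟨b, v⟩ := y
    simp only [List.nil_append, listMul_cons, hφ.contract_contract (a, u) (b, v),
      hψ.contract_contract (a, u) (b, v)]
    simp only [← neg_smul, listMul_smul_left, hφ'.listMul_smul_right, Pi.smul_apply]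
    rw [add_right_comm β b a]
    simp only [smul_add, smul_smul]
    -- The four terms say which map receives `x` and `y`: both `φ`, one each in two ways, both `ψ`.
    -- The exchange swaps the two mixed terms; the outer ones match by the symmetry of `φ` and `ψ`.
    rw [show ∀ p q r s p' q' r' s' : V, p = p' → q = r' → r = q' → s = s' →
      (p + q) + (r + s) = (p' + q') + (r' + s') by rintro _ _ _ _ _ _ _ _ rfl rfl rfl rfl; abel]
    all_goals
      congr 1
      try simp only [neg_mul, mul_neg]
      simp only [← sgn_add, ← sgn_add_one]
      congr 1
      revert a b n β
      clear * -
      decide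
  | cons z l₁ ih =>
    simp only [List.cons_append, listMul_cons]
    rw [ih hφ (hψ.contract z) hφ', ih (hφ.contract z) hψ (hφ'.contract z)]
    simp only [smul_neg, smul_add, neg_add, smul_comm (sgn K (x.1 * y.1))]

/-- The associator `(φ ∘ ψ) ∘ χ - φ ∘ (ψ ∘ χ)`. -/
def listAssoc (K : Type*) [Field K] {V : Type*} [AddCommGroup V] [Module K V] (n m β γ : ZMod 2)
    (φ ψ χ : ListMap V) : ListMap V :=
  listMul K (n + m) γ (listMul K n β φ ψ) χ - listMul K n (β + γ) φ (listMul K m γ ψ χ)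

/-- The two terms in which `ψ` takes `χ []` cancel for `n = 0`. For `n = 1` they vanish separately,
since `φ` is zero on lists of length one. -/
theorem listAssoc_nil {n m β γ : ZMod 2} {φ ψ χ : ListMap V} (hφ : HasLengthParity n φ) :
    listAssoc K n m β γ φ ψ χ [] = sgn K (β * γ) • φ [(γ, χ []), (β, ψ [])] := by
  simp only [listAssoc, Pi.sub_apply, listMul_nil, listMul_cons, contract_apply]
  by_cases hn : n = 0
  · simp [hn]
  · have h0 : ∀ p, φ [p] = 0 := fun p => hφ _ fun h => hn (by simpa using h)
    simp [h0]

/-- The derivation rule is applied to both iterated compositions, and the terms are grouped by the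
map that receives `x`. -/
theorem contract_listAssoc {n m β γ : ZMod 2} {φ ψ χ : ListMap V} (hφ : IsLinearListMap K φ)
    (x : ZMod 2 × V) :
    contract x (listAssoc K n m β γ φ ψ χ) =
      sgn K ((β + γ) * x.1) • listAssoc K (n + 1) m β γ (contract x φ) ψ χ +
      sgn K (n + γ * x.1) • listAssoc K n (m + 1) (β + x.1) γ φ (contract x ψ) χ +
      sgn K (n + m) • listAssoc K n m β (γ + x.1) φ ψ (contract x χ) := by
  have e : contract x (listAssoc K n m β γ φ ψ χ) =
    contract x (listMul K (n + m) γ (listMul K n β φ ψ) χ) -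
      contract x (listMul K n (β + γ) φ (listMul K m γ ψ χ)) := rfl
  rw [e]
  simp only [contract_listMul, listAssoc, listMul_add_left, listMul_smul_left,
    hφ.listMul_add_right, hφ.listMul_smul_right, smul_add, smul_sub, smul_smul, ← sgn_add]
  rw [show n + m + 1 = n + 1 + m from add_right_comm n m 1]
  rw [show n + (m + 1) = n + 1 + m by ring, show β + γ + x.1 = β + (γ + x.1) from add_assoc _ _ _,
    show β + x.1 + γ = β + (γ + x.1) by ring, show γ * x.1 + β * x.1 = (β + γ) * x.1 by ring,
    add_comm (γ * x.1) n]
  abel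

/-- The right pre-Lie identity. Contraction preserves all hypotheses, with the parity of the
contracted map shifted by one, so induction on the list reduces it to the symmetry of `φ` in two
arguments. -/
theorem listAssoc_symm {n m p β γ : ZMod 2} {φ ψ χ : ListMap V} (hφ : IsLinearListMap K φ)
    (hφ₁ : HasLengthParity n φ) (hφ₂ : IsAltListMap K φ) (hψ : HasLengthParity m ψ)
    (hχ : HasLengthParity p χ) :
    listAssoc K n m β γ φ ψ χ = sgn K (m * p + β * γ) • listAssoc K n p γ β φ χ ψ := by
  funext l
  induction l generalizing n m p β γ φ ψ χ with
  | nil =>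
    rw [Pi.smul_apply, listAssoc_nil hφ₁, listAssoc_nil hφ₁]
    -- On the empty list `ψ` and `χ` can be nonzero only if `m = 1` and `p = 1`; in all other cases
    -- both sides vanish by linearity of `φ`.
    by_cases hm : m = 1
    · by_cases hp : p = 1
      · have h := hφ₂ [] (γ, χ []) (β, ψ []) []
        rw [List.nil_append, List.nil_append] at h
        rw [h, hm, hp, mul_one, smul_smul, ← neg_smul, smul_smul, mul_comm γ β, add_comm,
          sgn_add_one, neg_mul, sgn_mul_self, mul_neg, sgn_mul_self]
      · have h : χ [] = 0 := hχ.apply_nil hp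
        have h1 := hφ.smul [] γ 0 0 [(β, ψ [])]
        have h2 := hφ.smul [(β, ψ [])] γ 0 0 []
        simp only [List.nil_append, List.cons_append, zero_smul] at h1 h2
        rw [h, h1, h2, smul_zero, smul_zero, smul_zero]
    · have h : ψ [] = 0 := hψ.apply_nil hm
      have h1 := hφ.smul [] β 0 0 [(γ, χ [])]
      have h2 := hφ.smul [(γ, χ [])] β 0 0 []
      simp only [List.nil_append, List.cons_append, zero_smul] at h1 h2
      rw [h, h1, h2, smul_zero, smul_zero, smul_zero]
  | cons x l ih =>
    simp only [← contract_apply x, contract_smul, Pi.smul_apply, contract_listAssoc hφ,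
      Pi.add_apply]
    rw [ih (hφ.contract x) (hφ₁.contract x) (hφ₂.contract x) hψ hχ,
      ih hφ hφ₁ hφ₂ (hψ.contract x) hχ, ih hφ hφ₁ hφ₂ hψ (hχ.contract x)]
    obtain ⟨a, u⟩ := x
    simp only [Pi.smul_apply, smul_add, smul_smul, ← sgn_add]
    rw [add_right_comm]
    congr 1
    · congr 1
      all_goals
        congr 2
        clear * -
        revert a m p β γ
        try revert n
        decide
    · congr 2
      clear * -
      revert a n m p
      revert β γ
      decide

/-- For `ψ` of odd total degree without constant part, `(φ ∘ ψ) ∘ ψ = φ ∘ (ψ ∘ ψ)`. -/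
theorem listAssoc_self {n m β : ZMod 2} {φ ψ : ListMap V} (hφ : IsLinearListMap K φ)
    (hφ₁ : HasLengthParity n φ) (hφ₂ : IsAltListMap K φ) (hψ : HasLengthParity m ψ)
    (h0 : ψ [] = 0) (hm : m + β = 1) : listAssoc K n m β β φ ψ ψ = 0 := by
  funext l
  induction l generalizing n φ with
  | nil =>
    have h1 := hφ.smul [] β 0 0 [(β, ψ [])]
    rw [List.nil_append, zero_smul, zero_smul] at h1
    rw [listAssoc_nil hφ₁]
    rw [h0] at h1 ⊢
    simpa using congrArg (sgn K (β * β) • ·) h1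
  | cons x l ih =>
    -- The terms with `x` in the first and in the second copy of `ψ` are exchanged by
    -- `listAssoc_symm` and cancel. Applied directly to `ψ`, `ψ`, that lemma would show only that
    -- twice the associator vanishes.
    rw [← contract_apply x (listAssoc K n m β β φ ψ ψ), contract_listAssoc hφ,
      listAssoc_symm (ψ := contract x ψ) hφ hφ₁ hφ₂ (hψ.contract x) hψ]
    simp only [Pi.add_apply, Pi.smul_apply, ih (hφ.contract x) (hφ₁.contract x) (hφ₂.contract x),
      Pi.zero_apply, smul_zero, zero_add, smul_smul, ← sgn_add, ← add_smul]
    obtain ⟨a, u⟩ := x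
    rw [show n + β * a + ((m + 1) * m + (β + a) * β) = n + m + 1 by
        clear * - hm
        revert a n m β
        decide, sgn_add_one, neg_add_cancel, zero_smul]

end ListMap

/-! ### The graded bracket on list maps -/

section ListBracket

variable {K : Type*} [Field K] {V : Type*} [AddCommGroup V] [Module K V]

/-- Multilinear signed-symmetric list maps; `n` is the parity of the number of arguments minus
one. -/
structure IsCochainListMap (K : Type*) [Field K] {V : Type*} [AddCommGroup V] [Module K V]
    (n : ZMod 2) (φ : ListMap V) : Prop where
  linear : IsLinearListMap K φ
  length : HasLengthParity n φ
  alt : IsAltListMap K φ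

/-- The bracket of list maps of degrees `(n, α)` and `(m, β)`. -/
def listBracket (K : Type*) [Field K] {V : Type*} [AddCommGroup V] [Module K V]
    (n m α β : ZMod 2) (φ ψ : ListMap V) : ListMap V :=
  listMul K n β φ ψ - sgn K (n * m + α * β) • listMul K m α ψ φ

theorem IsLinearListMap.listMul_sub_right {φ : ListMap V} (hφ : IsLinearListMap K φ)
    (n β : ZMod 2) (ψ ψ' : ListMap V) :
    LieSup.listMul K n β φ (ψ - ψ') =
      LieSup.listMul K n β φ ψ - LieSup.listMul K n β φ ψ' := by
  rw [sub_eq_add_neg, ← neg_one_smul K ψ', hφ.listMul_add_right, hφ.listMul_smul_right,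
    neg_one_smul, sub_eq_add_neg]

theorem listMul_sub_left (n β : ZMod 2) (φ φ' ψ : ListMap V) :
    listMul K n β (φ - φ') ψ = listMul K n β φ ψ - listMul K n β φ' ψ := by
  rw [sub_eq_add_neg, ← neg_one_smul K φ', listMul_add_left, listMul_smul_left,
    neg_one_smul, sub_eq_add_neg]

/-- The commutator of a right pre-Lie product is a graded Lie bracket: the twelve iterated
compositions group into six associators, which are equal in pairs up to sign. -/
theorem listBracket_jacobi {n m p α β γ : ZMod 2} {φ ψ χ : ListMap V}
    (hφ : IsCochainListMap K n φ) (hψ : IsCochainListMap K m ψ) (hχ : IsCochainListMap K p χ) :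
    listBracket K n (m + p) α (β + γ) φ (listBracket K m p β γ ψ χ) =
      listBracket K (n + m) p (α + β) γ (listBracket K n m α β φ ψ) χ +
        sgn K (n * m + α * β) •
          listBracket K m (n + p) β (α + γ) ψ (listBracket K n p α γ φ χ) := by
  have h1 := listAssoc_symm (β := β) (γ := γ) hφ.linear hφ.length hφ.alt hψ.length hχ.length
  have h2 := listAssoc_symm (β := α) (γ := γ) hψ.linear hψ.length hψ.alt hφ.length hχ.length
  have h3 := listAssoc_symm (β := α) (γ := β) hχ.linear hχ.length hχ.alt hφ.length hψ.length
  simp only [listAssoc] at h1 h2 h3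
  simp only [listBracket, hφ.linear.listMul_sub_right, hψ.linear.listMul_sub_right,
    hχ.linear.listMul_sub_right, listMul_sub_left, listMul_smul_left,
    hφ.linear.listMul_smul_right, hψ.linear.listMul_smul_right, hχ.linear.listMul_smul_right]
  rw [show n * (m + p) + α * (β + γ) = (n * m + α * β) + (n * p + α * γ) by ring,
    show (n + m) * p + (α + β) * γ = (n * p + α * γ) + (m * p + β * γ) by ring,
    show m * (n + p) + β * (α + γ) = (n * m + α * β) + (m * p + β * γ) by ring,
    sgn_add K (n * m + α * β), sgn_add K (n * p + α * γ), sgn_add K (n * m + α * β)]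
  rw [add_comm γ β] at h1
  rw [add_comm γ α] at h2
  rw [add_comm β α, add_comm p n, add_comm p m] at h3
  rw [add_comm m n] at h2
  -- Every sign is a product of the three pairwise signs; once these are fixed, the identity is a
  -- linear combination of the three symmetries.
  rcases sgn_eq_one_or K (n * m + α * β) with ha | ha <;>
  rcases sgn_eq_one_or K (n * p + α * γ) with hb | hb <;>
  rcases sgn_eq_one_or K (m * p + β * γ) with hc | hc <;>
  rw [hc] at h1 <;> rw [hb] at h2 <;> rw [ha] at h3 <;> rw [ha, hb, hc]
  · linear_combination (norm := module) - h1 + h2 - h3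
  · linear_combination (norm := module) - h1 + h2 + h3
  · linear_combination (norm := module) - h1 + h2 + h3
  · linear_combination (norm := module) - h1 + h2 - h3
  · linear_combination (norm := module) - h1 - h2 - h3
  · linear_combination (norm := module) - h1 - h2 + h3
  · linear_combination (norm := module) - h1 - h2 + h3
  · linear_combination (norm := module) - h1 - h2 - h3

/-- No division by two is used. Of the four terms of the double bracket, (χ ∘ ω) ∘ ω equals χ ∘ (ω ∘
ω) = 0 by `listAssoc_self`. The other three cancel by the symmetry of the associator of ω, ω, χ, in
which (ω ∘ ω) ∘ χ is zero. -/
theorem listBracket_listBracket_self {p γ : ZMod 2} {ω χ : ListMap V}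
    (hω : IsCochainListMap K 1 ω) (hχ : IsCochainListMap K p χ) (h0 : ω [] = 0)
    (hsq : listMul K 1 0 ω ω = 0) :
    listBracket K 1 (1 + p) 0 (0 + γ) ω (listBracket K 1 p 0 γ ω χ) = 0 := by
  have h1 := listAssoc_symm (β := 0) (γ := γ) hω.linear hω.length hω.alt hω.length hχ.length
  have h2 := listAssoc_self (β := 0) hχ.linear hχ.length hχ.alt hω.length h0 (add_zero 1)
  simp only [listAssoc] at h1 h2
  simp only [listBracket, hω.linear.listMul_sub_right, listMul_sub_left, listMul_smul_left,
    hω.linear.listMul_smul_right]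
  rw [hsq, listMul_zero_left, add_comm γ 0, one_mul, zero_mul, add_zero] at h1
  rw [hsq, hχ.linear.listMul_zero_right, sub_zero, add_comm p 1] at h2
  simp only [one_mul, zero_mul, add_zero, sgn_add, sgn_one, h2, smul_zero, sub_zero]
  rcases sgn_eq_one_or K p with h | h <;> rw [h] at h1 ⊢
  · linear_combination (norm := module) - h1
  · linear_combination (norm := module) - h1

end ListBracket

/-! ### Permutations with a prescribed preimage of `0` -/

section InsPerm

open Equiv

/-- The permutation with `p ↦ 0` which is given by `τ` on the other elements. -/
def insPerm {N : ℕ} (p : Fin (N + 1)) (τ : Perm (Fin N)) : Perm (Fin (N + 1)) :=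
  Perm.decomposeFin.symm (0, τ) * p.cycleRange

@[simp] theorem insPerm_self {N : ℕ} (p : Fin (N + 1)) (τ : Perm (Fin N)) :
    insPerm p τ p = 0 := by
  rw [insPerm, Perm.mul_apply, Fin.cycleRange_self, Perm.decomposeFin_symm_apply_zero]

@[simp] theorem insPerm_succAbove {N : ℕ} (p : Fin (N + 1)) (τ : Perm (Fin N)) (i : Fin N) :
    insPerm p τ (p.succAbove i) = (τ i).succ := by
  rw [insPerm, Perm.mul_apply, Fin.cycleRange_succAbove, Perm.decomposeFin_symm_apply_succ,
    swap_self, refl_apply]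

@[simp] theorem insPerm_zero_zero {N : ℕ} (τ : Perm (Fin N)) : insPerm 0 τ 0 = 0 :=
  insPerm_self 0 τ

@[simp] theorem insPerm_zero_succ {N : ℕ} (τ : Perm (Fin N)) (i : Fin N) :
    insPerm 0 τ i.succ = (τ i).succ := by
  simpa using insPerm_succAbove 0 τ i

theorem sign_insPerm {N : ℕ} (p : Fin (N + 1)) (τ : Perm (Fin N)) :
    Perm.sign (insPerm p τ) = (-1) ^ (p : ℕ) * Perm.sign τ := by
  rw [insPerm, Perm.sign_mul, Fin.sign_cycleRange, Perm.decomposeFin.symm_sign, if_pos rfl,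
    one_mul, mul_comm]

theorem insPerm_bijective (N : ℕ) :
    Function.Bijective fun x : Fin (N + 1) × Perm (Fin N) => insPerm x.1 x.2 := by
  rw [Fintype.bijective_iff_injective_and_card]
  constructor
  · rintro ⟨p, τ⟩ ⟨q, τ'⟩ h
    dsimp only at h
    have hp : p = q := (insPerm q τ').injective (by rw [← h, insPerm_self, h, insPerm_self])
    subst hp
    refine Prod.ext rfl (Equiv.ext fun i => Fin.succ_injective _ ?_)
    simpa using congrArg (fun σ : Perm (Fin (N + 1)) => σ (p.succAbove i)) h
  · rw [Fintype.card_prod, Fintype.card_perm, Fintype.card_perm, Fintype.card_fin,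
      Fintype.card_fin, Nat.factorial_succ]

theorem sum_perm_fin_succ {M : Type*} [AddCommMonoid M] {N : ℕ} (f : Perm (Fin (N + 1)) → M) :
    ∑ σ, f σ = ∑ p, ∑ τ, f (insPerm p τ) := by
  rw [← Fintype.sum_prod_type' fun p τ => f (insPerm p τ)]
  exact ((insPerm_bijective N).sum_comp f).symm

theorem apply_insPerm {α : Type*} {N : ℕ} (p : Fin (N + 1)) (τ : Perm (Fin N)) (x : α)
    (v : Fin N → α) :
    (fun i => Fin.cons (α := fun _ => α) x v (insPerm p τ i)) =
      p.insertNth (α := fun _ => α) x fun i => v (τ i) := by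
  rw [Fin.eq_insertNth_iff]
  refine ⟨by simp, funext fun i => ?_⟩
  simp [Fin.removeNth]

variable (K : Type*) [Field K]

theorem eps_eq_prod {n : ℕ} (σ : Perm (Fin n)) (d : Fin n → ZMod 2) :
    eps K σ d = ((Perm.sign σ : ℤ) : K) * ∏ i, ∏ j,
      if i < j ∧ d (σ i) = 1 ∧ d (σ j) = 1 ∧ σ j < σ i then -1 else 1 := by
  rw [eps, ← Fintype.prod_prod_type', Finset.prod_ite, Finset.prod_const, Finset.prod_const_one,
    mul_one]

/-- The inversions that do not come from `τ` are the pairs formed by `p` and a position in front of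
it, because the value at `p` is the least one. -/
theorem eps_insPerm {N : ℕ} (p : Fin (N + 1)) (τ : Perm (Fin N)) (a : ZMod 2)
    (d : Fin N → ZMod 2) :
    eps K (insPerm p τ) (Fin.cons (α := fun _ => ZMod 2) a d) =
      (-1) ^ (p : ℕ) * sgn K (a * ∑ i, if i.castSucc < p then d (τ i) else 0) * eps K τ d := by
  have h1 : ∀ i : Fin N, (if i.castSucc < p ∧ d (τ i) = 1 ∧ a = 1 then (-1 : K) else 1) =
      sgn K (a * if i.castSucc < p then d (τ i) else 0) := by
    intro i
    have h2 : ∀ x : ZMod 2, x = 0 ∨ x = 1 := by decide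
    by_cases h : i.castSucc < p
    · rcases h2 a with rfl | rfl <;> rcases h2 (d (τ i)) with h' | h' <;> simp [h, h']
    · simp [h]
  rw [eps_eq_prod, eps_eq_prod, sign_insPerm, Fin.prod_univ_succAbove _ p]
  simp only [insPerm_self, Fin.not_lt_zero, and_false, if_false, Finset.prod_const_one, one_mul]
  simp only [Fin.prod_univ_succAbove _ p, insPerm_self, insPerm_succAbove, Fin.cons_zero,
    Fin.cons_succ, Fin.succAbove_lt_succAbove_iff, Fin.succ_lt_succ_iff, Fin.succ_pos, and_true,
    Fin.succAbove_lt_iff_castSucc_lt, h1, Finset.prod_mul_distrib, Finset.mul_sum, sgn_sum]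
  push_cast
  ring

/-- `σ` is increasing on the first `n` elements and on the other elements. -/
def IsShuffle (n : ℕ) {N : ℕ} (σ : Perm (Fin N)) : Prop :=
  ∀ i j : Fin N, i < j → ((j : ℕ) < n ∨ n ≤ (i : ℕ)) → σ i < σ j

instance (n : ℕ) {N : ℕ} (σ : Perm (Fin N)) : Decidable (IsShuffle n σ) := by
  unfold IsShuffle
  infer_instance

theorem mem_shuffles {n m : ℕ} (σ : Perm (Fin (n + m))) :
    σ ∈ shuffles n m ↔ IsShuffle n σ := by
  simp only [shuffles, Finset.mem_filter, Finset.mem_univ, true_and]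
  constructor
  · rintro ⟨h1, h2⟩ i j hij hn
    induction i using Fin.addCases with
    | left i =>
      induction j using Fin.addCases with
      | left j => exact h1 i j hij
      | right j =>
        simp only [Fin.val_natAdd, Fin.val_castAdd] at hn
        omega
    | right i =>
      induction j using Fin.addCases with
      | left j =>
        simp only [Fin.lt_def, Fin.val_natAdd, Fin.val_castAdd] at hij
        omega
      | right j => exact h2 i j ((Fin.natAdd_lt_natAdd_iff n).1 hij)
  · intro h
    exact ⟨fun i j hij => h _ _ hij (Or.inl (by simp)),
      fun i j hij => h _ _ ((Fin.natAdd_lt_natAdd_iff n).2 hij) (Or.inr (by simp))⟩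

theorem isShuffle_insPerm_zero {n N : ℕ} (τ : Perm (Fin N)) :
    IsShuffle (n + 1) (insPerm 0 τ) ↔ IsShuffle n τ := by
  constructor
  · intro h i j hij hn
    simpa using h i.succ j.succ (by simpa using hij) (by simpa using hn)
  · intro h i j hij hn
    induction j using Fin.cases with
    | zero => exact absurd hij (Fin.not_lt_zero _)
    | succ j =>
      induction i using Fin.cases with
      | zero => simp
      | succ i => simpa using h i j (by simpa using hij) (by simpa using hn)

theorem val_succAbove_lt {N : ℕ} (p : Fin (N + 1)) (i : Fin N) :
    (p.succAbove i : ℕ) < p ↔ (i : ℕ) < p := by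
  exact Fin.succAbove_lt_iff_castSucc_lt p i

theorem isShuffle_insPerm_of_eq {N : ℕ} (p : Fin (N + 1)) (τ : Perm (Fin N)) :
    IsShuffle p (insPerm p τ) ↔ IsShuffle p τ := by
  constructor
  · intro h i j hij hn
    have h1 := h (p.succAbove i) (p.succAbove j) (Fin.succAbove_lt_succAbove_iff.2 hij)
      (by rwa [val_succAbove_lt, ← not_lt, val_succAbove_lt, not_lt])
    simpa using h1
  · intro h i j hij hn
    obtain rfl | ⟨j, rfl⟩ := Fin.eq_self_or_eq_succAbove p j
    · rw [Fin.lt_def] at hij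
      omega
    · obtain rfl | ⟨i, rfl⟩ := Fin.eq_self_or_eq_succAbove p i
      · simp
      · rw [val_succAbove_lt, ← not_lt, val_succAbove_lt, not_lt] at hn
        simpa using h i j (Fin.succAbove_lt_succAbove_iff.1 hij) hn

/-- The least value of a shuffle stands at the start of one of the two blocks, at position `0` or
`n`. -/
theorem not_isShuffle_insPerm {n N : ℕ} (p : Fin (N + 1)) (hp : p ≠ 0) (hpn : (p : ℕ) ≠ n)
    (τ : Perm (Fin N)) : ¬ IsShuffle n (insPerm p τ) := by
  intro h
  have hp0 : (p : ℕ) ≠ 0 := fun h0 => hp (Fin.ext h0)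
  -- Otherwise `p - 1` lies in the same block as `p`, and its value would have to be below `0`.
  have h1 := h ⟨p - 1, by omega⟩ p (by rw [Fin.lt_def]; dsimp only; omega)
    (by dsimp only; omega)
  rw [insPerm_self] at h1
  exact Fin.not_lt_zero _ h1

end InsPerm

/-! ### The sum over shuffles satisfies the recursion of `listMul`. -/

section Link

open Equiv

variable {K : Type*} [Field K] {V : Type*} [AddCommGroup V] [Module K V]

/-- The sum over shuffles which gives the composition `F ∘ G` on homogeneous arguments `v` of
degrees `d`, where `G` is homogeneous of degree `β`. -/
def compSum {N n m : ℕ} (h : n + m = N) (β : ZMod 2)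
    (F : MultilinearMap K (fun _ : Fin (n + 1) => V) V)
    (G : MultilinearMap K (fun _ : Fin m => V) V) (d : Fin N → ZMod 2) (v : Fin N → V) : V :=
  ∑ σ : Perm (Fin N), if IsShuffle n σ then
    (eps K σ d * sgn K (β * ∑ i : Fin n, d (σ (Fin.cast h (Fin.castAdd m i))))) •
      F (Fin.snoc (α := fun _ => V) (fun i => v (σ (Fin.cast h (Fin.castAdd m i))))
        (G fun j => v (σ (Fin.cast h (Fin.natAdd n j))))) else 0

/-- The part of `compSum` given by the shuffles with `p ↦ 0`. -/
def compPart {N n m : ℕ} (h : n + m = N + 1) (β : ZMod 2)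
    (F : MultilinearMap K (fun _ : Fin (n + 1) => V) V)
    (G : MultilinearMap K (fun _ : Fin m => V) V) (d : Fin (N + 1) → ZMod 2)
    (v : Fin (N + 1) → V) (p : Fin (N + 1)) : V :=
  ∑ τ : Perm (Fin N), if IsShuffle n (insPerm p τ) then
    (eps K (insPerm p τ) d *
        sgn K (β * ∑ i : Fin n, d (insPerm p τ (Fin.cast h (Fin.castAdd m i))))) •
      F (Fin.snoc (α := fun _ => V) (fun i => v (insPerm p τ (Fin.cast h (Fin.castAdd m i))))
        (G fun j => v (insPerm p τ (Fin.cast h (Fin.natAdd n j))))) else 0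

theorem compSum_eq_sum_compPart {N n m : ℕ} (h : n + m = N + 1) (β : ZMod 2)
    (F : MultilinearMap K (fun _ : Fin (n + 1) => V) V)
    (G : MultilinearMap K (fun _ : Fin m => V) V) (d : Fin (N + 1) → ZMod 2)
    (v : Fin (N + 1) → V) : compSum h β F G d v = ∑ p, compPart h β F G d v p :=
  sum_perm_fin_succ _

theorem compPart_eq_zero {N n m : ℕ} (h : n + m = N + 1) (β : ZMod 2)
    (F : MultilinearMap K (fun _ : Fin (n + 1) => V) V)
    (G : MultilinearMap K (fun _ : Fin m => V) V) (d : Fin (N + 1) → ZMod 2)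
    (v : Fin (N + 1) → V) (p : Fin (N + 1)) (hp : p ≠ 0) (hpn : (p : ℕ) ≠ n) :
    compPart h β F G d v p = 0 :=
  Finset.sum_eq_zero fun τ _ => if_neg (not_isShuffle_insPerm p hp hpn τ)

/-- Here `x` becomes the first argument of `F`. Position `0` creates no inversions, so the only new
sign is that of `x` against `G` in the definition of `F * G`. -/
theorem compPart_zero {N n m : ℕ} (h : n + 1 + m = N + 1) (h' : n + m = N) (β : ZMod 2)
    (F : MultilinearMap K (fun _ : Fin (n + 1 + 1) => V) V)
    (G : MultilinearMap K (fun _ : Fin m => V) V) (a : ZMod 2) (x : V) (d : Fin N → ZMod 2)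
    (v : Fin N → V) :
    compPart h β F G (Fin.cons (α := fun _ => ZMod 2) a d) (Fin.cons (α := fun _ => V) x v) 0 =
      sgn K (β * a) • compSum h' β (F.curryLeft x) G d v := by
  have e0 : Fin.cast h (Fin.castAdd m 0) = 0 := rfl
  have e1 : ∀ i : Fin n, Fin.cast h (Fin.castAdd m i.succ) =
      (Fin.cast h' (Fin.castAdd m i)).succ := fun i => rfl
  have e2 : ∀ j : Fin m, Fin.cast h (Fin.natAdd (n + 1) j) =
      (Fin.cast h' (Fin.natAdd n j)).succ := fun j => Fin.ext (by simp; omega)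
  rw [compPart, compSum, Finset.smul_sum]
  refine Finset.sum_congr rfl fun τ _ => ?_
  rw [smul_ite, smul_zero]
  refine if_congr (isShuffle_insPerm_zero τ) ?_ rfl
  rw [smul_smul]
  congr 1
  · rw [eps_insPerm, Fin.sum_univ_succ]
    simp only [e0, e1, insPerm_zero_zero, insPerm_zero_succ, Fin.cons_zero, Fin.cons_succ,
      Fin.not_lt_zero, if_false, Finset.sum_const_zero, mul_zero, sgn_zero, Fin.val_zero, pow_zero,
      one_mul, mul_add, sgn_add]
    ring
  · rw [MultilinearMap.curryLeft_apply, Fin.cons_snoc_eq_snoc_cons]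
    simp only [e2, insPerm_zero_succ, Fin.cons_succ]
    congr 2
    funext i
    induction i using Fin.cases with
    | zero => simp [e0]
    | succ i => simp [e1]

/-- Here `x` becomes the first argument of `G`, at position `n`. The `n` new inversions give `sgn K
n` and the parity signs of `x` against the other arguments of `F`; the latter combine with the sign
of `F * G` to the one belonging to degree `β + a`. -/
theorem compPart_last {N n m : ℕ} (h : n + (m + 1) = N + 1) (h' : n + m = N) (β : ZMod 2)
    (F : MultilinearMap K (fun _ : Fin (n + 1) => V) V)
    (G : MultilinearMap K (fun _ : Fin (m + 1) => V) V) (a : ZMod 2) (x : V)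
    (d : Fin N → ZMod 2) (v : Fin N → V) (p : Fin (N + 1)) (hp : (p : ℕ) = n) :
    compPart h β F G (Fin.cons (α := fun _ => ZMod 2) a d) (Fin.cons (α := fun _ => V) x v) p =
      sgn K n • compSum h' (β + a) F (G.curryLeft x) d v := by
  have e0 : Fin.cast h (Fin.natAdd n 0) = p := Fin.ext (by simp [hp])
  have e1 : ∀ i : Fin n, Fin.cast h (Fin.castAdd (m + 1) i) =
      p.succAbove (Fin.cast h' (Fin.castAdd m i)) := fun i => by
    rw [Fin.succAbove_of_castSucc_lt _ _ (by rw [Fin.lt_def, hp]; exact i.2)]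
    rfl
  have e2 : ∀ j : Fin m, Fin.cast h (Fin.natAdd n j.succ) =
      p.succAbove (Fin.cast h' (Fin.natAdd n j)) := fun j => by
    rw [Fin.succAbove_of_le_castSucc _ _ (by rw [Fin.le_def, hp]; simp)]
    rfl
  have e3 : ∀ τ : Perm (Fin N), (∑ i : Fin N, if i.castSucc < p then d (τ i) else 0) =
      ∑ i : Fin n, d (τ (Fin.cast h' (Fin.castAdd m i))) := by
    intro τ
    subst h'
    rw [Fin.sum_univ_add]
    have h1 : ∀ i : Fin n, (Fin.castAdd m i).castSucc < p := fun i => by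
      rw [Fin.lt_def, hp]; exact i.2
    have h2 : ∀ j : Fin m, ¬ (Fin.natAdd n j).castSucc < p := fun j => by
      rw [Fin.lt_def, hp]; simp
    simp only [h1, h2, if_true, if_false, Finset.sum_const_zero, add_zero]
    rfl
  rw [compPart, compSum, Finset.smul_sum]
  refine Finset.sum_congr rfl fun τ _ => ?_
  rw [smul_ite, smul_zero]
  refine if_congr (by subst hp; exact isShuffle_insPerm_of_eq p τ) ?_ rfl
  rw [smul_smul]
  congr 1
  · rw [eps_insPerm, e3, hp, sgn_natCast]
    simp only [e1, insPerm_succAbove, Fin.cons_succ, add_mul, sgn_add]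
    ring
  · simp only [e1, insPerm_succAbove, Fin.cons_succ]
    congr 2
    rw [MultilinearMap.curryLeft_apply]
    congr 1
    funext j
    induction j using Fin.cases with
    | zero => simp only [e0, insPerm_self, Fin.cons_zero]
    | succ j => simp only [e2, insPerm_succAbove, Fin.cons_succ]

theorem homogeneous_curryLeft {𝒱 : ZMod 2 → Submodule K V} {m : ℕ} {β : ZMod 2}
    {G : MultilinearMap K (fun _ : Fin (m + 1) => V) V} (hG : G ∈ homogeneous 𝒱 (m + 1) β)
    (a : ZMod 2) (x : V) (hx : x ∈ 𝒱 a) : G.curryLeft x ∈ homogeneous 𝒱 m (β + a) := by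
  intro d v hv
  have h := hG (Fin.cons a d) (Fin.cons x v) fun i => by
    induction i using Fin.cases with
    | zero => exact hx
    | succ i => exact hv i
  rw [Fin.sum_univ_succ] at h
  simp only [Fin.cons_zero, Fin.cons_succ] at h
  rwa [add_comm β a, ← add_assoc, add_comm _ a, MultilinearMap.curryLeft_apply]

variable (𝒱 : ZMod 2 → Submodule K V) [DirectSum.Decomposition 𝒱]

/-- A multilinear map as a map on lists of labelled vectors; each vector is projected to the
component given by its label. -/
noncomputable def toListMap :
    (a : ℕ) → MultilinearMap K (fun _ : Fin a => V) V → ListMap V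
  | 0, F, [] => F Fin.elim0
  | 0, _, _ :: _ => 0
  | _ + 1, _, [] => 0
  | a + 1, F, x :: l => toListMap a (F.curryLeft (proj 𝒱 x.1 x.2)) l

theorem contract_toListMap_zero (x : ZMod 2 × V) (F : MultilinearMap K (fun _ : Fin 0 => V) V) :
    contract x (toListMap 𝒱 0 F) = 0 := rfl

theorem contract_toListMap_succ (x : ZMod 2 × V) (a : ℕ)
    (F : MultilinearMap K (fun _ : Fin (a + 1) => V) V) :
    contract x (toListMap 𝒱 (a + 1) F) = toListMap 𝒱 a (F.curryLeft (proj 𝒱 x.1 x.2)) := rfl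

theorem toListMap_cons (x : ZMod 2 × V) (l : List (ZMod 2 × V)) (a : ℕ)
    (F : MultilinearMap K (fun _ : Fin (a + 1) => V) V) :
    toListMap 𝒱 (a + 1) F (x :: l) = toListMap 𝒱 a (F.curryLeft (proj 𝒱 x.1 x.2)) l := rfl

theorem toListMap_add (a : ℕ) (F G : MultilinearMap K (fun _ : Fin a => V) V) :
    toListMap 𝒱 a (F + G) = toListMap 𝒱 a F + toListMap 𝒱 a G := by
  funext l
  induction l generalizing a with
  | nil => cases a <;> simp [toListMap]
  | cons x l ih =>
    cases a with
    | zero => simp [toListMap]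
    | succ a => exact ih a (F.curryLeft (proj 𝒱 x.1 x.2)) (G.curryLeft (proj 𝒱 x.1 x.2))

theorem toListMap_smul (a : ℕ) (c : K) (F : MultilinearMap K (fun _ : Fin a => V) V) :
    toListMap 𝒱 a (c • F) = c • toListMap 𝒱 a F := by
  funext l
  induction l generalizing a with
  | nil => cases a <;> simp [toListMap]
  | cons x l ih =>
    cases a with
    | zero => simp [toListMap]
    | succ a => exact ih a (F.curryLeft (proj 𝒱 x.1 x.2))

theorem toListMap_eq_zero_of_length (a : ℕ) (F : MultilinearMap K (fun _ : Fin a => V) V)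
    (l : List (ZMod 2 × V)) (h : l.length ≠ a) : toListMap 𝒱 a F l = 0 := by
  induction l generalizing a with
  | nil => cases a <;> simp_all [toListMap]
  | cons x l ih =>
    cases a with
    | zero => rfl
    | succ a => exact ih a _ fun h' => h (by rw [List.length_cons, h'])

theorem toListMap_ofFn (a : ℕ) (F : MultilinearMap K (fun _ : Fin a => V) V)
    (w : Fin a → ZMod 2 × V) :
    toListMap 𝒱 a F (List.ofFn w) = F fun i => proj 𝒱 (w i).1 (w i).2 := by
  induction a with
  | zero =>
    rw [List.ofFn_zero]
    exact congrArg F (Subsingleton.elim _ _)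
  | succ a ih =>
    rw [List.ofFn_succ, toListMap_cons, ih, MultilinearMap.curryLeft_apply]
    congr 1
    funext i
    induction i using Fin.cases <;> rfl

theorem isLinearListMap_toListMap (a : ℕ) (F : MultilinearMap K (fun _ : Fin a => V) V) :
    IsLinearListMap K (toListMap 𝒱 a F) := by
  constructor
  · intro l₁ α x y l₂
    induction l₁ generalizing a with
    | nil =>
      cases a with
      | zero => exact (add_zero 0).symm
      | succ a => simp only [List.nil_append, toListMap_cons, map_add, toListMap_add, Pi.add_apply]
    | cons z l₁ ih =>
      cases a with
      | zero => exact (add_zero 0).symm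
      | succ a => exact ih a _
  · intro l₁ α c x l₂
    induction l₁ generalizing a with
    | nil =>
      cases a with
      | zero => exact (smul_zero c).symm
      | succ a =>
        simp only [List.nil_append, toListMap_cons, map_smul, toListMap_smul, Pi.smul_apply]
    | cons z l₁ ih =>
      cases a with
      | zero => exact (smul_zero c).symm
      | succ a => exact ih a _

theorem hasLengthParity_toListMap (n : ℕ) (F : MultilinearMap K (fun _ : Fin (n + 1) => V) V) :
    HasLengthParity (n : ZMod 2) (toListMap 𝒱 (n + 1) F) := fun l hl =>
  toListMap_eq_zero_of_length 𝒱 _ F l fun h => hl (by rw [h, Nat.cast_succ])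

/-- This covers maps `φ` without arguments, such as the contraction of a map of one argument: there
is no place to insert `ψ`. -/
theorem listMul_eq_zero_of_contract (n β : ZMod 2) (φ ψ : ListMap V)
    (h : ∀ x, contract x φ = 0) : listMul K n β φ ψ = 0 := by
  funext l
  induction l generalizing n β ψ with
  | nil => exact congrFun (h _) []
  | cons x l ih =>
    rw [listMul_cons, h, listMul_zero_left, ih]
    simp

theorem listMul_eq_zero_of_length {a m : ℕ} {φ ψ : ListMap V}
    (hφ : ∀ l, l.length ≠ a → φ l = 0) (hψ : ∀ l, l.length ≠ m → ψ l = 0)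
    (hφ' : IsLinearListMap K φ) (n β : ZMod 2) (l : List (ZMod 2 × V))
    (hl : l.length + 1 ≠ a + m) : listMul K n β φ ψ l = 0 := by
  induction l generalizing n β φ ψ a m with
  | nil =>
    rw [listMul_nil]
    by_cases ha : a = 1
    · rw [hψ [] fun h => hl (by rw [← h, ha]; rfl)]
      simpa using hφ'.smul [] β (0 : K) 0 []
    · exact hφ _ fun h => ha h.symm
  | cons x l ih =>
    rw [List.length_cons] at hl
    have h1 : listMul K (n + 1) β (contract x φ) ψ l = 0 := by
      cases a with
      | zero =>
        rw [show contract x φ = 0 from funext fun l => hφ _ (Nat.succ_ne_zero _),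
          listMul_zero_left, Pi.zero_apply]
      | succ a =>
        exact ih (a := a) (fun l h => hφ _ (by simpa using h)) hψ (hφ'.contract x) _ _
          (by omega)
    have h2 : listMul K n (β + x.1) φ (contract x ψ) l = 0 := by
      cases m with
      | zero =>
        rw [show contract x ψ = 0 from funext fun l => hψ _ (Nat.succ_ne_zero _),
          hφ'.listMul_zero_right, Pi.zero_apply]
      | succ m =>
        exact ih (m := m) hφ (fun l h => hψ _ (by simpa using h)) hφ' _ _ (by omega)
    rw [listMul_cons, h1, h2, smul_zero, smul_zero, add_zero]

variable {𝒱}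

/-- Both sides satisfy the same recursion in the first argument. The arity `m` of `G` may be zero,
since the recursion uses up the arguments of both maps. -/
theorem compSum_eq_listMul {N n m : ℕ} (h : n + m = N) (β : ZMod 2)
    (F : MultilinearMap K (fun _ : Fin (n + 1) => V) V)
    (G : MultilinearMap K (fun _ : Fin m => V) V) (hG : G ∈ homogeneous 𝒱 m β)
    (w : Fin N → ZMod 2 × V) :
    compSum h β F G (fun i => (w i).1) (fun i => proj 𝒱 (w i).1 (w i).2) =
      listMul K n β (toListMap 𝒱 (n + 1) F) (toListMap 𝒱 m G) (List.ofFn w) := by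
  induction N generalizing n m β with
  | zero =>
    obtain ⟨rfl, rfl⟩ : n = 0 ∧ m = 0 := by omega
    -- `toListMap` projects the inserted value to the component of its label; by homogeneity of `G`
    -- this changes nothing.
    have h1 : proj 𝒱 β (G Fin.elim0) = G Fin.elim0 := by
      rw [proj_of_mem 𝒱 β β _ (by simpa using hG Fin.elim0 Fin.elim0 fun i => i.elim0), if_pos rfl]
    rw [List.ofFn_zero, listMul_nil, compSum, Fintype.sum_unique,
      if_pos (show IsShuffle 0 _ from fun i => i.elim0)]
    simp only [toListMap, h1, MultilinearMap.curryLeft_apply]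
    have h2 : eps K (default : Perm (Fin 0)) (fun i => (w i).1) = 1 := by
      simp [eps]
    rw [h2, Finset.univ_eq_empty, Finset.sum_empty, mul_zero, sgn_zero, one_mul, one_smul]
    congr 1
    funext i
    obtain rfl : i = 0 := Fin.eq_zero i
    exact congrArg G (Subsingleton.elim _ _)
  | succ N ih =>
    have hd : (fun i => (w i).1) = Fin.cons (α := fun _ => ZMod 2) (w 0).1 fun i => (w i.succ).1 :=
      funext fun i => by induction i using Fin.cases <;> rfl
    have hv : (fun i => proj 𝒱 (w i).1 (w i).2) = Fin.cons (α := fun _ => V)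
        (proj 𝒱 (w 0).1 (w 0).2) fun i => proj 𝒱 (w i.succ).1 (w i.succ).2 :=
      funext fun i => by induction i using Fin.cases <;> rfl
    rw [List.ofFn_succ, listMul_cons, compSum_eq_sum_compPart, hd, hv]
    -- For `n = 0` the two possible positions of the value `0` coincide and only the term with `x`
    -- in `G` remains. For `m = 0` the second block is empty and only the term with `x` in `F`
    -- remains.
    rcases n with _ | n
    · obtain rfl : m = N + 1 := by omega
      rw [Fintype.sum_eq_single 0 fun p hp => compPart_eq_zero _ _ _ _ _ _ p hp
        fun h => hp (Fin.ext h), compPart_last h (zero_add N) β F G _ _ _ _ 0 rfl,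
        ih (zero_add N) _ _ _ (homogeneous_curryLeft hG _ _ (proj_mem _ _ _)),
        listMul_eq_zero_of_contract (_ + 1) β _ _ fun x => ?_]
      · simp [contract_toListMap_succ]
      · rw [contract_toListMap_succ, contract_toListMap_zero]
    · rcases m with _ | m
      · obtain rfl : n = N := by omega
        rw [Fintype.sum_eq_single 0 fun p hp => compPart_eq_zero _ _ _ _ _ _ p hp (by omega),
          compPart_zero h (add_zero n), ih (add_zero n) _ _ _ hG, contract_toListMap_zero,
          (isLinearListMap_toListMap 𝒱 _ _).listMul_zero_right, contract_toListMap_succ]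
        simp [add_assoc, CharTwo.add_self_eq_zero]
      · have hne : (0 : Fin (N + 1)) ≠ ⟨n + 1, by omega⟩ := by simp [Fin.ext_iff]
        rw [← Finset.sum_subset (Finset.subset_univ {0, ⟨n + 1, by omega⟩}),
          Finset.sum_pair hne, compPart_zero h (by omega),
          compPart_last h (show n + 1 + m = N by omega) β F G _ _ _ _ _ rfl,
          ih _ _ _ _ hG, ih _ _ _ _ (homogeneous_curryLeft hG _ _ (proj_mem _ _ _)),
          contract_toListMap_succ, contract_toListMap_succ]
        · simp [add_assoc, CharTwo.add_self_eq_zero]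
        · intro p _ hp
          simp only [Finset.mem_insert, Finset.mem_singleton, not_or] at hp
          exact compPart_eq_zero _ _ _ _ _ _ p hp.1 fun h => hp.2 (Fin.ext h)

end Link

/-! ### Evaluation of the operations on homogeneous arguments. -/

section Homogeneous

open Equiv

variable {K : Type*} [Field K] {V : Type*} [AddCommGroup V] [Module K V]

theorem cons_mem_homogeneous {𝒱 : ZMod 2 → Submodule K V} {n : ℕ} {a : ZMod 2} {x : V}
    (hx : x ∈ 𝒱 a) {d : Fin n → ZMod 2} {v : Fin n → V} (hv : ∀ i, v i ∈ 𝒱 (d i))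
    (i : Fin (n + 1)) :
    Fin.cons (α := fun _ => V) x v i ∈ 𝒱 (Fin.cons (α := fun _ => ZMod 2) a d i) := by
  induction i using Fin.cases with
  | zero => exact hx
  | succ i => exact hv i

variable {𝒱 : ZMod 2 → Submodule K V} [DirectSum.Decomposition 𝒱]

theorem proj_self {α : ZMod 2} {x : V} (hx : x ∈ 𝒱 α) : proj 𝒱 α x = x := by
  rw [proj_of_mem 𝒱 α α x hx, if_pos rfl]

theorem proj_eq_zero {α β : ZMod 2} {x : V} (hx : x ∈ 𝒱 β) (h : α ≠ β) : proj 𝒱 α x = 0 := by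
  rw [proj_of_mem 𝒱 α β x hx, if_neg h]

theorem apply_eq_sum_proj {n : ℕ} (F : MultilinearMap K (fun _ : Fin n => V) V) (v : Fin n → V) :
    F v = ∑ d : Fin n → ZMod 2, F fun i => proj 𝒱 (d i) (v i) := by
  rw [← MultilinearMap.map_sum F fun i α => proj 𝒱 α (v i)]
  exact congrArg F (funext fun i => (sum_proj 𝒱 (v i)).symm)

variable (𝒱) in
theorem ext_of_homogeneous {n : ℕ} {F G : MultilinearMap K (fun _ : Fin n => V) V}
    (h : ∀ (d : Fin n → ZMod 2) (v : Fin n → V), (∀ i, v i ∈ 𝒱 (d i)) → F v = G v) : F = G := by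
  refine MultilinearMap.ext fun v => ?_
  rw [apply_eq_sum_proj (𝒱 := 𝒱) F, apply_eq_sum_proj (𝒱 := 𝒱) G]
  exact Finset.sum_congr rfl fun d _ => h d _ fun i => proj_mem 𝒱 _ _

theorem exists_proj_eq_zero {n : ℕ} {d d' : Fin n → ZMod 2} {v : Fin n → V}
    (hv : ∀ i, v i ∈ 𝒱 (d i)) (h : d' ≠ d) : ∃ i, proj 𝒱 (d' i) (v i) = 0 := by
  obtain ⟨i, hi⟩ := Function.ne_iff.1 h
  exact ⟨i, proj_eq_zero (hv i) hi⟩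

theorem permAct_apply {n : ℕ} (σ : Perm (Fin n)) (F : MultilinearMap K (fun _ : Fin n => V) V)
    (v : Fin n → V) : permAct 𝒱 σ F v =
      ∑ d : Fin n → ZMod 2, eps K σ d • F fun i => proj 𝒱 (d (σ i)) (v (σ i)) := by
  simp [permAct]

theorem permAct_apply_of_mem {n : ℕ} (σ : Perm (Fin n))
    (F : MultilinearMap K (fun _ : Fin n => V) V) {d : Fin n → ZMod 2} {v : Fin n → V}
    (hv : ∀ i, v i ∈ 𝒱 (d i)) : permAct 𝒱 σ F v = eps K σ d • F fun i => v (σ i) := by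
  rw [permAct_apply, Fintype.sum_eq_single d]
  · congr 2
    exact funext fun i => proj_self (hv _)
  · intro d' hd'
    obtain ⟨i, hi⟩ := exists_proj_eq_zero hv hd'
    rw [F.map_coord_zero (σ.symm i) (by simpa using hi), smul_zero]

theorem homPart_apply {n : ℕ} (β : ZMod 2) (F : MultilinearMap K (fun _ : Fin n => V) V)
    (v : Fin n → V) : homPart 𝒱 β F v =
      ∑ d : Fin n → ZMod 2, proj 𝒱 ((∑ i, d i) + β) (F fun i => proj 𝒱 (d i) (v i)) := by
  simp [homPart]

theorem homPart_apply_of_mem {n : ℕ} (β : ZMod 2) (F : MultilinearMap K (fun _ : Fin n => V) V)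
    {d : Fin n → ZMod 2} {v : Fin n → V} (hv : ∀ i, v i ∈ 𝒱 (d i)) :
    homPart 𝒱 β F v = proj 𝒱 ((∑ i, d i) + β) (F v) := by
  rw [homPart_apply, Fintype.sum_eq_single d]
  · congr 2
    exact funext fun i => proj_self (hv _)
  · intro d' hd'
    obtain ⟨i, hi⟩ := exists_proj_eq_zero hv hd'
    rw [F.map_coord_zero i hi, map_zero]

theorem homPart_mem {n : ℕ} (β : ZMod 2) (F : MultilinearMap K (fun _ : Fin n => V) V) :
    homPart 𝒱 β F ∈ homogeneous 𝒱 n β := fun d v hv => by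
  rw [homPart_apply_of_mem β F hv]
  exact proj_mem 𝒱 _ _

theorem homPart_of_mem {n : ℕ} {β : ZMod 2} (γ : ZMod 2)
    {F : MultilinearMap K (fun _ : Fin n => V) V} (hF : F ∈ homogeneous 𝒱 n β) :
    homPart 𝒱 γ F = if γ = β then F else 0 := by
  refine ext_of_homogeneous 𝒱 fun d v hv => ?_
  rw [homPart_apply_of_mem γ F hv, proj_of_mem 𝒱 _ _ _ (hF d v hv)]
  by_cases h : γ = β
  · simp [h]
  · rw [if_neg h, if_neg fun h' => h (add_left_cancel h')]
    rfl

theorem sum_homPart {n : ℕ} (F : MultilinearMap K (fun _ : Fin n => V) V) :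
    ∑ β, homPart 𝒱 β F = F := by
  refine ext_of_homogeneous 𝒱 fun d v hv => ?_
  rw [sum_apply]
  simp only [homPart_apply_of_mem _ F hv]
  exact (Equiv.sum_comp (Equiv.addLeft (∑ i, d i)) fun β => proj 𝒱 β (F v)).trans
    (sum_proj 𝒱 (F v))

theorem starMul_apply {n m : ℕ} (F : MultilinearMap K (fun _ : Fin (n + 1) => V) V)
    (G : MultilinearMap K (fun _ : Fin m => V) V) (v : Fin (n + m) → V) :
    starMul 𝒱 F G v = ∑ β : ZMod 2, ∑ d : Fin n → ZMod 2, sgn K (β * ∑ i, d i) •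
      F (Fin.snoc (α := fun _ => V) (fun i => proj 𝒱 (d i) (v (Fin.castAdd m i)))
        (homPart 𝒱 β G fun j => v (Fin.natAdd n j))) := by
  simp only [starMul, sum_apply, smul_apply, insertLast_apply,
    MultilinearMap.compLinearMap_apply]
  refine Finset.sum_congr rfl fun β _ => Finset.sum_congr rfl fun d _ => ?_
  congr 2
  funext i
  induction i using Fin.lastCases <;> simp

theorem starMul_apply_of_mem {n m : ℕ} {β : ZMod 2}
    (F : MultilinearMap K (fun _ : Fin (n + 1) => V) V)
    {G : MultilinearMap K (fun _ : Fin m => V) V} (hG : G ∈ homogeneous 𝒱 m β)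
    {d : Fin (n + m) → ZMod 2} {v : Fin (n + m) → V} (hv : ∀ i, v i ∈ 𝒱 (d i)) :
    starMul 𝒱 F G v = sgn K (β * ∑ i, d (Fin.castAdd m i)) •
      F (Fin.snoc (α := fun _ => V) (fun i => v (Fin.castAdd m i))
        (G fun j => v (Fin.natAdd n j))) := by
  rw [starMul_apply, Fintype.sum_eq_single β,
    Fintype.sum_eq_single fun i => d (Fin.castAdd m i)]
  · simp only [homPart_of_mem β hG, if_true]
    congr 3
    exact funext fun i => proj_self (hv _)
  · intro d' hd'
    obtain ⟨i, hi⟩ := exists_proj_eq_zero (fun i => hv (Fin.castAdd m i)) hd'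
    rw [F.map_coord_zero i.castSucc (by simpa using hi), smul_zero]
  · intro γ hγ
    refine Finset.sum_eq_zero fun d' _ => ?_
    rw [homPart_of_mem γ hG, if_neg hγ, F.map_coord_zero (Fin.last n) (by simp), smul_zero]

theorem circ_apply {n m : ℕ} (F : MultilinearMap K (fun _ : Fin (n + 1) => V) V)
    (G : MultilinearMap K (fun _ : Fin (m + 1) => V) V) :
    circ 𝒱 n m F G = ∑ σ ∈ shuffles n (m + 1), permAct 𝒱 σ (starMul 𝒱 F G) := rfl

theorem circ_apply_of_mem {n m : ℕ} {β : ZMod 2}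
    (F : MultilinearMap K (fun _ : Fin (n + 1) => V) V)
    {G : MultilinearMap K (fun _ : Fin (m + 1) => V) V} (hG : G ∈ homogeneous 𝒱 (m + 1) β)
    {d : Fin (n + m + 1) → ZMod 2} {v : Fin (n + m + 1) → V} (hv : ∀ i, v i ∈ 𝒱 (d i)) :
    circ 𝒱 n m F G v = compSum (m := m + 1) rfl β F G d v := by
  rw [circ_apply, sum_apply, compSum, ← Finset.sum_filter]
  refine Finset.sum_congr (Finset.ext fun σ => ?_) fun σ _ => ?_
  · rw [Finset.mem_filter, and_iff_right (Finset.mem_univ _)]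
    exact mem_shuffles σ
  · rw [permAct_apply_of_mem (n := n + (m + 1)) σ _ hv,
      starMul_apply_of_mem F hG (d := fun i => d (σ i)) fun i => hv _, smul_smul]
    rfl

/-- The bridge between the two descriptions of the composition. Only `G` has to be homogeneous,
because only its degree enters the signs. -/
theorem toListMap_circ {n m : ℕ} {β : ZMod 2}
    (F : MultilinearMap K (fun _ : Fin (n + 1) => V) V)
    {G : MultilinearMap K (fun _ : Fin (m + 1) => V) V} (hG : G ∈ homogeneous 𝒱 (m + 1) β) :
    toListMap 𝒱 (n + m + 1) (circ 𝒱 n m F G) =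
      listMul K n β (toListMap 𝒱 (n + 1) F) (toListMap 𝒱 (m + 1) G) := by
  funext l
  by_cases hl : l.length = n + m + 1
  · obtain ⟨w, rfl⟩ : ∃ w : Fin (n + m + 1) → ZMod 2 × V, l = List.ofFn w := by
      rw [← hl]
      exact ⟨l.get, (List.ofFn_get l).symm⟩
    rw [toListMap_ofFn, ← compSum_eq_listMul (m := m + 1) rfl β F G hG w,
      circ_apply_of_mem F hG fun i => proj_mem 𝒱 _ _]
    rfl
  · rw [toListMap_eq_zero_of_length 𝒱 _ _ l hl,
      listMul_eq_zero_of_length (toListMap_eq_zero_of_length 𝒱 _ F)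
        (toListMap_eq_zero_of_length 𝒱 _ G) (isLinearListMap_toListMap 𝒱 _ _) _ _ l (by omega)]

/-- Homogeneous vectors labelled by their own degrees are not changed by the projections, and a
multilinear map is determined by its values on them. -/
theorem toListMap_injective (a : ℕ) : Function.Injective (toListMap (K := K) 𝒱 a) := by
  intro F G h
  refine ext_of_homogeneous 𝒱 fun d v hv => ?_
  have h1 := congrFun h (List.ofFn fun i => (d i, v i))
  rw [toListMap_ofFn, toListMap_ofFn] at h1
  simpa only [proj_self (hv _)] using h1

/-! ### Signed symmetric maps -/

theorem mem_superAlt_iff {n : ℕ} {F : MultilinearMap K (fun _ : Fin n => V) V} :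
    F ∈ superAlt 𝒱 n ↔ ∀ (σ : Perm (Fin n)) (d : Fin n → ZMod 2) (v : Fin n → V),
      (∀ i, v i ∈ 𝒱 (d i)) → F v = eps K σ d • F fun i => v (σ i) := by
  simp only [superAlt, Submodule.mem_iInf, LinearMap.mem_ker, LinearMap.sub_apply,
    LinearMap.id_apply, sub_eq_zero]
  constructor
  · intro h σ d v hv
    rw [← permAct_apply_of_mem σ F hv, h σ]
  · intro h σ
    exact ext_of_homogeneous 𝒱 fun d v hv => by rw [permAct_apply_of_mem σ F hv, ← h σ d v hv]

theorem superAlt_insPerm {n : ℕ} {F : MultilinearMap K (fun _ : Fin (n + 1) => V) V}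
    (hF : F ∈ superAlt 𝒱 (n + 1)) (p : Fin (n + 1)) (τ : Perm (Fin n)) {a : ZMod 2} {x : V}
    (hx : x ∈ 𝒱 a) {d : Fin n → ZMod 2} {v : Fin n → V} (hv : ∀ i, v i ∈ 𝒱 (d i)) :
    F (Fin.cons (α := fun _ => V) x v) = ((-1) ^ (p : ℕ) *
      sgn K (a * ∑ i, if i.castSucc < p then d (τ i) else 0) * eps K τ d) •
        F (p.insertNth (α := fun _ => V) x fun i => v (τ i)) := by
  rw [mem_superAlt_iff.1 hF (insPerm p τ) _ _ (cons_mem_homogeneous hx hv), eps_insPerm,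
    apply_insPerm]

theorem superAlt_curryLeft {n : ℕ} {F : MultilinearMap K (fun _ : Fin (n + 1) => V) V}
    (hF : F ∈ superAlt 𝒱 (n + 1)) {a : ZMod 2} {x : V} (hx : x ∈ 𝒱 a) :
    F.curryLeft x ∈ superAlt 𝒱 n :=
  mem_superAlt_iff.2 fun τ d v hv => by
    rw [MultilinearMap.curryLeft_apply, MultilinearMap.curryLeft_apply,
      superAlt_insPerm hF 0 τ hx hv, Fin.insertNth_zero']
    simp

theorem eps_one {n : ℕ} (d : Fin n → ZMod 2) : eps K (1 : Perm (Fin n)) d = 1 := by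
  rw [eps, Finset.filter_false_of_mem]
  · simp
  · rintro ⟨i, j⟩ - ⟨h1, -, -, h2⟩
    exact lt_asymm h1 h2

theorem superAlt_curryLeft_curryLeft {n : ℕ}
    {F : MultilinearMap K (fun _ : Fin (n + 1 + 1) => V) V}
    (hF : F ∈ superAlt 𝒱 (n + 1 + 1)) {a b : ZMod 2} {x y : V} (hx : x ∈ 𝒱 a) (hy : y ∈ 𝒱 b) :
    (F.curryLeft x).curryLeft y = -(sgn K (a * b) • (F.curryLeft y).curryLeft x) := by
  refine ext_of_homogeneous 𝒱 fun d v hv => ?_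
  have h := superAlt_insPerm hF 1 1 hx (cons_mem_homogeneous hy hv)
  simp only [Perm.one_apply, eps_one] at h
  rw [← Fin.succ_zero_eq_one, Fin.insertNth_succ_cons, Fin.insertNth_zero'] at h
  rw [MultilinearMap.curryLeft_apply, MultilinearMap.curryLeft_apply, h]
  simp

theorem isAltListMap_toListMap {n : ℕ} {F : MultilinearMap K (fun _ : Fin n => V) V}
    (hF : F ∈ superAlt 𝒱 n) : IsAltListMap K (toListMap 𝒱 n F) := by
  intro l₁ x y l₂
  induction l₁ generalizing n with
  | nil =>
    rcases n with _ | _ | n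
    · simp [toListMap]
    · simp [toListMap]
    · simp only [List.nil_append, toListMap_cons]
      rw [superAlt_curryLeft_curryLeft hF (proj_mem 𝒱 x.1 x.2) (proj_mem 𝒱 y.1 y.2), ← neg_smul,
        toListMap_smul, Pi.smul_apply, neg_smul]
  | cons z l₁ ih =>
    rcases n with _ | n
    · simp [toListMap]
    · exact ih (superAlt_curryLeft hF (proj_mem 𝒱 z.1 z.2))

/-- The vector `x` moves to the right one neighbour at a time: it is exchanged with the first entry
`y`, and the induction hypothesis is applied after contraction with `y`. -/
theorem insertNth_of_isAltListMap {n : ℕ} {F : MultilinearMap K (fun _ : Fin (n + 1) => V) V}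
    (hF : IsAltListMap K (toListMap 𝒱 (n + 1) F)) (p : Fin (n + 1)) {a : ZMod 2} {x : V}
    (hx : x ∈ 𝒱 a) {d : Fin n → ZMod 2} {v : Fin n → V} (hv : ∀ i, v i ∈ 𝒱 (d i)) :
    F (Fin.cons (α := fun _ => V) x v) = ((-1) ^ (p : ℕ) *
      sgn K (a * ∑ i, if i.castSucc < p then d i else 0)) •
        F (p.insertNth (α := fun _ => V) x v) := by
  induction n with
  | zero =>
    obtain rfl : p = 0 := Fin.eq_zero p
    rw [Fin.insertNth_zero']
    simp
  | succ n ih =>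
    induction p using Fin.cases with
    | zero =>
      rw [Fin.insertNth_zero']
      simp
    | succ p =>
      obtain ⟨y, u, rfl⟩ : ∃ y u, v = Fin.cons (α := fun _ => V) y u :=
        ⟨v 0, fun i => v i.succ, (Fin.cons_self_tail v).symm⟩
      have hu : ∀ i : Fin n, u i ∈ 𝒱 (d i.succ) := fun i => by simpa using hv i.succ
      have hy : y ∈ 𝒱 (d 0) := by simpa using hv 0
      have h1 : toListMap 𝒱 n ((F.curryLeft x).curryLeft y) =
          -(sgn K (a * d 0) • toListMap 𝒱 n ((F.curryLeft y).curryLeft x)) := by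
        have h := hF.contract_contract (a, x) (d 0, y)
        simpa only [contract_toListMap_succ, proj_self hx, proj_self hy] using h
      rw [← neg_smul, ← toListMap_smul] at h1
      have h2 := DFunLike.congr_fun (toListMap_injective n h1) u
      have h3 : IsAltListMap K (toListMap 𝒱 (n + 1) (F.curryLeft y)) := by
        have h := hF.contract (d 0, y)
        rwa [contract_toListMap_succ, proj_self hy] at h
      have h4 := ih h3 p hu
      simp only [smul_apply, MultilinearMap.curryLeft_apply] at h2 h4
      rw [h4] at h2
      rw [h2, Fin.insertNth_succ_cons, smul_smul, Fin.sum_univ_succ]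
      congr 1
      simp only [Fin.castSucc_zero, Fin.succ_pos, if_true, Fin.castSucc_succ,
        Fin.succ_lt_succ_iff, Fin.val_succ, pow_succ, mul_add, sgn_add]
      ring

/-- Neighbour exchanges suffice: with `σ = insPerm p τ`, the tail is permuted by `τ` by induction,
and the first argument is then moved to position `p`. -/
theorem mem_superAlt_of_isAltListMap {n : ℕ} {F : MultilinearMap K (fun _ : Fin n => V) V}
    (hF : IsAltListMap K (toListMap 𝒱 n F)) : F ∈ superAlt 𝒱 n := by
  induction n with
  | zero =>
    refine mem_superAlt_iff.2 fun σ d v _ => ?_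
    rw [Subsingleton.elim σ 1, eps_one, one_smul]
    rfl
  | succ n ih =>
    refine mem_superAlt_iff.2 fun σ d v hv => ?_
    obtain ⟨⟨p, τ⟩, rfl⟩ := (insPerm_bijective n).2 σ
    obtain ⟨x, u, rfl⟩ : ∃ x u, v = Fin.cons (α := fun _ => V) x u :=
      ⟨v 0, fun i => v i.succ, (Fin.cons_self_tail v).symm⟩
    obtain ⟨a, e, rfl⟩ : ∃ a e, d = Fin.cons (α := fun _ => ZMod 2) a e :=
      ⟨d 0, fun i => d i.succ, (Fin.cons_self_tail d).symm⟩
    have hx : x ∈ 𝒱 a := by simpa using hv 0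
    have hu : ∀ i, u i ∈ 𝒱 (e i) := fun i => by simpa using hv i.succ
    have h1 : F.curryLeft x ∈ superAlt 𝒱 n := ih <| by
      have h := hF.contract (a, x)
      rwa [contract_toListMap_succ, proj_self hx] at h
    have h2 := mem_superAlt_iff.1 h1 τ e u hu
    rw [MultilinearMap.curryLeft_apply, MultilinearMap.curryLeft_apply,
      insertNth_of_isAltListMap hF p hx fun i => hu (τ i)] at h2
    dsimp only
    rw [h2, eps_insPerm, apply_insPerm, smul_smul, mul_comm]

theorem isCochainListMap_toListMap {n : ℕ} {F : MultilinearMap K (fun _ : Fin (n + 1) => V) V}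
    (hF : F ∈ superAlt 𝒱 (n + 1)) : IsCochainListMap K n (toListMap 𝒱 (n + 1) F) :=
  ⟨isLinearListMap_toListMap 𝒱 _ F, hasLengthParity_toListMap 𝒱 n F, isAltListMap_toListMap hF⟩

theorem toListMap_homPart {n : ℕ} (β : ZMod 2) (F : MultilinearMap K (fun _ : Fin n => V) V)
    (l : List (ZMod 2 × V)) : toListMap 𝒱 n (homPart 𝒱 β F) l =
      proj 𝒱 ((l.map Prod.fst).sum + β) (toListMap 𝒱 n F l) := by
  by_cases hl : l.length = n
  · obtain ⟨w, rfl⟩ : ∃ w : Fin n → ZMod 2 × V, l = List.ofFn w := by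
      rw [← hl]
      exact ⟨l.get, (List.ofFn_get l).symm⟩
    rw [toListMap_ofFn, toListMap_ofFn, homPart_apply_of_mem β F fun i => proj_mem 𝒱 _ _,
      List.map_ofFn, List.sum_ofFn]
    rfl
  · rw [toListMap_eq_zero_of_length 𝒱 _ _ l hl, toListMap_eq_zero_of_length 𝒱 _ _ l hl, map_zero]

/-- The projection depends only on the total degree of the arguments, which an exchange does not
change. -/
theorem homPart_mem_superAlt {n : ℕ} (β : ZMod 2) {F : MultilinearMap K (fun _ : Fin n => V) V}
    (hF : F ∈ superAlt 𝒱 n) : homPart 𝒱 β F ∈ superAlt 𝒱 n := by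
  refine mem_superAlt_of_isAltListMap fun l₁ x y l₂ => ?_
  rw [toListMap_homPart, toListMap_homPart, isAltListMap_toListMap hF l₁ x y l₂, map_neg, map_smul]
  simp only [List.map_append, List.map_cons, List.sum_append, List.sum_cons, add_left_comm x.1]

/-- Passing to lists avoids multiplying shuffles by arbitrary permutations. -/
theorem circ_mem_superAlt {n m : ℕ} {F : MultilinearMap K (fun _ : Fin (n + 1) => V) V}
    {G : MultilinearMap K (fun _ : Fin (m + 1) => V) V} (hF : F ∈ superAlt 𝒱 (n + 1))
    (hG : G ∈ superAlt 𝒱 (m + 1)) : circ 𝒱 n m F G ∈ superAlt 𝒱 (n + m + 1) := by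
  rw [← sum_homPart (𝒱 := 𝒱) G, map_sum]
  refine Submodule.sum_mem _ fun β _ => mem_superAlt_of_isAltListMap ?_
  rw [toListMap_circ F (homPart_mem β G)]
  exact (isAltListMap_toListMap hF).listMul
    (isAltListMap_toListMap (homPart_mem_superAlt β hG)) (isLinearListMap_toListMap 𝒱 _ F) _ _

theorem circ_mem_homogeneous {n m : ℕ} {α β : ZMod 2}
    {F : MultilinearMap K (fun _ : Fin (n + 1) => V) V}
    {G : MultilinearMap K (fun _ : Fin (m + 1) => V) V}
    (hF : F ∈ homogeneous 𝒱 (n + 1) α) (hG : G ∈ homogeneous 𝒱 (m + 1) β) :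
    circ 𝒱 n m F G ∈ homogeneous 𝒱 (n + m + 1) (α + β) := by
  intro d v hv
  rw [circ_apply_of_mem F hG hv, compSum]
  refine Submodule.sum_mem _ fun σ _ => ?_
  split_ifs
  · refine Submodule.smul_mem _ _ ?_
    have h1 := hG _ _ fun j => hv (σ (Fin.cast rfl (Fin.natAdd n j)))
    have h2 := hF (Fin.snoc (α := fun _ => ZMod 2)
      (fun i => d (σ (Fin.cast rfl (Fin.castAdd (m + 1) i)))) _) (Fin.snoc (α := fun _ => V)
      (fun i => v (σ (Fin.cast rfl (Fin.castAdd (m + 1) i)))) _) fun i => by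
        induction i using Fin.lastCases with
        | last =>
          rw [Fin.snoc_last, Fin.snoc_last]
          exact h1
        | cast i =>
          rw [Fin.snoc_castSucc, Fin.snoc_castSucc]
          exact hv _
    rw [Fin.sum_univ_castSucc] at h2
    simp only [Fin.snoc_castSucc, Fin.snoc_last] at h2
    convert h2 using 2
    have h3 := (Equiv.sum_comp σ d).symm.trans
      (Fin.sum_univ_add (a := n) (b := m + 1) fun i => d (σ i))
    refine (congrArg (· + (α + β)) h3).trans ?_
    simp only [Fin.cast_eq_self]
    ring
  · exact Submodule.zero_mem _

end Homogeneous

/-! ### The direct sum over all arities and its bracket. -/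

section Multi

variable {K : Type*} [Field K] {V : Type*} [AddCommGroup V] [Module K V]

theorem component_incl_self (s : ℕ) (F : MultilinearMap K (fun _ : Fin (s + 1) => V) V) :
    component s (incl s F) = F :=
  DirectSum.component.lof_self K (M := fun s => MultilinearMap K (fun _ : Fin (s + 1) => V) V) s F

theorem component_incl_of_ne {s t : ℕ} (h : s ≠ t)
    (F : MultilinearMap K (fun _ : Fin (s + 1) => V) V) : component t (incl s F) = 0 := by
  classical
  exact (DirectSum.component.of K (M := fun s => MultilinearMap K (fun _ : Fin (s + 1) => V) V) t s
    F).trans (dif_neg h)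

theorem Multi.ext {a b : Multi K V} (h : ∀ s, component s a = component s b) : a = b :=
  DirectSum.ext_component K h

theorem exists_sum_incl (a : Multi K V) :
    ∃ t : Finset ℕ, a = ∑ s ∈ t, incl s (component s a) := by
  classical
  exact ⟨DFinsupp.support a, (DirectSum.sum_support_of a).symm⟩

theorem eq_incl_component {s : ℕ} {a : Multi K V} (h : ∀ t, t ≠ s → component t a = 0) :
    a = incl s (component s a) := by
  refine Multi.ext fun t => ?_
  by_cases ht : t = s
  · subst ht
    rw [component_incl_self]
  · rw [h t ht, component_incl_of_ne (Ne.symm ht)]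

variable (𝒱 : ZMod 2 → Submodule K V) [DirectSum.Decomposition 𝒱]

/-- A finite sum of multilinear maps as a map on lists of labelled vectors. -/
noncomputable def multiToListMap : Multi K V →ₗ[K] ListMap V :=
  lift fun s =>
    { toFun := toListMap 𝒱 (s + 1)
      map_add' := toListMap_add 𝒱 (s + 1)
      map_smul' := toListMap_smul 𝒱 (s + 1) }

theorem multiToListMap_incl (s : ℕ) (F : MultilinearMap K (fun _ : Fin (s + 1) => V) V) :
    multiToListMap 𝒱 (incl s F) = toListMap 𝒱 (s + 1) F := lift_incl _ s F

theorem multiToListMap_apply (a : Multi K V) (s : ℕ) (l : List (ZMod 2 × V))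
    (hl : l.length = s + 1) :
    multiToListMap 𝒱 a l = toListMap 𝒱 (s + 1) (component s a) l := by
  obtain ⟨t, ht⟩ := exists_sum_incl a
  have h : ∀ u, multiToListMap 𝒱 (incl u (component u a)) l =
      toListMap 𝒱 (s + 1) (component s (incl u (component u a))) l := by
    intro u
    rw [multiToListMap_incl]
    by_cases hu : u = s
    · subst hu
      rw [component_incl_self]
    · rw [component_incl_of_ne hu, toListMap_eq_zero_of_length 𝒱 _ _ l (by omega),
        show toListMap 𝒱 (s + 1) 0 = 0 by simpa using toListMap_smul 𝒱 (s + 1) (0 : K) 0]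
      rfl
  have h' : ∀ F : MultilinearMap K (fun _ : Fin (s + 1) => V) V, toListMap 𝒱 (s + 1) F l =
      multiToListMap 𝒱 (incl s F) l := fun F => by rw [multiToListMap_incl]
  simp only [h'] at h ⊢
  conv_lhs => rw [ht]
  conv_rhs => rw [ht]
  simp only [map_sum, Finset.sum_apply]
  exact Finset.sum_congr rfl fun u _ => h u

theorem multiToListMap_injective : Function.Injective (multiToListMap (K := K) 𝒱) := by
  intro a b h
  refine Multi.ext fun s => toListMap_injective (𝒱 := 𝒱) (s + 1) (funext fun l => ?_)
  by_cases hl : l.length = s + 1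
  · rw [← multiToListMap_apply 𝒱 a s l hl, h, multiToListMap_apply 𝒱 b s l hl]
  · rw [toListMap_eq_zero_of_length 𝒱 _ _ l hl, toListMap_eq_zero_of_length 𝒱 _ _ l hl]

variable {𝒱}

theorem bracket_incl_of_mem {n m : ℕ} {α β : ZMod 2}
    {F : MultilinearMap K (fun _ : Fin (n + 1) => V) V}
    {G : MultilinearMap K (fun _ : Fin (m + 1) => V) V}
    (hF : F ∈ homogeneous 𝒱 (n + 1) α) (hG : G ∈ homogeneous 𝒱 (m + 1) β) :
    bracket 𝒱 (incl n F) (incl m G) = incl (n + m) (circ 𝒱 n m F G) -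
      sgn K (n * m + α * β) • incl (m + n) (circ 𝒱 m n G F) := by
  rw [bracket_incl, bracketAux]
  simp only [LinearMap.sub_apply, LinearMap.compr₂_apply, LinearMap.sum_apply,
    LinearMap.smul_apply, LinearMap.compl₁₂_apply, LinearMap.flip_apply]
  rw [Fintype.sum_eq_single α, Fintype.sum_eq_single β]
  · rw [homPart_of_mem α hF, homPart_of_mem β hG, if_pos rfl, if_pos rfl]
  · intro γ hγ
    rw [homPart_of_mem γ hG, if_neg hγ]
    simp
  · intro γ hγ
    rw [homPart_of_mem γ hF, if_neg hγ]
    simp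

theorem multiToListMap_bracket {n m : ℕ} {α β : ZMod 2}
    {F : MultilinearMap K (fun _ : Fin (n + 1) => V) V}
    {G : MultilinearMap K (fun _ : Fin (m + 1) => V) V}
    (hF : F ∈ homogeneous 𝒱 (n + 1) α) (hG : G ∈ homogeneous 𝒱 (m + 1) β) :
    multiToListMap 𝒱 (bracket 𝒱 (incl n F) (incl m G)) =
      listBracket K n m α β (toListMap 𝒱 (n + 1) F) (toListMap 𝒱 (m + 1) G) := by
  rw [bracket_incl_of_mem hF hG, map_sub, map_smul, multiToListMap_incl, multiToListMap_incl,
    toListMap_circ F hG, toListMap_circ G hF, listBracket]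

theorem bracket_incl_skew {n m : ℕ} {α β : ZMod 2}
    {F : MultilinearMap K (fun _ : Fin (n + 1) => V) V}
    {G : MultilinearMap K (fun _ : Fin (m + 1) => V) V}
    (hF : F ∈ homogeneous 𝒱 (n + 1) α) (hG : G ∈ homogeneous 𝒱 (m + 1) β) :
    bracket 𝒱 (incl n F) (incl m G) =
      -(sgn K (n * m + α * β) • bracket 𝒱 (incl m G) (incl n F)) := by
  rw [bracket_incl_of_mem hF hG, bracket_incl_of_mem hG hF, mul_comm (m : ZMod 2), mul_comm β,
    smul_sub, smul_smul, sgn_mul_self, one_smul, neg_sub]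

/-- The bracket of two homogeneous elements is given by one multilinear map. -/
theorem exists_bracket_eq_incl {n m : ℕ} {α β : ZMod 2}
    {F : MultilinearMap K (fun _ : Fin (n + 1) => V) V}
    {G : MultilinearMap K (fun _ : Fin (m + 1) => V) V}
    (hF : F ∈ homogeneous 𝒱 (n + 1) α) (hG : G ∈ homogeneous 𝒱 (m + 1) β)
    (C : ∀ s, Submodule K (MultilinearMap K (fun _ : Fin (s + 1) => V) V))
    (hFG : circ 𝒱 n m F G ∈ C (n + m)) (hGF : circ 𝒱 m n G F ∈ C (m + n)) :
    ∃ E : MultilinearMap K (fun _ : Fin (n + m + 1) => V) V,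
      bracket 𝒱 (incl n F) (incl m G) = incl (n + m) E ∧ E ∈ C (n + m) ∧
        E ∈ homogeneous 𝒱 (n + m + 1) (α + β) ∧ toListMap 𝒱 (n + m + 1) E =
          listBracket K n m α β (toListMap 𝒱 (n + 1) F) (toListMap 𝒱 (m + 1) G) := by
  -- The two compositions have `n + m + 1` and `m + n + 1` arguments, which are different types; the
  -- second is transported to the first.
  have key : ∀ {s t : ℕ} (_ : t = s) (B : MultilinearMap K (fun _ : Fin (t + 1) => V) V),
      ∃ B' : MultilinearMap K (fun _ : Fin (s + 1) => V) V, incl t B = incl s B' ∧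
        (B ∈ C t → B' ∈ C s) ∧ ∀ γ, B ∈ homogeneous 𝒱 (t + 1) γ → B' ∈ homogeneous 𝒱 (s + 1) γ := by
    rintro s t rfl B
    exact ⟨B, rfl, id, fun _ => id⟩
  obtain ⟨B, hB, hC, hH⟩ := key (add_comm m n) (circ 𝒱 m n G F)
  have h : bracket 𝒱 (incl n F) (incl m G) =
      incl (n + m) (circ 𝒱 n m F G - sgn K (n * m + α * β) • B) := by
    rw [bracket_incl_of_mem hF hG, hB, map_sub, map_smul]
  have hGF' := circ_mem_homogeneous hG hF
  rw [add_comm β α] at hGF'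
  refine ⟨_, h, Submodule.sub_mem _ hFG (Submodule.smul_mem _ _ (hC hGF)),
    Submodule.sub_mem _ (circ_mem_homogeneous hF hG) (Submodule.smul_mem _ _ (hH _ hGF')), ?_⟩
  rw [← multiToListMap_incl, ← h, multiToListMap_bracket hF hG]

theorem exists_bracket_eq_incl_superAlt {n m : ℕ} {α β : ZMod 2}
    {F : MultilinearMap K (fun _ : Fin (n + 1) => V) V}
    {G : MultilinearMap K (fun _ : Fin (m + 1) => V) V}
    (hF : F ∈ homogeneous 𝒱 (n + 1) α) (hG : G ∈ homogeneous 𝒱 (m + 1) β)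
    (hF' : F ∈ superAlt 𝒱 (n + 1)) (hG' : G ∈ superAlt 𝒱 (m + 1)) :
    ∃ E : MultilinearMap K (fun _ : Fin (n + m + 1) => V) V,
      bracket 𝒱 (incl n F) (incl m G) = incl (n + m) E ∧ E ∈ superAlt 𝒱 (n + m + 1) ∧
        E ∈ homogeneous 𝒱 (n + m + 1) (α + β) ∧ toListMap 𝒱 (n + m + 1) E =
          listBracket K n m α β (toListMap 𝒱 (n + 1) F) (toListMap 𝒱 (m + 1) G) :=
  exists_bracket_eq_incl hF hG (fun s => superAlt 𝒱 (s + 1)) (circ_mem_superAlt hF' hG')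
    (circ_mem_superAlt hG' hF')

/-- Symmetry of the maps is essential here: it is a hypothesis of the pre-Lie identity on lists. The
inner brackets are single multilinear maps, so the outer ones translate to lists as well. -/
theorem bracket_incl_jacobi {n m p : ℕ} {α β γ : ZMod 2}
    {F : MultilinearMap K (fun _ : Fin (n + 1) => V) V}
    {G : MultilinearMap K (fun _ : Fin (m + 1) => V) V}
    {H : MultilinearMap K (fun _ : Fin (p + 1) => V) V}
    (hF : F ∈ homogeneous 𝒱 (n + 1) α) (hG : G ∈ homogeneous 𝒱 (m + 1) β)
    (hH : H ∈ homogeneous 𝒱 (p + 1) γ) (hF' : F ∈ superAlt 𝒱 (n + 1))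
    (hG' : G ∈ superAlt 𝒱 (m + 1)) (hH' : H ∈ superAlt 𝒱 (p + 1)) :
    bracket 𝒱 (incl n F) (bracket 𝒱 (incl m G) (incl p H)) =
      bracket 𝒱 (bracket 𝒱 (incl n F) (incl m G)) (incl p H) +
        sgn K (n * m + α * β) • bracket 𝒱 (incl m G) (bracket 𝒱 (incl n F) (incl p H)) := by
  obtain ⟨A, hA, -, hA1, hA2⟩ := exists_bracket_eq_incl_superAlt hG hH hG' hH'
  obtain ⟨B, hB, -, hB1, hB2⟩ := exists_bracket_eq_incl_superAlt hF hG hF' hG'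
  obtain ⟨C, hC, -, hC1, hC2⟩ := exists_bracket_eq_incl_superAlt hF hH hF' hH'
  refine multiToListMap_injective 𝒱 ?_
  rw [hA, hB, hC, map_add, map_smul, multiToListMap_bracket hF hA1, multiToListMap_bracket hB1 hH,
    multiToListMap_bracket hG hC1, hA2, hB2, hC2, Nat.cast_add, Nat.cast_add, Nat.cast_add]
  exact listBracket_jacobi (isCochainListMap_toListMap hF') (isCochainListMap_toListMap hG')
    (isCochainListMap_toListMap hH')

theorem bracket_incl_bracket_incl_self {p : ℕ} {γ : ZMod 2}
    {P : MultilinearMap K (fun _ : Fin (1 + 1) => V) V}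
    {H : MultilinearMap K (fun _ : Fin (p + 1) => V) V}
    (hP : P ∈ homogeneous 𝒱 (1 + 1) 0) (hH : H ∈ homogeneous 𝒱 (p + 1) γ)
    (hP' : P ∈ superAlt 𝒱 (1 + 1)) (hH' : H ∈ superAlt 𝒱 (p + 1))
    (hsq : listMul K 1 0 (toListMap 𝒱 (1 + 1) P) (toListMap 𝒱 (1 + 1) P) = 0) :
    bracket 𝒱 (incl 1 P) (bracket 𝒱 (incl 1 P) (incl p H)) = 0 := by
  obtain ⟨A, hA, -, hA1, hA2⟩ := exists_bracket_eq_incl_superAlt hP hH hP' hH'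
  refine multiToListMap_injective 𝒱 ?_
  have hP1 := isCochainListMap_toListMap hP'
  rw [Nat.cast_one] at hP1
  rw [hA, multiToListMap_bracket hP hA1, hA2, map_zero, Nat.cast_add, Nat.cast_one]
  -- The `rfl` is the vanishing of `P`, a map of two arguments, on the empty list.
  exact listBracket_listBracket_self hP1 (isCochainListMap_toListMap hH') rfl hsq

theorem bracket_incl_self {P : MultilinearMap K (fun _ : Fin (1 + 1) => V) V}
    (hP : P ∈ homogeneous 𝒱 (1 + 1) 0)
    (hsq : listMul K 1 0 (toListMap 𝒱 (1 + 1) P) (toListMap 𝒱 (1 + 1) P) = 0) :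
    bracket 𝒱 (incl 1 P) (incl 1 P) = 0 := by
  refine multiToListMap_injective 𝒱 ?_
  rw [multiToListMap_bracket hP hP, listBracket, Nat.cast_one, hsq, smul_zero, sub_zero, map_zero]

end Multi

/-! ### Maps preserving `g` and `h` -/

section Stable

open Equiv

variable {K : Type*} [Field K] {g h : Type*} [AddCommGroup g] [Module K g] [AddCommGroup h]
  [Module K h]

/-- The multilinear maps on `g × h` for which `g` is a subalgebra and `h` is an ideal. -/
def stableMaps (K g h : Type*) [Field K] [AddCommGroup g] [Module K g] [AddCommGroup h]
    [Module K h] (n : ℕ) : Submodule K (MultilinearMap K (fun _ : Fin n => g × h) (g × h)) where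
  carrier := {F | (∀ v, (∀ i, (v i).2 = 0) → (F v).2 = 0) ∧ ∀ v i, (v i).1 = 0 → (F v).1 = 0}
  add_mem' hF hG := ⟨fun v hv => by simp [hF.1 v hv, hG.1 v hv],
    fun v i hi => by simp [hF.2 v i hi, hG.2 v i hi]⟩
  zero_mem' := ⟨fun _ _ => rfl, fun _ _ _ => rfl⟩
  smul_mem' c F hF := ⟨fun v hv => by simp [hF.1 v hv], fun v i hi => by simp [hF.2 v i hi]⟩

/-- The entry `x` is replaced by its component in `h` or in `g`. -/
def splitEntry (K g h : Type*) [Field K] [AddCommGroup g] [Module K g] [AddCommGroup h]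
    [Module K h] (p : Prop) [Decidable p] : g × h →ₗ[K] g × h :=
  if p then LinearMap.inr K g h ∘ₗ LinearMap.snd K g h
  else LinearMap.inl K g h ∘ₗ LinearMap.fst K g h

theorem splitEntry_of_pos {p : Prop} [Decidable p] (hp : p) (x : g × h) :
    splitEntry K g h p x = (0, x.2) := by
  rw [splitEntry, if_pos hp]
  rfl

theorem splitEntry_of_neg {p : Prop} [Decidable p] (hp : ¬ p) (x : g × h) :
    splitEntry K g h p x = (x.1, 0) := by
  rw [splitEntry, if_neg hp]
  rfl

theorem splitEntry_mem {𝒢 : ZMod 2 → Submodule K g} {ℋ : ZMod 2 → Submodule K h} (p : Prop)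
    [Decidable p] {α : ZMod 2} {x : g × h}
    (hx : x ∈ prodGrading 𝒢 ℋ α) : splitEntry K g h p x ∈ prodGrading 𝒢 ℋ α := by
  by_cases hp : p
  · rw [splitEntry_of_pos hp]
    exact ⟨Submodule.zero_mem _, hx.2⟩
  · rw [splitEntry_of_neg hp]
    exact ⟨hx.1, Submodule.zero_mem _⟩

variable {𝒢 : ZMod 2 → Submodule K g} {ℋ : ZMod 2 → Submodule K h}
  [DirectSum.Decomposition 𝒢] [DirectSum.Decomposition ℋ]

theorem proj_prodGrading (α : ZMod 2) (x : g × h) :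
    proj (prodGrading 𝒢 ℋ) α x = (proj 𝒢 α x.1, proj ℋ α x.2) := by
  have hx : x = ∑ β, (proj 𝒢 β x.1, proj ℋ β x.2) := by
    refine Prod.ext ?_ ?_
    · rw [Prod.fst_sum]
      exact (sum_proj 𝒢 x.1).symm
    · rw [Prod.snd_sum]
      exact (sum_proj ℋ x.2).symm
  have hm : ∀ β, (proj 𝒢 β x.1, proj ℋ β x.2) ∈ prodGrading 𝒢 ℋ β := fun β =>
    ⟨proj_mem 𝒢 β x.1, proj_mem ℋ β x.2⟩
  conv_lhs => rw [hx]
  rw [map_sum, Fintype.sum_eq_single α fun β hβ => proj_eq_zero (hm β) (Ne.symm hβ),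
    proj_self (hm α)]

theorem proj_snd_eq_zero (α : ZMod 2) {x : g × h} (hx : x.2 = 0) :
    (proj (prodGrading 𝒢 ℋ) α x).2 = 0 := by
  rw [proj_prodGrading, hx, map_zero]

theorem proj_fst_eq_zero (α : ZMod 2) {x : g × h} (hx : x.1 = 0) :
    (proj (prodGrading 𝒢 ℋ) α x).1 = 0 := by
  rw [proj_prodGrading, hx, map_zero]

theorem permAct_mem_stableMaps {n : ℕ} (σ : Perm (Fin n))
    {F : MultilinearMap K (fun _ : Fin n => g × h) (g × h)} (hF : F ∈ stableMaps K g h n) :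
    permAct (prodGrading 𝒢 ℋ) σ F ∈ stableMaps K g h n := by
  constructor
  · intro v hv
    rw [permAct_apply, Prod.snd_sum]
    refine Finset.sum_eq_zero fun d _ => ?_
    rw [Prod.smul_snd, hF.1 _ fun i => proj_snd_eq_zero _ (hv _), smul_zero]
  · intro v i hi
    rw [permAct_apply, Prod.fst_sum]
    refine Finset.sum_eq_zero fun d _ => ?_
    rw [Prod.smul_fst, hF.2 _ (σ.symm i) (proj_fst_eq_zero _ (by simpa using hi)), smul_zero]

theorem homPart_mem_stableMaps {n : ℕ} (β : ZMod 2)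
    {F : MultilinearMap K (fun _ : Fin n => g × h) (g × h)} (hF : F ∈ stableMaps K g h n) :
    homPart (prodGrading 𝒢 ℋ) β F ∈ stableMaps K g h n := by
  constructor
  · intro v hv
    rw [homPart_apply, Prod.snd_sum]
    exact Finset.sum_eq_zero fun d _ =>
      proj_snd_eq_zero _ (hF.1 _ fun i => proj_snd_eq_zero _ (hv _))
  · intro v i hi
    rw [homPart_apply, Prod.fst_sum]
    exact Finset.sum_eq_zero fun d _ => proj_fst_eq_zero _ (hF.2 _ i (proj_fst_eq_zero _ hi))

/-- If all entries lie in g, so does the value of `G`, and then that of `F`. An entry from h is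
either an entry of `F` or puts the value of `G` into h; in both cases `F` takes a value in h. -/
theorem starMul_mem_stableMaps {n m : ℕ}
    {F : MultilinearMap K (fun _ : Fin (n + 1) => g × h) (g × h)}
    {G : MultilinearMap K (fun _ : Fin m => g × h) (g × h)}
    (hF : F ∈ stableMaps K g h (n + 1)) (hG : G ∈ stableMaps K g h m) :
    starMul (prodGrading 𝒢 ℋ) F G ∈ stableMaps K g h (n + m) := by
  have hG' := fun β => homPart_mem_stableMaps (𝒢 := 𝒢) (ℋ := ℋ) β hG
  constructor
  · intro v hv
    rw [starMul_apply, Prod.snd_sum]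
    refine Finset.sum_eq_zero fun β _ => ?_
    rw [Prod.snd_sum]
    refine Finset.sum_eq_zero fun d _ => ?_
    rw [Prod.smul_snd, hF.1 _ fun i => ?_, smul_zero]
    induction i using Fin.lastCases with
    | last =>
      rw [Fin.snoc_last]
      exact (hG' β).1 _ fun j => hv _
    | cast i =>
      rw [Fin.snoc_castSucc]
      exact proj_snd_eq_zero _ (hv _)
  · intro v i hi
    rw [starMul_apply, Prod.fst_sum]
    refine Finset.sum_eq_zero fun β _ => ?_
    rw [Prod.fst_sum]
    refine Finset.sum_eq_zero fun d _ => ?_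
    rw [Prod.smul_fst]
    induction i using Fin.addCases with
    | left i =>
      rw [hF.2 _ i.castSucc (by rw [Fin.snoc_castSucc]; exact proj_fst_eq_zero _ hi), smul_zero]
    | right j =>
      rw [hF.2 _ (Fin.last n) (by rw [Fin.snoc_last]; exact (hG' β).2 _ j hi), smul_zero]

theorem circ_mem_stableMaps {n m : ℕ}
    {F : MultilinearMap K (fun _ : Fin (n + 1) => g × h) (g × h)}
    {G : MultilinearMap K (fun _ : Fin (m + 1) => g × h) (g × h)}
    (hF : F ∈ stableMaps K g h (n + 1)) (hG : G ∈ stableMaps K g h (m + 1)) :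
    circ (prodGrading 𝒢 ℋ) n m F G ∈ stableMaps K g h (n + m + 1) := by
  rw [circ_apply]
  exact Submodule.sum_mem _ fun σ _ =>
    permAct_mem_stableMaps (n := n + (m + 1)) σ (starMul_mem_stableMaps hF hG)

theorem apply_eq_sum_splitEntry {n : ℕ} (F : MultilinearMap K (fun _ : Fin n => g × h) (g × h))
    (v : Fin n → g × h) :
    F v = ∑ S : Finset (Fin n), F fun i => splitEntry K g h (i ∈ S) (v i) := by
  have hv : v = (fun i => ((0, (v i).2) : g × h)) + fun i => ((v i).1, 0) :=
    funext fun i => by simp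
  conv_lhs => rw [hv, MultilinearMap.map_add_univ]
  refine Finset.sum_congr rfl fun S _ => congrArg F (funext fun i => ?_)
  by_cases hi : i ∈ S
  · rw [Finset.piecewise_eq_of_mem _ _ _ hi, splitEntry_of_pos hi]
  · rw [Finset.piecewise_eq_of_notMem _ _ _ hi, splitEntry_of_neg hi]

/-- The part of a multilinear map on `g × h` with `j` arguments from `h`. -/
def splitPart {n : ℕ} (j : ℕ) (F : MultilinearMap K (fun _ : Fin n => g × h) (g × h)) :
    MultilinearMap K (fun _ : Fin n => g × h) (g × h) :=
  ∑ S : Finset (Fin n) with S.card = j, F.compLinearMap fun i => splitEntry K g h (i ∈ S)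

theorem splitPart_apply {n : ℕ} (j : ℕ) (F : MultilinearMap K (fun _ : Fin n => g × h) (g × h))
    (v : Fin n → g × h) : splitPart j F v =
      ∑ S : Finset (Fin n) with S.card = j, F fun i => splitEntry K g h (i ∈ S) (v i) := by
  simp [splitPart]

theorem sum_splitPart {n : ℕ} (F : MultilinearMap K (fun _ : Fin n => g × h) (g × h)) :
    ∑ j ∈ Finset.range (n + 1), splitPart j F = F := by
  refine MultilinearMap.ext fun v => ?_
  rw [sum_apply, apply_eq_sum_splitEntry F v]
  simp only [splitPart_apply]
  exact Finset.sum_fiberwise_of_maps_to (fun S _ => Finset.mem_range_succ_iff.2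
    ((Finset.card_le_univ S).trans_eq (Fintype.card_fin n))) _

/-- Taking components in g and h preserves degrees, hence signs, and a permutation of the arguments
permutes the sets `S` of given size. -/
theorem splitPart_mem_superAlt {n : ℕ} (j : ℕ)
    {F : MultilinearMap K (fun _ : Fin n => g × h) (g × h)}
    (hF : F ∈ superAlt (prodGrading 𝒢 ℋ) n) : splitPart j F ∈ superAlt (prodGrading 𝒢 ℋ) n := by
  refine mem_superAlt_iff.2 fun σ d v hv => ?_
  rw [splitPart_apply, splitPart_apply, Finset.smul_sum]
  refine Finset.sum_equiv σ.symm.finsetCongr (fun S => by simp) fun S _ => ?_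
  rw [mem_superAlt_iff.1 hF σ d _ fun i => splitEntry_mem (i ∈ S) (hv i)]
  congr 2
  funext i
  by_cases hi : σ i ∈ S
  · rw [splitEntry_of_pos hi, splitEntry_of_pos (by simpa using hi)]
  · rw [splitEntry_of_neg hi, splitEntry_of_neg (by simpa using hi)]

theorem splitPart_eq_zero {n : ℕ} {j : ℕ} (F : MultilinearMap K (fun _ : Fin n => g × h) (g × h))
    {v : Fin n → g × h} {S : Finset (Fin n)} (h₁ : ∀ i ∈ S, (v i).1 = 0)
    (h₂ : ∀ i ∉ S, (v i).2 = 0) (hS : S.card ≠ j) : splitPart j F v = 0 := by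
  rw [splitPart_apply]
  refine Finset.sum_eq_zero fun T hT => ?_
  rw [Finset.mem_filter] at hT
  obtain ⟨i, hi⟩ : ∃ i, ¬ (i ∈ S ↔ i ∈ T) := by
    by_contra hST
    push Not at hST
    exact hS (by rw [Finset.ext hST, hT.2])
  refine F.map_coord_zero i ?_
  by_cases hiT : i ∈ T
  · rw [splitEntry_of_pos hiT, h₂ i (by tauto)]
    rfl
  · rw [splitEntry_of_neg hiT, h₁ i (by tauto)]
    rfl

/-- This trades a sum of subspaces for a condition that composition visibly preserves. Conversely, a
stable map splits by the number of entries from h: the part with none has values in g, every other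
part has values in h. -/
theorem mem_actComponent_iff {s : ℕ}
    {F : MultilinearMap K (fun _ : Fin (s + 1) => g × h) (g × h)} :
    F ∈ actComponent 𝒢 ℋ s ↔
      F ∈ superAlt (prodGrading 𝒢 ℋ) (s + 1) ∧ F ∈ stableMaps K g h (s + 1) := by
  constructor
  · suffices hle : actComponent 𝒢 ℋ s ≤
        superAlt (prodGrading 𝒢 ℋ) (s + 1) ⊓ stableMaps K g h (s + 1) from fun hF => hle hF
    refine sup_le (fun F hF => ⟨hF.1, fun v _ => (hF.2.1 v).2, fun v i hi => ?_⟩)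
      (iSup₂_le fun j hj F hF => ⟨hF.1, fun v hv => ?_, fun v _ _ => (hF.2.1 v).1⟩)
    · rw [apply_eq_sum_splitEntry, Finset.sum_eq_zero, Prod.fst_zero]
      intro S _
      -- Only `S = ∅` could contribute, but there entry `i` is replaced by its component in g, which
      -- is zero.
      by_cases hS : S.card = 0
      · rw [Finset.card_eq_zero] at hS
        refine F.map_coord_zero i ?_
        rw [splitEntry_of_neg (by simp [hS]), hi]
        rfl
      · exact hF.2.2 _ S (fun i hi => by rw [splitEntry_of_pos hi])
          (fun i hi => by rw [splitEntry_of_neg hi]) hS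
    · rw [Finset.mem_Icc] at hj
      rw [hF.2.2 v ∅ (by simp) (fun i _ => hv i) (by rw [Finset.card_empty]; omega), Prod.snd_zero]
  · rintro ⟨h₁, h₂⟩
    -- The term `j = 0`, the only one with values in g, is split off.
    rw [← sum_splitPart F, Finset.sum_range_succ']
    refine Submodule.add_mem _ (Submodule.sum_mem _ fun j hj => ?_) ?_
    · rw [Finset.mem_range] at hj
      refine Submodule.mem_sup_right (Submodule.mem_iSup_of_mem (j + 1)
        (Submodule.mem_iSup_of_mem (Finset.mem_Icc.2 ⟨by omega, by omega⟩)
        ⟨splitPart_mem_superAlt _ h₁, fun v => ⟨?_, trivial⟩,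
          fun v S hS hS' => splitPart_eq_zero F hS hS'⟩))
      rw [splitPart_apply]
      change _ = (0 : g)
      rw [Prod.fst_sum]
      refine Finset.sum_eq_zero fun S hS => ?_
      rw [Finset.mem_filter] at hS
      obtain ⟨i, hi⟩ : S.Nonempty := Finset.card_pos.1 (by omega)
      exact h₂.2 _ i (by rw [splitEntry_of_pos hi])
    · refine Submodule.mem_sup_left
        ⟨splitPart_mem_superAlt _ h₁, fun v => ⟨trivial, ?_⟩,
          fun v S hS hS' => splitPart_eq_zero F hS hS'⟩
      rw [splitPart_apply]
      change _ = (0 : h)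
      rw [Prod.snd_sum]
      refine Finset.sum_eq_zero fun S hS => ?_
      rw [Finset.mem_filter, Finset.card_eq_zero] at hS
      exact h₂.1 _ fun i => by rw [splitEntry_of_neg (by simp [hS.2])]

end Stable

/-! ### The element Π as the bracket of a semidirect product. -/

section MaurerCartan

open Equiv

variable {K : Type*} [Field K] {g h : Type*} [AddCommGroup g] [Module K g] [AddCommGroup h]
  [Module K h] {𝒢 : ZMod 2 → Submodule K g} {ℋ : ZMod 2 → Submodule K h}
  {π : g →ₗ[K] g →ₗ[K] g} {μ : h →ₗ[K] h →ₗ[K] h} {ρ : g →ₗ[K] Module.End K h}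

variable (π μ ρ) in
/-- The bracket `π + ρ + μ` of elements of degrees `α` and `β`. -/
noncomputable def mcBracket (α β : ZMod 2) (x y : g × h) : g × h :=
  (π x.1 y.1, ρ x.1 y.2 - sgn K (α * β) • ρ y.1 x.2 + μ x.2 y.2)

theorem mcBracket_skew (hρ : IsLieSupAct 𝒢 ℋ π μ ρ) {α β : ZMod 2} {x y : g × h}
    (hx : x ∈ prodGrading 𝒢 ℋ α) (hy : y ∈ prodGrading 𝒢 ℋ β) :
    mcBracket π μ ρ α β x y = -(sgn K (α * β) • mcBracket π μ ρ β α y x) := by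
  refine Prod.ext (hρ.left.skew α β _ _ hx.1 hy.1) ?_
  change _ = -(sgn K (α * β) • _)
  simp only [mcBracket]
  rw [hρ.right.skew α β _ _ hx.2 hy.2, mul_comm β α, smul_add, smul_sub, smul_smul, sgn_mul_self,
    one_smul]
  abel

theorem mcBracket_mem (hρ : IsLieSupAct 𝒢 ℋ π μ ρ) {α β : ZMod 2} {x y : g × h}
    (hx : x ∈ prodGrading 𝒢 ℋ α) (hy : y ∈ prodGrading 𝒢 ℋ β) :
    mcBracket π μ ρ α β x y ∈ prodGrading 𝒢 ℋ (α + β) := by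
  refine ⟨hρ.left.degree _ _ _ _ hx.1 hy.1, Submodule.add_mem _ (Submodule.sub_mem _
    ((hρ.der _ _ hx.1).degree _ _ hy.2) (Submodule.smul_mem _ _ ?_))
    (hρ.right.degree _ _ _ _ hx.2 hy.2)⟩
  rw [add_comm]
  exact (hρ.der _ _ hy.1).degree _ _ hx.2

/-- In the h-component, terms with two entries from g match because `ρ` is a morphism, terms with
one because `ρ` acts by derivations, and terms with none by the Jacobi identity of `μ`. -/
theorem mcBracket_jacobi (hρ : IsLieSupAct 𝒢 ℋ π μ ρ) {α β γ : ZMod 2} {x y z : g × h}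
    (hx : x ∈ prodGrading 𝒢 ℋ α) (hy : y ∈ prodGrading 𝒢 ℋ β) (hz : z ∈ prodGrading 𝒢 ℋ γ) :
    mcBracket π μ ρ α (β + γ) x (mcBracket π μ ρ β γ y z) =
      mcBracket π μ ρ (α + β) γ (mcBracket π μ ρ α β x y) z +
        sgn K (α * β) • mcBracket π μ ρ β (α + γ) y (mcBracket π μ ρ α γ x z) := by
  refine Prod.ext (hρ.left.jacobi α β _ _ _ hx.1 hy.1) ?_
  change _ = _ + sgn K (α * β) • _
  simp only [mcBracket]
  have hxy := LinearMap.congr_fun (hρ.map_bracket α β _ _ hx.1 hy.1) z.2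
  have hxz := LinearMap.congr_fun (hρ.map_bracket α γ _ _ hx.1 hz.1) y.2
  have hyz := LinearMap.congr_fun (hρ.map_bracket β γ _ _ hy.1 hz.1) x.2
  have dx := (hρ.der α _ hx.1).leibniz β y.2 z.2 hy.2
  have dy := (hρ.der β _ hy.1).leibniz α x.2 z.2 hx.2
  have dz := (hρ.der γ _ hz.1).leibniz α x.2 y.2 hx.2
  have hm := hρ.right.jacobi α β x.2 y.2 z.2 hx.2 hy.2
  -- The derivation rule for `z.1` gives `μ (ρ z.1 x.2) y.2`, whereas the double bracket with outer
  -- entry `y` gives the opposite order.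
  have s4 := hρ.right.skew _ _ _ _ ((hρ.der γ _ hz.1).degree _ _ hx.2) hy.2
  simp only [LinearMap.sub_apply, LinearMap.smul_apply, Module.End.mul_apply] at hxy hxz hyz
  simp only [map_add, map_sub, map_smul, LinearMap.add_apply, LinearMap.sub_apply,
    LinearMap.smul_apply, hxy, hxz, hyz, dx, dy, dz, hm, s4, mul_add, add_mul, sgn_add,
    mul_comm β α, mul_comm γ α, mul_comm γ β]
  rcases sgn_eq_one_or K (α * β) with h1 | h1 <;> rcases sgn_eq_one_or K (α * γ) with h2 | h2 <;>
    rcases sgn_eq_one_or K (β * γ) with h3 | h3 <;> simp only [h1, h2, h3] <;> module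

variable [DirectSum.Decomposition 𝒢] [DirectSum.Decomposition ℋ]

theorem ofBilin_apply {V : Type*} [AddCommGroup V] [Module K V] (B : V →ₗ[K] V →ₗ[K] V)
    (v : Fin 2 → V) : ofBilin B v = B (v 0) (v 1) := rfl

variable (𝒢 ℋ π μ ρ) in
/-- The map `π + ρ + μ`. -/
noncomputable def mcMap : MultilinearMap K (fun _ : Fin (1 + 1) => g × h) (g × h) :=
  liftLeft π + liftAct 𝒢 ℋ ρ + liftRight μ

theorem sum_shuffles_one_one {M : Type*} [AddCommMonoid M] (f : Perm (Fin (1 + 1)) → M) :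
    ∑ σ ∈ shuffles 1 1, f σ = f 1 + f (swap 0 1) := by
  have h : shuffles 1 1 = {1, swap 0 1} := by decide
  rw [h, Finset.sum_pair (by decide)]

theorem eps_swap (d : Fin 2 → ZMod 2) : eps K (swap 0 1) d = -sgn K (d 0 * d 1) := by
  have h1 : (swap 0 1 : Perm (Fin (1 + 1))) = insPerm 1 1 := by decide
  have h2 : d = Fin.cons (α := fun _ => ZMod 2) (d 0) fun i => d i.succ :=
    (Fin.cons_self_tail d).symm
  have h3 := eps_insPerm K (1 : Fin (1 + 1)) 1 (d 0) fun i => d i.succ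
  rw [← h1, ← h2] at h3
  rw [h3, eps_one]
  simp

theorem mcMap_apply {d : Fin 2 → ZMod 2} {v : Fin 2 → g × h}
    (hv : ∀ i, v i ∈ prodGrading 𝒢 ℋ (d i)) : mcMap 𝒢 ℋ π μ ρ v =
      (π (v 0).1 (v 1).1, ρ (v 0).1 (v 1).2 - sgn K (d 0 * d 1) • ρ (v 1).1 (v 0).2 +
        μ (v 0).2 (v 1).2) := by
  rw [mcMap, liftAct, sum_shuffles_one_one]
  simp only [add_apply]
  rw [permAct_apply_of_mem 1 _ hv, permAct_apply_of_mem (swap 0 1) _ hv, eps_one, eps_swap]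
  refine Prod.ext ?_ ?_
  · simp [liftLeft, liftRight, ofBilin_apply]
  · simp [liftLeft, liftRight, ofBilin_apply, sub_eq_add_neg]

theorem mcMap_mem_homogeneous (hρ : IsLieSupAct 𝒢 ℋ π μ ρ) :
    mcMap 𝒢 ℋ π μ ρ ∈ homogeneous (prodGrading 𝒢 ℋ) (1 + 1) 0 := by
  intro d v hv
  rw [mcMap_apply hv, add_zero]
  have hd : ∑ i, d i = d 0 + d 1 := Fin.sum_univ_two d
  rw [hd]
  refine ⟨hρ.left.degree _ _ _ _ (hv 0).1 (hv 1).1, Submodule.add_mem _ (Submodule.sub_mem _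
    ((hρ.der _ _ (hv 0).1).degree _ _ (hv 1).2) (Submodule.smul_mem _ _ ?_))
    (hρ.right.degree _ _ _ _ (hv 0).2 (hv 1).2)⟩
  rw [add_comm]
  exact (hρ.der _ _ (hv 1).1).degree _ _ (hv 0).2

theorem mcMap_mem_stableMaps : mcMap 𝒢 ℋ π μ ρ ∈ stableMaps K g h (1 + 1) := by
  refine Submodule.add_mem _ (Submodule.add_mem _ ?_ (Submodule.sum_mem _ fun σ _ =>
    permAct_mem_stableMaps σ ?_)) ?_
  · refine ⟨fun v hv => rfl, fun v i hi => ?_⟩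
    fin_cases i
    · simp_all [liftLeft, ofBilin_apply]
    · simp_all [liftLeft, ofBilin_apply]
  · refine ⟨fun v hv => ?_, fun v i hi => rfl⟩
    simp [ofBilin_apply, hv]
  · refine ⟨fun v hv => ?_, fun v i hi => rfl⟩
    simp [liftRight, ofBilin_apply, hv]

theorem toListMap_mcMap_pair (x y : ZMod 2 × (g × h)) :
    toListMap (prodGrading 𝒢 ℋ) (1 + 1) (mcMap 𝒢 ℋ π μ ρ) [x, y] =
      mcBracket π μ ρ x.1 y.1 (proj (prodGrading 𝒢 ℋ) x.1 x.2)
        (proj (prodGrading 𝒢 ℋ) y.1 y.2) := by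
  have h := toListMap_ofFn (prodGrading 𝒢 ℋ) (1 + 1) (mcMap 𝒢 ℋ π μ ρ) ![x, y]
  rw [mcMap_apply (d := fun i => (![x, y] i).1) fun i => proj_mem _ _ _] at h
  exact h

theorem mcMap_mem_superAlt (hρ : IsLieSupAct 𝒢 ℋ π μ ρ) :
    mcMap 𝒢 ℋ π μ ρ ∈ superAlt (prodGrading 𝒢 ℋ) (1 + 1) := by
  refine mem_superAlt_of_isAltListMap fun l₁ x y l₂ => ?_
  by_cases hl : l₁ = [] ∧ l₂ = []
  · obtain ⟨rfl, rfl⟩ := hl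
    rw [List.nil_append, List.nil_append, toListMap_mcMap_pair, toListMap_mcMap_pair]
    exact mcBracket_skew hρ (proj_mem _ _ _) (proj_mem _ _ _)
  · have h : ∀ x y : ZMod 2 × (g × h), (l₁ ++ x :: y :: l₂).length ≠ 1 + 1 := fun x y h => hl <| by
      simp only [List.length_append, List.length_cons] at h
      exact ⟨List.length_eq_zero_iff.1 (by omega), List.length_eq_zero_iff.1 (by omega)⟩
    rw [toListMap_eq_zero_of_length _ _ _ _ (h x y), toListMap_eq_zero_of_length _ _ _ _ (h y x),
      smul_zero, neg_zero]

theorem mcMap_mem_actComponent (hρ : IsLieSupAct 𝒢 ℋ π μ ρ) :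
    mcMap 𝒢 ℋ π μ ρ ∈ actComponent 𝒢 ℋ 1 :=
  mem_actComponent_iff.2 ⟨mcMap_mem_superAlt hρ, mcMap_mem_stableMaps⟩

/-- On three arguments the composition of Π with itself is the signed sum in the Jacobi identity;
for other lengths it vanishes. -/
theorem listMul_mcMap_self (hρ : IsLieSupAct 𝒢 ℋ π μ ρ) :
    listMul K 1 0 (toListMap (prodGrading 𝒢 ℋ) (1 + 1) (mcMap 𝒢 ℋ π μ ρ))
      (toListMap (prodGrading 𝒢 ℋ) (1 + 1) (mcMap 𝒢 ℋ π μ ρ)) = 0 := by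
  funext l
  by_cases hl : l.length = 3
  · obtain ⟨⟨α, x⟩, ⟨β, y⟩, ⟨γ, z⟩, rfl⟩ := List.length_eq_three.1 hl
    have h0 := fun l => toListMap_eq_zero_of_length (prodGrading 𝒢 ℋ) (1 + 1)
      (mcMap 𝒢 ℋ π μ ρ) l
    have hpx := proj_mem (prodGrading 𝒢 ℋ) α x
    have hpy := proj_mem (prodGrading 𝒢 ℋ) β y
    have hpz := proj_mem (prodGrading 𝒢 ℋ) γ z
    have hj := mcBracket_jacobi hρ hpx hpy hpz
    -- Composition always inserts the inner bracket as the last argument, so [[x, y], z] is written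
    -- with [z, [x, y]].
    rw [mcBracket_skew hρ (mcBracket_mem hρ hpx hpy) hpz] at hj
    simp only [listMul_cons, listMul_nil, contract_apply]
    simp [h0, toListMap_mcMap_pair, proj_self, mcBracket_mem hρ, hpx, hpy, hpz,
      CharTwo.add_self_eq_zero, hj]
  · exact listMul_eq_zero_of_length (toListMap_eq_zero_of_length _ _ _)
      (toListMap_eq_zero_of_length _ _ _) (isLinearListMap_toListMap _ _ _) _ _ l (by omega)

end MaurerCartan

/-! ### The differential graded Lie algebra 𝔉. -/

section Act

variable {K : Type*} [Field K] {g h : Type*} [AddCommGroup g] [Module K g] [AddCommGroup h]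
  [Module K h] {𝒢 : ZMod 2 → Submodule K g} {ℋ : ZMod 2 → Submodule K h}
  [DirectSum.Decomposition 𝒢] [DirectSum.Decomposition ℋ]

theorem incl_mem_actAlgebra {s : ℕ} {F : MultilinearMap K (fun _ : Fin (s + 1) => g × h) (g × h)}
    (hF : F ∈ actComponent 𝒢 ℋ s) : incl s F ∈ actAlgebra 𝒢 ℋ := by
  intro t
  by_cases ht : s = t
  · subst ht
    rwa [component_incl_self]
  · rw [component_incl_of_ne ht]
    exact Submodule.zero_mem _

theorem homPart_mem_actComponent {s : ℕ} (β : ZMod 2)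
    {F : MultilinearMap K (fun _ : Fin (s + 1) => g × h) (g × h)}
    (hF : F ∈ actComponent 𝒢 ℋ s) :
    homPart (prodGrading 𝒢 ℋ) β F ∈ actComponent 𝒢 ℋ s := by
  rw [mem_actComponent_iff] at hF ⊢
  exact ⟨homPart_mem_superAlt β hF.1, homPart_mem_stableMaps β hF.2⟩

theorem circ_mem_actComponent {n m : ℕ}
    {F : MultilinearMap K (fun _ : Fin (n + 1) => g × h) (g × h)}
    {G : MultilinearMap K (fun _ : Fin (m + 1) => g × h) (g × h)}
    (hF : F ∈ actComponent 𝒢 ℋ n) (hG : G ∈ actComponent 𝒢 ℋ m) :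
    circ (prodGrading 𝒢 ℋ) n m F G ∈ actComponent 𝒢 ℋ (n + m) := by
  rw [mem_actComponent_iff] at hF hG ⊢
  exact ⟨circ_mem_superAlt hF.1 hG.1, circ_mem_stableMaps hF.2 hG.2⟩

theorem incl_induction {P : Multi K (g × h) → Prop} (add : ∀ a b, P a → P b → P (a + b))
    {s : ℕ} (hom : ∀ (β : ZMod 2) (F : MultilinearMap K (fun _ : Fin (s + 1) => g × h) (g × h)),
      F ∈ actComponent 𝒢 ℋ s → F ∈ homogeneous (prodGrading 𝒢 ℋ) (s + 1) β → P (incl s F))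
    {F : MultilinearMap K (fun _ : Fin (s + 1) => g × h) (g × h)}
    (hF : F ∈ actComponent 𝒢 ℋ s) : P (incl s F) := by
  have h0 : P 0 := by
    simpa using hom 0 0 (Submodule.zero_mem _) (Submodule.zero_mem _)
  rw [← sum_homPart (𝒱 := prodGrading 𝒢 ℋ) F, map_sum]
  exact Finset.sum_induction _ P add h0 fun β _ =>
    hom β _ (homPart_mem_actComponent β hF) (homPart_mem β F)

/-- Reduces additive statements about 𝔉 to homogeneous maps of one arity, the only ones for which
the bracket has explicit signs. -/
theorem actAlgebra_induction {P : Multi K (g × h) → Prop}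
    (add : ∀ a b, P a → P b → P (a + b))
    (hom : ∀ (s : ℕ) (β : ZMod 2) (F : MultilinearMap K (fun _ : Fin (s + 1) => g × h) (g × h)),
      F ∈ actComponent 𝒢 ℋ s → F ∈ homogeneous (prodGrading 𝒢 ℋ) (s + 1) β → P (incl s F))
    {a : Multi K (g × h)} (ha : a ∈ actAlgebra 𝒢 ℋ) : P a := by
  have h0 : P 0 := by
    simpa using hom 0 0 0 (Submodule.zero_mem _) (Submodule.zero_mem _)
  obtain ⟨t, ht⟩ := exists_sum_incl a
  rw [ht]
  exact Finset.sum_induction _ P add h0 fun s _ => incl_induction add (hom s) (ha s)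

theorem exists_bracket_eq_incl_actComponent {n m : ℕ} {α β : ZMod 2}
    {F : MultilinearMap K (fun _ : Fin (n + 1) => g × h) (g × h)}
    {G : MultilinearMap K (fun _ : Fin (m + 1) => g × h) (g × h)}
    (hF : F ∈ homogeneous (prodGrading 𝒢 ℋ) (n + 1) α)
    (hG : G ∈ homogeneous (prodGrading 𝒢 ℋ) (m + 1) β)
    (hF' : F ∈ actComponent 𝒢 ℋ n) (hG' : G ∈ actComponent 𝒢 ℋ m) :
    ∃ E : MultilinearMap K (fun _ : Fin (n + m + 1) => g × h) (g × h),
      bracket (prodGrading 𝒢 ℋ) (incl n F) (incl m G) = incl (n + m) E ∧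
        E ∈ actComponent 𝒢 ℋ (n + m) ∧
        E ∈ homogeneous (prodGrading 𝒢 ℋ) (n + m + 1) (α + β) := by
  obtain ⟨E, h₁, h₂, h₃, -⟩ := exists_bracket_eq_incl hF hG (fun s => actComponent 𝒢 ℋ s)
    (circ_mem_actComponent hF' hG') (circ_mem_actComponent hG' hF')
  exact ⟨E, h₁, h₂, h₃⟩

theorem bracket_mem_actAlgebra {a b : Multi K (g × h)} (ha : a ∈ actAlgebra 𝒢 ℋ)
    (hb : b ∈ actAlgebra 𝒢 ℋ) : bracket (prodGrading 𝒢 ℋ) a b ∈ actAlgebra 𝒢 ℋ := by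
  refine actAlgebra_induction (P := fun a => bracket (prodGrading 𝒢 ℋ) a b ∈ actAlgebra 𝒢 ℋ)
    (fun a a' h h' => ?_) (fun n α F hF hF' => ?_) ha
  · rw [map_add, LinearMap.add_apply]
    exact Submodule.add_mem _ h h'
  · refine actAlgebra_induction
      (P := fun b => bracket (prodGrading 𝒢 ℋ) (incl n F) b ∈ actAlgebra 𝒢 ℋ)
      (fun b b' h h' => ?_) (fun m β G hG hG' => ?_) hb
    · rw [map_add]
      exact Submodule.add_mem _ h h'
    · obtain ⟨E, h₁, h₂, -⟩ := exists_bracket_eq_incl_actComponent hF' hG' hF hG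
      rw [h₁]
      exact incl_mem_actAlgebra h₂

variable (𝒢 ℋ) in
/-- The bracket of `𝔉`. -/
noncomputable def actBracket :
    actAlgebra 𝒢 ℋ →ₗ[K] actAlgebra 𝒢 ℋ →ₗ[K] actAlgebra 𝒢 ℋ :=
  LinearMap.mk₂ K (fun a b => ⟨bracket (prodGrading 𝒢 ℋ) a b, bracket_mem_actAlgebra a.2 b.2⟩)
    (fun _ _ _ => Subtype.ext (by simp)) (fun _ _ _ => Subtype.ext (by simp))
    (fun _ _ _ => Subtype.ext (by simp)) (fun _ _ _ => Subtype.ext (by simp))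

theorem coe_actBracket (a b : actAlgebra 𝒢 ℋ) :
    (actBracket 𝒢 ℋ a b : Multi K (g × h)) = bracket (prodGrading 𝒢 ℋ) (a : Multi K (g × h)) b :=
  rfl

theorem incl_mem_actGrading {s : ℕ} {β : ZMod 2}
    {F : MultilinearMap K (fun _ : Fin (s + 1) => g × h) (g × h)}
    (hF : F ∈ actComponent 𝒢 ℋ s) (hF' : F ∈ homogeneous (prodGrading 𝒢 ℋ) (s + 1) β) :
    (⟨incl s F, incl_mem_actAlgebra hF⟩ : actAlgebra 𝒢 ℋ) ∈ actGrading 𝒢 ℋ ((s : ℤ), β) := by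
  refine ⟨fun t ht => component_incl_of_ne (fun h => ht (by rw [h])) F, fun t => ?_⟩
  by_cases ht : s = t
  · subst ht
    change component s (incl s F) ∈ _
    rwa [component_incl_self]
  · change component t (incl s F) ∈ _
    rw [component_incl_of_ne ht]
    exact Submodule.zero_mem _

theorem exists_of_mem_actGrading {p : ℤ × ZMod 2} {x : actAlgebra 𝒢 ℋ}
    (hx : x ∈ actGrading 𝒢 ℋ p) : x = 0 ∨ ∃ (n : ℕ)
      (F : MultilinearMap K (fun _ : Fin (n + 1) => g × h) (g × h)), p.1 = n ∧
        F ∈ actComponent 𝒢 ℋ n ∧ F ∈ homogeneous (prodGrading 𝒢 ℋ) (n + 1) p.2 ∧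
        (x : Multi K (g × h)) = incl n F := by
  rcases lt_or_ge p.1 0 with hp | hp
  · refine Or.inl (Subtype.ext (Multi.ext fun s => ?_))
    rw [hx.1 s (by omega), Submodule.coe_zero, map_zero]
  · obtain ⟨n, hn⟩ := Int.eq_ofNat_of_zero_le hp
    exact Or.inr ⟨n, component n (x : Multi K (g × h)), hn, x.2 n, hx.2 n,
      eq_incl_component fun t ht => hx.1 t (by omega)⟩

theorem actGrading_isInternal : DirectSum.IsInternal (actGrading 𝒢 ℋ) := by
  rw [DirectSum.isInternal_submodule_iff_iSupIndep_and_iSup_eq_top]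
  constructor
  · intro p
    rw [Submodule.disjoint_def]
    intro x hx hx'
    rcases exists_of_mem_actGrading hx with rfl | ⟨n, F, hn, -, hF, hxF⟩
    · rfl
    -- Independence: the part of parity `p.2` of component `n` kills every other degree and
    -- determines an element of degree `p`.
    have hle : ⨆ q, ⨆ (_ : q ≠ p), actGrading 𝒢 ℋ q ≤ LinearMap.ker
        (homPart (prodGrading 𝒢 ℋ) p.2 ∘ₗ component n ∘ₗ (actAlgebra 𝒢 ℋ).subtype) := by
      refine iSup₂_le fun q hq y hy => ?_
      change homPart (prodGrading 𝒢 ℋ) p.2 (component n (y : Multi K (g × h))) = 0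
      by_cases h1 : (n : ℤ) = q.1
      · rw [homPart_of_mem p.2 (hy.2 n), if_neg fun h2 => hq (Prod.ext (h1.symm.trans hn.symm)
          h2.symm)]
      · rw [hy.1 n h1, map_zero]
    have h0 : homPart (prodGrading 𝒢 ℋ) p.2 (component n (x : Multi K (g × h))) = 0 := hle hx'
    rw [hxF, component_incl_self, homPart_of_mem p.2 hF, if_pos rfl] at h0
    refine Subtype.ext ?_
    rw [hxF, h0, map_zero, Submodule.coe_zero]
  · rw [eq_top_iff]
    rintro ⟨a, ha⟩ -
    suffices h : a ∈ (⨆ p, actGrading 𝒢 ℋ p).map (actAlgebra 𝒢 ℋ).subtype by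
      obtain ⟨b, hb, hba⟩ := h
      obtain rfl : b = ⟨a, ha⟩ := Subtype.ext hba
      exact hb
    refine actAlgebra_induction (fun a b => Submodule.add_mem _) (fun s β F hF hF' => ?_) ha
    exact ⟨_, Submodule.mem_iSup_of_mem ((s : ℤ), β) (incl_mem_actGrading hF hF'), rfl⟩

theorem degSgn_natCast (n m : ℕ) {p q : ℤ × ZMod 2} (hp : p.1 = n) (hq : q.1 = m) :
    degSgn K p q = sgn K (n * m + p.2 * q.2) := by
  rw [degSgn, hp, hq]
  push_cast
  rfl

theorem actBracket_mem {p q : ℤ × ZMod 2} {x y : actAlgebra 𝒢 ℋ} (hx : x ∈ actGrading 𝒢 ℋ p)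
    (hy : y ∈ actGrading 𝒢 ℋ q) : actBracket 𝒢 ℋ x y ∈ actGrading 𝒢 ℋ (p + q) := by
  rcases exists_of_mem_actGrading hx with rfl | ⟨n, F, hn, hF, hF', hxF⟩
  · rw [map_zero, LinearMap.zero_apply]
    exact Submodule.zero_mem _
  rcases exists_of_mem_actGrading hy with rfl | ⟨m, G, hm, hG, hG', hyG⟩
  · rw [map_zero]
    exact Submodule.zero_mem _
  obtain ⟨E, h₁, h₂, h₃⟩ := exists_bracket_eq_incl_actComponent hF' hG' hF hG
  have h : actBracket 𝒢 ℋ x y = ⟨incl (n + m) E, incl_mem_actAlgebra h₂⟩ :=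
    Subtype.ext (by rw [coe_actBracket, hxF, hyG, h₁])
  have hpq : p + q = (((n + m : ℕ) : ℤ), p.2 + q.2) :=
    Prod.ext (by rw [Prod.fst_add, hn, hm, Nat.cast_add]) rfl
  rw [h, hpq]
  exact incl_mem_actGrading h₂ h₃

theorem actBracket_isGradedLieAlgebra :
    IsGradedLieAlgebra (actGrading 𝒢 ℋ) (actBracket 𝒢 ℋ) where
  internal := actGrading_isInternal
  degree _ _ _ _ hx hy := actBracket_mem hx hy
  skew p q x y hx hy := by
    rcases exists_of_mem_actGrading hx with rfl | ⟨n, F, hn, hF, hF', hxF⟩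
    · simp
    rcases exists_of_mem_actGrading hy with rfl | ⟨m, G, hm, hG, hG', hyG⟩
    · simp
    refine Subtype.ext ?_
    rw [Submodule.coe_neg, Submodule.coe_smul, coe_actBracket, coe_actBracket, hxF, hyG,
      degSgn_natCast n m hn hm]
    exact bracket_incl_skew hF' hG'
  jacobi p q x y z hx hy := by
    rcases exists_of_mem_actGrading hx with rfl | ⟨n, F, hn, hF, hF', hxF⟩
    · simp
    rcases exists_of_mem_actGrading hy with rfl | ⟨m, G, hm, hG, hG', hyG⟩
    · simp
    refine Subtype.ext ?_
    rw [Submodule.coe_add, Submodule.coe_smul]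
    simp only [coe_actBracket]
    rw [hxF, hyG, degSgn_natCast n m hn hm]
    -- The third entry is not assumed homogeneous; both sides are additive in it.
    refine actAlgebra_induction (P := fun z : Multi K (g × h) =>
      bracket (prodGrading 𝒢 ℋ) (incl n F) (bracket (prodGrading 𝒢 ℋ) (incl m G) z) =
        bracket (prodGrading 𝒢 ℋ) (bracket (prodGrading 𝒢 ℋ) (incl n F) (incl m G)) z +
          sgn K (n * m + p.2 * q.2) • bracket (prodGrading 𝒢 ℋ) (incl m G)
            (bracket (prodGrading 𝒢 ℋ) (incl n F) z))
      (fun a b ha hb => ?_) (fun s γ H hH hH' => ?_) z.2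
    · simp only [map_add, ha, hb, smul_add]
      abel
    · have h := bracket_incl_jacobi hF' hG' hH' (mem_actComponent_iff.1 hF).1
        (mem_actComponent_iff.1 hG).1 (mem_actComponent_iff.1 hH).1
      convert h using 2

variable {π : g →ₗ[K] g →ₗ[K] g} {μ : h →ₗ[K] h →ₗ[K] h} {ρ : g →ₗ[K] Module.End K h}

theorem mcElement_eq : mcElement 𝒢 ℋ π μ ρ = incl 1 (mcMap 𝒢 ℋ π μ ρ) := rfl

theorem mcElement_mem_actAlgebra (hρ : IsLieSupAct 𝒢 ℋ π μ ρ) :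
    mcElement 𝒢 ℋ π μ ρ ∈ actAlgebra 𝒢 ℋ := by
  rw [mcElement_eq]
  exact incl_mem_actAlgebra (mcMap_mem_actComponent hρ)

theorem bracket_mcElement_bracket_mcElement (hρ : IsLieSupAct 𝒢 ℋ π μ ρ) {a : Multi K (g × h)}
    (ha : a ∈ actAlgebra 𝒢 ℋ) : bracket (prodGrading 𝒢 ℋ) (mcElement 𝒢 ℋ π μ ρ)
      (bracket (prodGrading 𝒢 ℋ) (mcElement 𝒢 ℋ π μ ρ) a) = 0 := by
  rw [mcElement_eq]
  refine actAlgebra_induction (P := fun a => bracket (prodGrading 𝒢 ℋ) (incl 1 (mcMap 𝒢 ℋ π μ ρ))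
    (bracket (prodGrading 𝒢 ℋ) (incl 1 (mcMap 𝒢 ℋ π μ ρ)) a) = 0)
    (fun a b ha hb => ?_) (fun s γ H hH hH' => ?_) ha
  · rw [map_add, map_add, ha, hb, add_zero]
  · exact bracket_incl_bracket_incl_self (mcMap_mem_homogeneous hρ) hH' (mcMap_mem_superAlt hρ)
      (mem_actComponent_iff.1 hH).1 (listMul_mcMap_self hρ)

theorem bracket_mcElement_self (hρ : IsLieSupAct 𝒢 ℋ π μ ρ) :
    bracket (prodGrading 𝒢 ℋ) (mcElement 𝒢 ℋ π μ ρ) (mcElement 𝒢 ℋ π μ ρ) = 0 := by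
  rw [mcElement_eq]
  exact bracket_incl_self (mcMap_mem_homogeneous hρ) (listMul_mcMap_self hρ)

theorem mcElement_isMaurerCartan (hρ : IsLieSupAct 𝒢 ℋ π μ ρ) :
    IsMaurerCartan (actGrading 𝒢 ℋ) (actBracket 𝒢 ℋ)
      ⟨mcElement 𝒢 ℋ π μ ρ, mcElement_mem_actAlgebra hρ⟩ := by
  constructor
  · exact incl_mem_actGrading (mcMap_mem_actComponent hρ) (mcMap_mem_homogeneous hρ)
  · refine Subtype.ext ?_
    rw [coe_actBracket, Submodule.coe_zero]
    convert bracket_mcElement_self hρ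

theorem actAlgebra_isDGLieAlgebra (hρ : IsLieSupAct 𝒢 ℋ π μ ρ) :
    IsDGLieAlgebra (actGrading 𝒢 ℋ) (actBracket 𝒢 ℋ)
      (actBracket 𝒢 ℋ ⟨mcElement 𝒢 ℋ π μ ρ, mcElement_mem_actAlgebra hρ⟩) where
  graded := actBracket_isGradedLieAlgebra
  derivation :=
    { degree := fun _ _ hx => actBracket_mem (mcElement_isMaurerCartan hρ).degree hx
      leibniz := fun _ _ _ hx =>
        actBracket_isGradedLieAlgebra.jacobi _ _ _ _ _ (mcElement_isMaurerCartan hρ).degree hx }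
  sq_zero x := Subtype.ext (bracket_mcElement_bracket_mcElement hρ x.2)

/-! ### The cochain complex -/

theorem eq_zero_of_mem_cochains_zero {a : Multi K (g × h)} (ha : a ∈ cochains 𝒢 ℋ 0) : a = 0 :=
  Multi.ext fun s => by rw [ha.2 s (Nat.succ_ne_zero s), map_zero]

theorem incl_mem_cochains {s n : ℕ} (hn : s + 1 = n)
    {F : MultilinearMap K (fun _ : Fin (s + 1) => g × h) (g × h)}
    (hF : F ∈ actComponent 𝒢 ℋ s) : incl s F ∈ cochains 𝒢 ℋ n :=
  ⟨incl_mem_actAlgebra hF, fun t ht => component_incl_of_ne (by omega) F⟩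

theorem bracket_mcElement_mem_cochains (hρ : IsLieSupAct 𝒢 ℋ π μ ρ) {n : ℕ}
    {a : Multi K (g × h)} (ha : a ∈ cochains 𝒢 ℋ n) :
    bracket (prodGrading 𝒢 ℋ) (mcElement 𝒢 ℋ π μ ρ) a ∈ cochains 𝒢 ℋ (n + 1) := by
  cases n with
  | zero =>
    rw [eq_zero_of_mem_cochains_zero ha, map_zero]
    exact Submodule.zero_mem _
  | succ n =>
    rw [eq_incl_component fun t ht => ha.2 t fun h => ht (Nat.succ_injective h)]
    rw [mcElement_eq]
    refine incl_induction (P := fun a =>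
      bracket (prodGrading 𝒢 ℋ) (incl 1 (mcMap 𝒢 ℋ π μ ρ)) a ∈ cochains 𝒢 ℋ (n + 1 + 1))
      (fun a b ha hb => ?_) (fun β F hF hF' => ?_) (ha.1 n)
    · rw [map_add]
      exact Submodule.add_mem _ ha hb
    · obtain ⟨E, h₁, h₂, -⟩ := exists_bracket_eq_incl_actComponent (mcMap_mem_homogeneous hρ) hF'
        (mcMap_mem_actComponent hρ) hF
      exact h₁ ▸ incl_mem_cochains (by omega) h₂

/-- The differential `Cⁿ → Cⁿ⁺¹` given by the bracket with `Π`. -/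
noncomputable def cochainsDifferential (hρ : IsLieSupAct 𝒢 ℋ π μ ρ) (n : ℕ) :
    cochains 𝒢 ℋ n →ₗ[K] cochains 𝒢 ℋ (n + 1) :=
  (bracket (prodGrading 𝒢 ℋ) (mcElement 𝒢 ℋ π μ ρ)).restrict
    fun _ => bracket_mcElement_mem_cochains hρ

theorem coe_cochainsDifferential (hρ : IsLieSupAct 𝒢 ℋ π μ ρ) (n : ℕ) (a : cochains 𝒢 ℋ n) :
    (cochainsDifferential hρ n a : Multi K (g × h)) =
      bracket (prodGrading 𝒢 ℋ) (mcElement 𝒢 ℋ π μ ρ) a := rfl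

theorem cochainsDifferential_comp (hρ : IsLieSupAct 𝒢 ℋ π μ ρ) (n : ℕ) :
    cochainsDifferential hρ (n + 1) ∘ₗ cochainsDifferential hρ n = 0 :=
  LinearMap.ext fun a => Subtype.ext (bracket_mcElement_bracket_mcElement hρ a.2.1)

end Act

/-! ### Homology of the complex as cocycles modulo coboundaries. -/

section Homology

open CategoryTheory

universe v u

/-- The homology of a short complex of modules as a subquotient. -/
theorem nonempty_homology_iso_subquotient {K : Type u} [Field K]
    (S : ShortComplex (ModuleCat.{v} K)) {M : Type v} [AddCommGroup M] [Module K M]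
    (Z B : Submodule K M) (e : S.X₂ →ₗ[K] M) (he : Function.Injective e)
    (hZ : (LinearMap.ker S.g.hom).map e = Z) (hB : ∀ x, e x ∈ B ↔ ∃ y, S.f.hom y = x) :
    Nonempty (S.homology ≅ ModuleCat.of K (Subquotient Z B)) := by
  subst hZ
  let e' : LinearMap.ker S.g.hom ≃ₗ[K] (LinearMap.ker S.g.hom).map e :=
    Submodule.equivMapOfInjective e he _
  have h : (LinearMap.range S.moduleCatToCycles).map (e' : _ →ₗ[K] _) =
      B.submoduleOf ((LinearMap.ker S.g.hom).map e) := by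
    ext z
    obtain ⟨x, rfl⟩ := e'.surjective z
    have h1 : e' x ∈ B.submoduleOf ((LinearMap.ker S.g.hom).map e) ↔ e x ∈ B := Iff.rfl
    rw [h1, hB]
    constructor
    · rintro ⟨_, ⟨y, rfl⟩, hy⟩
      exact ⟨y, congrArg Subtype.val (e'.injective hy)⟩
    · rintro ⟨y, hy⟩
      exact ⟨_, ⟨y, rfl⟩, congrArg e' (Subtype.ext hy)⟩
  exact ⟨S.moduleCatHomologyIso ≪≫ (Submodule.Quotient.equiv _ _ e' h).toModuleIso⟩

theorem nonempty_cochains_homology_iso {K : Type*} [Field K] {g h : Type*} [AddCommGroup g]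
    [Module K g] [AddCommGroup h] [Module K h] {𝒢 : ZMod 2 → Submodule K g}
    [DirectSum.Decomposition 𝒢] {ℋ : ZMod 2 → Submodule K h} [DirectSum.Decomposition ℋ]
    {π : g →ₗ[K] g →ₗ[K] g} {μ : h →ₗ[K] h →ₗ[K] h} {ρ : g →ₗ[K] Module.End K h}
    (hρ : IsLieSupAct 𝒢 ℋ π μ ρ)
    (hδ : ∀ n : ℕ, ModuleCat.ofHom (cochainsDifferential hρ n) ≫
      ModuleCat.ofHom (cochainsDifferential hρ (n + 1)) = 0) (n : ℕ) :
    Nonempty ((CochainComplex.of (fun n => ModuleCat.of K (cochains 𝒢 ℋ n))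
      (fun n => ModuleCat.ofHom (cochainsDifferential hρ n)) hδ).homology n ≅
        ModuleCat.of K (cohomology 𝒢 ℋ π μ ρ n)) := by
  set C := CochainComplex.of (fun n => ModuleCat.of K (cochains 𝒢 ℋ n))
      (fun n => ModuleCat.ofHom (cochainsDifferential hρ n)) hδ with hC
  have hd : ∀ n, C.d n (n + 1) = ModuleCat.ofHom (cochainsDifferential hρ n) := fun n =>
    CochainComplex.of_d (fun n => ModuleCat.of K (cochains 𝒢 ℋ n))
      (fun n => ModuleCat.ofHom (cochainsDifferential hρ n)) n
  have hZ : ∀ n, (LinearMap.ker (C.d n (n + 1)).hom).map (cochains 𝒢 ℋ n).subtype =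
      cocycles 𝒢 ℋ π μ ρ n := by
    intro n
    rw [hd]
    ext a
    constructor
    · rintro ⟨x, hx, rfl⟩
      exact ⟨x.2, congrArg Subtype.val hx⟩
    · rintro ⟨ha, ha'⟩
      exact ⟨⟨a, ha⟩, Subtype.ext ha', rfl⟩
  have key : ∀ i, (ComplexShape.up ℕ).prev n = i →
      (∀ x : cochains 𝒢 ℋ n, (x : Multi K (g × h)) ∈ coboundaries 𝒢 ℋ π μ ρ n ↔
        ∃ y, (C.d i n).hom y = x) →
      Nonempty (C.homology n ≅ ModuleCat.of K (cohomology 𝒢 ℋ π μ ρ n)) := by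
    intro i hi hB
    obtain ⟨f⟩ := nonempty_homology_iso_subquotient (C.sc' i n (n + 1)) (cocycles 𝒢 ℋ π μ ρ n)
      (coboundaries 𝒢 ℋ π μ ρ n) (cochains 𝒢 ℋ n).subtype Subtype.val_injective (hZ n) hB
    exact ⟨ShortComplex.homologyMapIso (C.isoSc' i n (n + 1) hi (CochainComplex.next ℕ n)) ≪≫ f⟩
  cases n with
  | zero =>
    -- In `ComplexShape.up ℕ` the predecessor of `0` is `0` by convention; this is harmless because
    -- C⁰ = 0.
    refine key 0 CochainComplex.prev_nat_zero fun x => ?_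
    obtain rfl : x = 0 := Subtype.ext (eq_zero_of_mem_cochains_zero x.2)
    exact ⟨fun _ => ⟨0, map_zero _⟩, fun _ => Submodule.zero_mem _⟩
  | succ n =>
    refine key n (CochainComplex.prev_nat_succ n) fun x => ?_
    rw [hd]
    constructor
    · rintro ⟨y, hy, hyx⟩
      exact ⟨⟨y, hy⟩, Subtype.ext hyx⟩
    · rintro ⟨y, rfl⟩
      exact ⟨y, y.2, rfl⟩

end Homology

end LieSup

open LieSup CategoryTheory in
theorem mainTheorem4 {K : Type*} [Field K] {g h : Type*} [AddCommGroup g] [Module K g]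
    [AddCommGroup h] [Module K h]
    (𝒢 : ZMod 2 → Submodule K g) [DirectSum.Decomposition 𝒢]
    (ℋ : ZMod 2 → Submodule K h) [DirectSum.Decomposition ℋ]
    (π : g →ₗ[K] g →ₗ[K] g) (μ : h →ₗ[K] h →ₗ[K] h) (ρ : g →ₗ[K] Module.End K h)
    (hρ : IsLieSupAct 𝒢 ℋ π μ ρ) :
    (∃ (br : actAlgebra 𝒢 ℋ →ₗ[K] actAlgebra 𝒢 ℋ →ₗ[K] actAlgebra 𝒢 ℋ) (ω : actAlgebra 𝒢 ℋ),
      (∀ a b : actAlgebra 𝒢 ℋ,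
        (br a b : Multi K (g × h)) = bracket (prodGrading 𝒢 ℋ) (a : Multi K (g × h)) b) ∧
      (ω : Multi K (g × h)) = mcElement 𝒢 ℋ π μ ρ ∧
      IsMaurerCartan (actGrading 𝒢 ℋ) br ω ∧
      IsDGLieAlgebra (actGrading 𝒢 ℋ) br (br ω)) ∧
    (∃ δ : ∀ n : ℕ, cochains 𝒢 ℋ n →ₗ[K] cochains 𝒢 ℋ (n + 1),
      (∀ (n : ℕ) (a : cochains 𝒢 ℋ n), (δ n a : Multi K (g × h)) =
        bracket (prodGrading 𝒢 ℋ) (mcElement 𝒢 ℋ π μ ρ) a) ∧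
      ∃ hδ : ∀ n : ℕ, ModuleCat.ofHom (δ n) ≫ ModuleCat.ofHom (δ (n + 1)) = 0,
        ∀ n : ℕ, Nonempty
          ((CochainComplex.of (fun n => ModuleCat.of K (cochains 𝒢 ℋ n))
            (fun n => ModuleCat.ofHom (δ n)) hδ).homology n ≅
              ModuleCat.of K (cohomology 𝒢 ℋ π μ ρ n))) := by
  refine ⟨⟨actBracket 𝒢 ℋ, ⟨mcElement 𝒢 ℋ π μ ρ, mcElement_mem_actAlgebra hρ⟩, coe_actBracket, rfl,
    mcElement_isMaurerCartan hρ, actAlgebra_isDGLieAlgebra hρ⟩, cochainsDifferential hρ,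
    coe_cochainsDifferential hρ, fun n => ?_, fun n => nonempty_cochains_homology_iso hρ _ n⟩
  rw [← ModuleCat.ofHom_comp, cochainsDifferential_comp]
  rfl
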